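/- **Setting.** Let $\mathcal U,\mathcal X,\mathcal Y,\mathcal V$ be finite alphabets, $\bar P_U$ a probability distribution on $\mathcal U$ (the source) and $\bar P_{Y|X}$ a discrete memoryless channel from $\mathcal X$ to $\mathcal Y$. Entropies $H$ and mutual informations $I$ are in bits, and the variational distance is $\mathbb V(P,Q)=\sum_a|P(a)-Q(a)|$. **Codes.** A code of block length $n$ with rate of common randomness $R_0\ge 0$ consists of the following. The common randomness $C$ is uniform on $\{1,\dots,\lfloor 2^{nR_0}\rfloor\}$, the source sequence $U^n$ is i.i.d. with law $\bar P_U$, and $S$ is a finitely valued local randomness of the encoder, drawn once per block with an arbitrary law; $U^n$, $C$, $S$ are independent. The encoder is strictly causal: $X_i=f_i(U^{i-1},C,S)$ for $i=1,\dots,n$ (that is, $f^n=(f_1,\dots,f_n)$ is a random function of $(U^{i-1},C)$, $i=1,\dots,n$). The sequence $X^n$ is sent over the memoryless channel, with output $Y^n$. The decoder is non-causal: it draws $V^n$ from a stochastic map $g^n(\cdot\mid Y^n,C)$. **Strong coordination region.** A pair $(\bar P_{UXYV},R_0)$ of a probability distribution on $\mathcal U\times\mathcal X\times\mathcal Y\times\mathcal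 V$ and a real number $R_0\ge0$ is *achievable* if there is a sequence of codes $(f^n,g^n)_n$ with rate of common randomness $R_0$ such that for every $\varepsilon>0$ there are sets of time indices $A_n\subseteq\{1,\dots,n\}$ with $|A_n|>(1-\varepsilon)n$ for all sufficiently large $n$ and $$\lim_{n\to\infty}\mathbb V\Big(P_{(U_t,X_t,Y_t,V_t)_{t\in A_n}},\ \bar P_{UXYV}^{\otimes |A_n|}\Big)=0 ,$$ where $P$ is the distribution induced by the code. The *strong coordination region* $\mathcal R$ is the closure of the set of achievable pairs. **Theorem.** $\mathcal R_{\rm in}\subseteq\mathcal R\subseteq\mathcal R_{\rm out}$, where $\mathcal R_{\rm in}$ is the set of pairs $(\bar P_{UXYV},R_0)$ such that $\bar P_{UXYV}=\bar P_U\bar P_X\bar P_{Y|X}\bar P_{V|UXY}$ for some $\bar P_X$, $\bar P_{V|UXY}$, and such that there is a random variable $W$ with values in a finite set $\mathcal W$ whose joint distribution with $(U,X,Y,V)$ has $(U,X,Y,V)$-marginal $\bar P_{UXYV}$ and satisfies $$\bar P_{UXYVW}=\bar P_U\,\bar P_X\,\bar P_{W|UX}\,\bar P_{Y|X}\,\bar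 P_{V|WY},\qquad I(WX;U)\le I(WX;Y),\qquad R_0\ge I(W;UXV|Y)+H(X|WY),$$ and $\mathcal R_{\rm out}$ is defined in the same way with the last condition replaced by $$R_0\ge I(W;UXV|Y)\quad\text{and}\quad |\mathcal W|\le|\mathcal U\times\mathcal X\times\mathcal Y\times\mathcal V|+4 .$$ -/

import Mathlib

open Filter Topology

noncomputable section

namespace StrongCoord

/-! ### Finite probability: mass functions are elements of `stdSimplex ℝ α` -/

/-- `k b` is a probability mass function for every `b`: a stochastic map from `β` to `α`. -/
def IsKernel {β α : Type*} [Fintype α] (k : β → α → ℝ) : Prop :=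
  ∀ b, k b ∈ stdSimplex ℝ α

open Classical in
/-- The distribution of the random variable `f` when the sample point has mass function `p`. -/
def marg {Ω α : Type*} [Fintype Ω] (p : Ω → ℝ) (f : Ω → α) (a : α) : ℝ :=
  ∑ ω, if f ω = a then p ω else 0

/-- The variational distance (the `ℓ¹` distance of the mass functions). -/
def tv {α : Type*} [Fintype α] (p q : α → ℝ) : ℝ :=
  ∑ a, |p a - q a|

/-- The i.i.d. distribution with single-letter law `p` on families indexed by `ι`. -/
def iid {ι α : Type*} [Fintype ι] (p : α → ℝ) (a : ι → α) : ℝ :=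
  ∏ t, p (a t)

/-! ### Information measures, in bits -/

/-- `H(A) = ∑ₐ p(a) log₂ (1 / p(a))`. -/
def entropy {Ω α : Type*} [Fintype Ω] [Fintype α] (p : Ω → ℝ) (A : Ω → α) : ℝ :=
  ∑ a, marg p A a * Real.logb 2 (1 / marg p A a)

/-- `H(A|B) = ∑ p(a,b) log₂ (p(b) / p(a,b))`. -/
def condEntropy {Ω α β : Type*} [Fintype Ω] [Fintype α] [Fintype β]
    (p : Ω → ℝ) (A : Ω → α) (B : Ω → β) : ℝ :=
  ∑ a, ∑ b, marg p (fun ω => (A ω, B ω)) (a, b) *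
    Real.logb 2 (marg p B b / marg p (fun ω => (A ω, B ω)) (a, b))

/-- `I(A;B) = H(A) - H(A|B)`. -/
def mutualInfo {Ω α β : Type*} [Fintype Ω] [Fintype α] [Fintype β]
    (p : Ω → ℝ) (A : Ω → α) (B : Ω → β) : ℝ :=
  entropy p A - condEntropy p A B

/-- `I(A;B|C) = H(A|C) - H(A|B,C)`. -/
def condMutualInfo {Ω α β γ : Type*} [Fintype Ω] [Fintype α] [Fintype β] [Fintype γ]
    (p : Ω → ℝ) (A : Ω → α) (B : Ω → β) (C : Ω → γ) : ℝ :=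
  condEntropy p A C - condEntropy p A (fun ω => (B ω, C ω))

/-! ### Codes -/

/-- The source symbols observed strictly before time `i`. -/
def past {α : Type*} {n : ℕ} (u : Fin n → α) (i : Fin n) : Fin i.val → α :=
  fun j => u ⟨j.val, j.isLt.trans i.isLt⟩

/-- A code of block length `n` with `M` values of common randomness. The encoder is the stochastic
strictly causal map `Xᵢ = fᵢ(U^{i-1}, C)`: its randomness is a local variable `S`, which has finitely
many values, is drawn once per block and is independent of the source and of the common randomness.
The decoder is a stochastic map from `(Y^n, C)` to `V^n`. -/
structure Code (𝒰 𝒳 𝒴 𝒱 : Type*) [Fintype 𝒱] (n M : ℕ) where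
  numS : ℕ
  pS : Fin numS → ℝ
  pS_mem : pS ∈ stdSimplex ℝ (Fin numS)
  f : (i : Fin n) → (Fin i.val → 𝒰) → Fin M → Fin numS → 𝒳
  g : (Fin n → 𝒴) × Fin M → (Fin n → 𝒱) → ℝ
  g_kernel : IsKernel g

section

variable {𝒰 𝒳 𝒴 𝒱 : Type*} [Fintype 𝒰] [Fintype 𝒳] [Fintype 𝒴] [Fintype 𝒱]

open Classical in
/-- The law of `(U^n, X^n, Y^n, V^n)` induced by a code: `C` is uniform, `U^n` is i.i.d.,
`Xᵢ = fᵢ(U^{i-1}, C, S)`, the channel is memoryless, and `V^n` is drawn from `g(· | Y^n, C)`. -/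
def Code.law {n M : ℕ} (K : Code 𝒰 𝒳 𝒴 𝒱 n M) (pU : 𝒰 → ℝ) (pYX : 𝒳 → 𝒴 → ℝ)
    (z : (Fin n → 𝒰) × (Fin n → 𝒳) × (Fin n → 𝒴) × (Fin n → 𝒱)) : ℝ :=
  ∑ c : Fin M, ∑ s : Fin K.numS,
    (1 / (M : ℝ)) * K.pS s * (∏ i, pU (z.1 i)) *
      (if ∀ i, z.2.1 i = K.f i (past z.1 i) c s then 1 else 0) *
      (∏ i, pYX (z.2.1 i) (z.2.2.1 i)) * K.g (z.2.2.1, c) z.2.2.2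

/-- The law of the sub-sequence of `(Uₜ, Xₜ, Yₜ, Vₜ)` with time indices `t ∈ A`. -/
def Code.lawOn {n M : ℕ} (K : Code 𝒰 𝒳 𝒴 𝒱 n M) (pU : 𝒰 → ℝ) (pYX : 𝒳 → 𝒴 → ℝ)
    (A : Finset (Fin n)) : (A → 𝒰 × 𝒳 × 𝒴 × 𝒱) → ℝ :=
  marg (K.law pU pYX) (fun z t => (z.1 t, z.2.1 t, z.2.2.1 t, z.2.2.2 t))

/-- The pair `(P, R₀)` is achievable for strong coordination: some sequence of codes with common
randomness uniform on `⌊2^{nR₀}⌋` values coordinates, for every `ε > 0`, a sub-sequence of more than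
`(1 - ε) n` time slots, with variational distance to the i.i.d. target tending to `0`. -/
def Achievable (pU : 𝒰 → ℝ) (pYX : 𝒳 → 𝒴 → ℝ) (P : 𝒰 × 𝒳 × 𝒴 × 𝒱 → ℝ) (R₀ : ℝ) : Prop :=
  P ∈ stdSimplex ℝ (𝒰 × 𝒳 × 𝒴 × 𝒱) ∧ 0 ≤ R₀ ∧
  ∃ K : (n : ℕ) → Code 𝒰 𝒳 𝒴 𝒱 n ⌊(2 : ℝ) ^ ((n : ℝ) * R₀)⌋₊,
    ∀ ε : ℝ, 0 < ε → ∃ A : (n : ℕ) → Finset (Fin n),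
      (∀ᶠ n : ℕ in atTop, (1 - ε) * (n : ℝ) < ((A n).card : ℝ)) ∧
      Tendsto (fun n => tv ((K n).lawOn pU pYX (A n)) (iid P)) atTop (𝓝 0)

/-- The strong coordination region: the closure of the set of achievable pairs. -/
def region (pU : 𝒰 → ℝ) (pYX : 𝒳 → 𝒴 → ℝ) : Set ((𝒰 × 𝒳 × 𝒴 × 𝒱 → ℝ) × ℝ) :=
  closure {q | Achievable pU pYX q.1 q.2}

/-! ### The inner and outer regions -/

/-- The joint mass function `P_U P_X P_{W|UX} P_{Y|X} P_{V|WY}` of `(U, X, W, Y, V)`. -/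
def joint {𝒲 : Type*} (pU : 𝒰 → ℝ) (pX : 𝒳 → ℝ) (pW : 𝒰 × 𝒳 → 𝒲 → ℝ) (pYX : 𝒳 → 𝒴 → ℝ)
    (pV : 𝒲 × 𝒴 → 𝒱 → ℝ) (z : 𝒰 × 𝒳 × 𝒲 × 𝒴 × 𝒱) : ℝ :=
  match z with
  | (u, x, w, y, v) => pU u * pX x * pW (u, x) w * pYX x y * pV (w, y) v

section

variable {𝒲 : Type*}

/-- The coordinate random variable `U`. -/
def rvU (z : 𝒰 × 𝒳 × 𝒲 × 𝒴 × 𝒱) : 𝒰 := z.1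
/-- The coordinate random variable `X`. -/
def rvX (z : 𝒰 × 𝒳 × 𝒲 × 𝒴 × 𝒱) : 𝒳 := z.2.1
/-- The coordinate random variable `W`. -/
def rvW (z : 𝒰 × 𝒳 × 𝒲 × 𝒴 × 𝒱) : 𝒲 := z.2.2.1
/-- The coordinate random variable `Y`. -/
def rvY (z : 𝒰 × 𝒳 × 𝒲 × 𝒴 × 𝒱) : 𝒴 := z.2.2.2.1
/-- The coordinate random variable `V`. -/
def rvV (z : 𝒰 × 𝒳 × 𝒲 × 𝒴 × 𝒱) : 𝒱 := z.2.2.2.2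

end

/-- `Q` is a joint law of `(U, X, W, Y, V)`, with `W` valued in `Fin m`, that satisfies the conditions
shared by the inner and the outer region for the target `P`: `P = P_U P_X P_{Y|X} P_{V|UXY}`,
`Q = P_U P_X P_{W|UX} P_{Y|X} P_{V|WY}`, the marginal of `Q` on `(U, X, Y, V)` is `P`, and
`I(WX;U) ≤ I(WX;Y)`. -/
def IsAuxiliary (pU : 𝒰 → ℝ) (pYX : 𝒳 → 𝒴 → ℝ) (P : 𝒰 × 𝒳 × 𝒴 × 𝒱 → ℝ) (m : ℕ)
    (Q : 𝒰 × 𝒳 × Fin m × 𝒴 × 𝒱 → ℝ) : Prop :=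
  (∃ pX ∈ stdSimplex ℝ 𝒳,
    (∃ pV : 𝒰 × 𝒳 × 𝒴 → 𝒱 → ℝ, IsKernel pV ∧
      ∀ u x y v, P (u, x, y, v) = pU u * pX x * pYX x y * pV (u, x, y) v) ∧
    ∃ pW : 𝒰 × 𝒳 → Fin m → ℝ, ∃ pV : Fin m × 𝒴 → 𝒱 → ℝ,
      IsKernel pW ∧ IsKernel pV ∧ Q = joint pU pX pW pYX pV) ∧
  marg Q (fun z => (rvU z, rvX z, rvY z, rvV z)) = P ∧
  mutualInfo Q (fun z => (rvW z, rvX z)) rvU ≤ mutualInfo Q (fun z => (rvW z, rvX z)) rvY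

/-- The inner region: `R₀ ≥ I(W;UXV|Y) + H(X|WY)`. -/
def innerRegion (pU : 𝒰 → ℝ) (pYX : 𝒳 → 𝒴 → ℝ) : Set ((𝒰 × 𝒳 × 𝒴 × 𝒱 → ℝ) × ℝ) :=
  {q | ∃ (m : ℕ) (Q : 𝒰 × 𝒳 × Fin m × 𝒴 × 𝒱 → ℝ), IsAuxiliary pU pYX q.1 m Q ∧
    condMutualInfo Q rvW (fun z => (rvU z, rvX z, rvV z)) rvY
      + condEntropy Q rvX (fun z => (rvW z, rvY z)) ≤ q.2}

/-- The outer region: `R₀ ≥ I(W;UXV|Y)` and `|𝒲| ≤ |𝒰 × 𝒳 × 𝒴 × 𝒱| + 4`. -/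
def outerRegion (pU : 𝒰 → ℝ) (pYX : 𝒳 → 𝒴 → ℝ) : Set ((𝒰 × 𝒳 × 𝒴 × 𝒱 → ℝ) × ℝ) :=
  {q | ∃ (m : ℕ) (Q : 𝒰 × 𝒳 × Fin m × 𝒴 × 𝒱 → ℝ), IsAuxiliary pU pYX q.1 m Q ∧
    condMutualInfo Q rvW (fun z => (rvU z, rvX z, rvV z)) rvY ≤ q.2 ∧
    m ≤ Fintype.card (𝒰 × 𝒳 × 𝒴 × 𝒱) + 4}

end

end StrongCoord

end

/-!
# Strong coordination with a strictly causal encoder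

**Outer bound.** For a code of length `n`, the auxiliary variable at time `t` is `W_t = (C, Y_s : s ≠ t)`.
Given `W_t`, the pair `(U_t, X_t)` is arbitrary, `Y_t` is the channel output for `X_t`, and `V_t` depends
only on `(W_t, Y_t)`; moreover `X_t` is independent of `U_t` because the encoder is strictly causal
(`Code.marg_letter_UX`, `Code.exists_fibres`). The chain rule gives
`∑ H(U_t | W_t X_t) ≥ H(U^n | C S Y^n)` (`Code.ent_source_le`), which amounts to
`∑ I(W_t X_t; U_t) ≤ ∑ I(X_t; Y_t)`, and the common randomness cannot carry more than its rate, which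
bounds `∑ I(W_t; U_t X_t V_t | Y_t)` (`Code.shannon_lawOn_le`). The times outside the set `A` of
coordinated times cost at most `log |𝒴|` each.

For each law of the auxiliary variable, the law of `(U, X, Y, V)` together with `H(U | X W)` and
`H(U X V | Y W)` is an average of *fibre points*, the values of this triple for a constant `W`. All
averages of fibre points form a compact convex set in a space of dimension `|𝒰 × 𝒳 × 𝒴 × 𝒱| + 2`
(`fibreHull`). Convexity allows averaging over the times in `A` (`Code.exists_average`), compactness
allows passing to the limit in the block length and to the closure of the achievable pairs
(`exists_isOuterPoint_of_tendsto`), and Carathéodory's theorem turns a point of the hull into an auxiliary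
variable with at most `|𝒰 × 𝒳 × 𝒴 × 𝒱| + 3` values (`mem_outerRegion_of_isOuterPoint`).

**Inner bound.** A code consists of `B + 1` chained blocks of length `N`. In each block, an input
codeword `x` and a satellite codeword `w` from a superposition codebook are used (`BlockCode`). The input
codeword has a uniform index, independent of the source block. Given the source block, one part
`j` of the index of the satellite codeword is drawn from its posterior law, which by soft covering
(`soft_covering`) makes `(U, X, Y, V)` nearly i.i.d. with the target law when `V` is drawn from `(W, Y)`
(`BlockCode.tv_out_le`). The decoder is told `j` through the message of the *next* block: `j`, masked by
a uniform pad of common randomness, is part of the index of its input codeword, which is why a strictly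
causal encoder suffices, and why the blocks remain exactly independent (`BlockCode.marg_step`,
`BlockCode.tv_chain_le`). The message is decoded by a likelihood threshold (`threshold_decoding`); this is
possible since `I(W; U | X) < I(X; Y)`. The last block, for which `V` is not generated, is a small fraction
of all times.

The pad, the common part of the input index and the common part of the satellite index have total rate
`H(X) - I(X; Y) + I(W; U Y V | X)`, which equals `I(W; U X V | Y) + H(X | W Y)`
(`AuxData.condMutualInfo_add_condEntropy`). The boundary case `I(WX; U) = I(WX; Y)` is reduced to a strict
inequality by erasing `W` with a small probability (`AuxData.erase`, `AuxData.mem_region`), since the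
region is closed.
-/

open Filter Topology
open Real (negMulLog)

noncomputable section

namespace StrongCoord

set_option linter.unusedSectionVars false

/-! ### Marginals and variational distance -/

open Classical in
theorem marg_eq_sum_filter {Ω α : Type*} [Fintype Ω] (p : Ω → ℝ) (f : Ω → α) (a : α) :
    marg p f a = ∑ ω with f ω = a, p ω := by
  rw [marg, Finset.sum_filter]

open Classical in
theorem sum_marg_mul {Ω α : Type*} [Fintype Ω] [Fintype α] (p : Ω → ℝ) (f : Ω → α) (φ : α → ℝ) :
    ∑ a, marg p f a * φ a = ∑ ω, p ω * φ (f ω) := by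
  simp only [marg, Finset.sum_mul]
  rw [Finset.sum_comm]
  refine Finset.sum_congr rfl fun ω _ => ?_
  rw [Finset.sum_eq_single (f ω)] <;> simp +contextual [eq_comm]

theorem sum_marg {Ω α : Type*} [Fintype Ω] [Fintype α] (p : Ω → ℝ) (f : Ω → α) :
    ∑ a, marg p f a = ∑ ω, p ω := by
  simpa using sum_marg_mul p f (fun _ => 1)

theorem marg_nonneg {Ω α : Type*} [Fintype Ω] {p : Ω → ℝ} (hp : ∀ ω, 0 ≤ p ω) (f : Ω → α) (a : α) :
    0 ≤ marg p f a := by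
  classical
  exact Finset.sum_nonneg fun ω _ => by split_ifs <;> simp [hp]

theorem le_marg {Ω α : Type*} [Fintype Ω] {p : Ω → ℝ} (hp : ∀ ω, 0 ≤ p ω) (f : Ω → α) (ω : Ω) :
    p ω ≤ marg p f (f ω) := by
  classical
  refine le_trans ?_ (Finset.single_le_sum (f := fun ω' => if f ω' = f ω then p ω' else 0)
    (fun ω' _ => by split_ifs <;> simp [hp]) (Finset.mem_univ ω))
  simp

theorem marg_mem {Ω α : Type*} [Fintype Ω] [Fintype α] {p : Ω → ℝ} (hp : p ∈ stdSimplex ℝ Ω)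
    (f : Ω → α) : marg p f ∈ stdSimplex ℝ α :=
  ⟨marg_nonneg hp.1 f, by rw [sum_marg, hp.2]⟩

theorem marg_marg {Ω α β : Type*} [Fintype Ω] [Fintype α] (p : Ω → ℝ) (f : Ω → α) (g : α → β) :
    marg (marg p f) g = marg p (fun ω => g (f ω)) := by
  classical
  funext b
  have := sum_marg_mul p f (fun a => if g a = b then 1 else 0)
  simp only [mul_ite, mul_one, mul_zero] at this
  exact this

theorem marg_equiv {Ω α : Type*} [Fintype Ω] (p : Ω → ℝ) (e : Ω ≃ α) (a : α) :
    marg p e a = p (e.symm a) := by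
  classical
  rw [marg, Finset.sum_eq_single (e.symm a)]
  · simp
  · intro b _ hb
    rw [if_neg]
    rintro rfl
    simp at hb
  · simp

theorem marg_id {Ω : Type*} [Fintype Ω] (p : Ω → ℝ) : marg p (fun ω => ω) = p := by
  funext a
  exact marg_equiv p (Equiv.refl _) a

theorem marg_equiv_comp {Ω Ω' α : Type*} [Fintype Ω] [Fintype Ω'] (p : Ω → ℝ) (e : Ω' ≃ Ω)
    (f : Ω → α) : marg (fun ω => p (e ω)) (fun ω => f (e ω)) = marg p f := by
  classical
  funext a
  exact e.sum_comp (fun ω => if f ω = a then p ω else 0)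

theorem nonempty_of_mem_stdSimplex {α : Type*} [Fintype α] {p : α → ℝ} (hp : p ∈ stdSimplex ℝ α) :
    Nonempty α := by
  by_contra h
  rw [not_nonempty_iff] at h
  simpa using hp.2

/-- Probabilities of `(f, g) = (a, b)` summed over `b`. -/
theorem sum_marg_pair {Ω α β : Type*} [Fintype Ω] [Fintype β] (p : Ω → ℝ)
    (f : Ω → α) (g : Ω → β) (a : α) :
    ∑ b, marg p (fun ω => (f ω, g ω)) (a, b) = marg p f a := by
  classical
  simp only [marg]
  rw [Finset.sum_comm]
  refine Finset.sum_congr rfl fun ω _ => ?_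
  simp only [Prod.mk.injEq]
  by_cases h : f ω = a <;> simp [h]

/-- The first marginal of a law that is given as a mass function on a product. -/
theorem marg_fst {α β : Type*} [Fintype α] [Fintype β] (p : α × β → ℝ) (a : α) :
    marg p Prod.fst a = ∑ b, p (a, b) := by
  classical
  simp only [marg, Fintype.sum_prod_type]
  rw [Finset.sum_comm]
  simp

theorem tv_nonneg {α : Type*} [Fintype α] (p q : α → ℝ) : 0 ≤ tv p q :=
  Finset.sum_nonneg fun _ _ => abs_nonneg _

theorem tv_self {α : Type*} [Fintype α] (p : α → ℝ) : tv p p = 0 := by simp [tv]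

theorem tv_comm {α : Type*} [Fintype α] (p q : α → ℝ) : tv p q = tv q p := by
  simp [tv, abs_sub_comm]

theorem tv_triangle {α : Type*} [Fintype α] (p q r : α → ℝ) : tv p r ≤ tv p q + tv q r := by
  simp only [tv, ← Finset.sum_add_distrib]
  exact Finset.sum_le_sum fun a _ => abs_sub_le _ _ _

theorem tv_marg_le {Ω α : Type*} [Fintype Ω] [Fintype α] (p q : Ω → ℝ) (f : Ω → α) :
    tv (marg p f) (marg q f) ≤ tv p q := by
  classical
  have h : ∀ a, |marg p f a - marg q f a| ≤ marg (fun ω => |p ω - q ω|) f a := by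
    intro a
    simp only [marg_eq_sum_filter, ← Finset.sum_sub_distrib]
    exact Finset.abs_sum_le_sum_abs _ _
  exact (Finset.sum_le_sum fun a _ => h a).trans (sum_marg _ f).le

/-- Passing both laws through the same stochastic map does not change their distance. -/
theorem tv_mul_kernel {α β : Type*} [Fintype α] [Fintype β] (p q : α → ℝ) (k : α → β → ℝ)
    (hk : IsKernel k) :
    tv (fun z : α × β => p z.1 * k z.1 z.2) (fun z => q z.1 * k z.1 z.2) = tv p q := by
  simp only [tv, Fintype.sum_prod_type, ← sub_mul, abs_mul]
  refine Finset.sum_congr rfl fun a _ => ?_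
  rw [← Finset.mul_sum]
  have : ∑ b, |k a b| = 1 := by
    rw [← (hk a).2]
    exact Finset.sum_congr rfl fun b _ => abs_of_nonneg ((hk a).1 b)
  rw [this, mul_one]

theorem tv_le_two {α : Type*} [Fintype α] {p q : α → ℝ} (hp : p ∈ stdSimplex ℝ α)
    (hq : q ∈ stdSimplex ℝ α) : tv p q ≤ 2 := by
  calc tv p q ≤ ∑ a, (p a + q a) := Finset.sum_le_sum fun a _ => by
        have h1 := hp.1 a; have h2 := hq.1 a
        exact abs_sub_le_iff.2 ⟨by linarith, by linarith⟩
    _ = 2 := by rw [Finset.sum_add_distrib, hp.2, hq.2]; norm_num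

/-! ### Product laws -/

/-- The law of independent random variables with laws `p i`. -/
def prodLaw {ι α : Type*} [Fintype ι] (p : ι → α → ℝ) (w : ι → α) : ℝ :=
  ∏ i, p i (w i)

theorem iid_eq_prodLaw {ι α : Type*} [Fintype ι] (p : α → ℝ) :
    (iid p : (ι → α) → ℝ) = prodLaw (fun _ => p) := rfl

theorem sum_prod_pi {ι : Type*} {α : ι → Type*} [Fintype ι] [DecidableEq ι] [∀ i, Fintype (α i)]
    (f : (i : ι) → α i → ℝ) : ∑ w : (i : ι) → α i, ∏ i, f i (w i) = ∏ i, ∑ a, f i a := by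
  rw [Finset.prod_univ_sum, Fintype.piFinset_univ]

theorem prodLaw_mem {ι α : Type*} [Fintype ι] [DecidableEq ι] [Fintype α] {p : ι → α → ℝ}
    (hp : ∀ i, p i ∈ stdSimplex ℝ α) : prodLaw p ∈ stdSimplex ℝ (ι → α) := by
  refine ⟨fun w => Finset.prod_nonneg fun i _ => (hp i).1 _, ?_⟩
  simp only [prodLaw]
  rw [sum_prod_pi]
  simp [(hp _).2]

theorem iid_mem {ι α : Type*} [Fintype ι] [DecidableEq ι] [Fintype α] {p : α → ℝ}
    (hp : p ∈ stdSimplex ℝ α) : iid p ∈ stdSimplex ℝ (ι → α) :=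
  prodLaw_mem fun _ => hp

/-- Sub-families of independent random variables are independent. -/
theorem marg_prodLaw_comp {ι κ α : Type*} [Fintype ι] [DecidableEq ι] [Fintype κ]
    [DecidableEq κ] [Fintype α] {p : ι → α → ℝ}
    (hp : ∀ i, p i ∈ stdSimplex ℝ α) {e : κ → ι} (he : Function.Injective e) (a : κ → α) :
    marg (prodLaw p) (fun w j => w (e j)) a = prodLaw (fun j => p (e j)) a := by
  classical
  let c : ι → α → ℝ := fun i b => ∏ j, if e j = i then (if b = a j then 1 else 0) else 1
  have h1 : ∀ w : ι → α, (if (fun j => w (e j)) = a then prodLaw p w else 0)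
      = ∏ i, p i (w i) * c i (w i) := by
    intro w
    rw [Finset.prod_mul_distrib]
    simp only [c]
    rw [Finset.prod_comm]
    simp only [Finset.prod_ite_eq, Finset.mem_univ, if_true]
    by_cases h : (fun j => w (e j)) = a
    · rw [if_pos h]
      subst h
      simp [prodLaw]
    · rw [if_neg h]
      obtain ⟨j, hj⟩ := Function.ne_iff.1 h
      rw [Finset.prod_eq_zero (i := j) (Finset.mem_univ _) (by simp [hj]), mul_zero]
  simp only [marg]
  rw [Finset.sum_congr rfl fun w _ => (by convert! h1 w), sum_prod_pi (fun i b => p i b * c i b)]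
  have hc : ∀ j b, c (e j) b = if b = a j then 1 else 0 := by
    intro j b
    simp only [c]
    rw [Finset.prod_eq_single j]
    · simp
    · intro j' _ hj'
      rw [if_neg (fun h => hj' (he h))]
    · simp
  have hc' : ∀ i, i ∉ Set.range e → ∀ b, c i b = 1 := by
    intro i hi b
    simp only [c]
    refine Finset.prod_eq_one fun j _ => ?_
    rw [if_neg (fun h => hi ⟨j, h⟩)]
  rw [prodLaw, ← Finset.prod_subset (Finset.subset_univ (Finset.univ.map ⟨e, he⟩)), Finset.prod_map]
  · refine Finset.prod_congr rfl fun j _ => ?_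
    simp [hc]
  · intro i _ hi
    have : i ∉ Set.range e := by simpa using hi
    simp [hc' i this, (hp i).2]

theorem sum_prodLaw_comp {ι κ α : Type*} [Fintype ι] [DecidableEq ι] [Fintype κ]
    [DecidableEq κ] [Fintype α] {p : ι → α → ℝ}
    (hp : ∀ i, p i ∈ stdSimplex ℝ α) {e : κ → ι} (he : Function.Injective e) (φ : (κ → α) → ℝ) :
    ∑ w, prodLaw p w * φ (fun j => w (e j)) = ∑ a, prodLaw (fun j => p (e j)) a * φ a := by
  rw [← sum_marg_mul (prodLaw p) (fun w j => w (e j)) φ]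
  simp only [marg_prodLaw_comp hp he]

theorem sum_prodLaw_apply {ι α : Type*} [Fintype ι] [DecidableEq ι] [Fintype α] {p : ι → α → ℝ}
    (hp : ∀ i, p i ∈ stdSimplex ℝ α) (i : ι) (φ : α → ℝ) :
    ∑ w, prodLaw p w * φ (w i) = ∑ a, p i a * φ a := by
  have := sum_prodLaw_comp hp (e := fun _ : Unit => i) (Function.injective_of_subsingleton _)
    (fun a => φ (a ()))
  rw [this, ← (Equiv.funUnique Unit α).sum_comp (fun a => p i a * φ a)]
  simp [prodLaw]

theorem sum_prodLaw_pair {ι α : Type*} [Fintype ι] [DecidableEq ι] [Fintype α] {p : ι → α → ℝ}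
    (hp : ∀ i, p i ∈ stdSimplex ℝ α) {i j : ι} (hij : i ≠ j) (φ : α → α → ℝ) :
    ∑ w, prodLaw p w * φ (w i) (w j) = ∑ a, ∑ b, p i a * p j b * φ a b := by
  have he : Function.Injective (fun k : Fin 2 => ![i, j] k) := by
    intro a b
    fin_cases a <;> fin_cases b <;> simp [hij, hij.symm]
  have := sum_prodLaw_comp hp he (fun a => φ (a 0) (a 1))
  simp only [Matrix.cons_val_zero, Matrix.cons_val_one] at this
  rw [this, ← (finTwoArrowEquiv α).symm.sum_comp
    (fun a => prodLaw (fun k => p (![i, j] k)) a * φ (a 0) (a 1)), Fintype.sum_prod_type]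
  simp [prodLaw, Fin.prod_univ_two]

/-- The variance of a sum of independent identically distributed centred variables. -/
theorem sum_iid_mul_sq {ι α : Type*} [Fintype ι] [DecidableEq ι] [Fintype α] {p : α → ℝ}
    (hp : p ∈ stdSimplex ℝ α) (g : α → ℝ) (hg : ∑ a, p a * g a = 0) :
    ∑ w : ι → α, iid p w * (∑ i, g (w i)) ^ 2 = Fintype.card ι * ∑ a, p a * g a ^ 2 := by
  have hp' : ∀ i : ι, (fun _ : ι => p) i ∈ stdSimplex ℝ α := fun _ => hp
  have h : ∀ i j : ι, ∑ w : ι → α, iid p w * (g (w i) * g (w j))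
      = if i = j then ∑ a, p a * g a ^ 2 else 0 := by
    intro i j
    split_ifs with hij
    · subst hij
      rw [iid_eq_prodLaw, sum_prodLaw_apply hp' i (fun a => g a * g a)]
      simp [sq]
    · rw [iid_eq_prodLaw, sum_prodLaw_pair hp' hij (fun a b => g a * g b)]
      have : ∀ a b, p a * p b * (g a * g b) = (p a * g a) * (p b * g b) := fun a b => by ring
      simp only [this, ← Finset.mul_sum, hg, mul_zero, Finset.sum_const_zero]
  calc _ = ∑ w : ι → α, ∑ i : ι, ∑ j : ι, iid p w * (g (w i) * g (w j)) := by
        simp only [sq]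
        refine Finset.sum_congr rfl fun w _ => ?_
        rw [Finset.sum_mul_sum]
        simp only [Finset.mul_sum]
    _ = ∑ i : ι, ∑ j : ι, ∑ w : ι → α, iid p w * (g (w i) * g (w j)) := by
        rw [Finset.sum_comm]
        exact Finset.sum_congr rfl fun i _ => Finset.sum_comm
    _ = _ := by simp [h]

/-- Subadditivity of the distance over independent components. -/
theorem tv_iid_fin_le {α : Type*} [Fintype α] {p q : α → ℝ} (hp : p ∈ stdSimplex ℝ α)
    (hq : q ∈ stdSimplex ℝ α) (B : ℕ) :
    tv (iid p : (Fin B → α) → ℝ) (iid q) ≤ B * tv p q := by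
  classical
  induction B with
  | zero => simp [tv, iid]
  | succ B ih =>
    have key : ∀ r s : α → ℝ, tv (iid r : (Fin (B + 1) → α) → ℝ) (iid s)
        = tv (fun z : α × (Fin B → α) => r z.1 * iid r z.2) (fun z => s z.1 * iid s z.2) := by
      intro r s
      simp only [tv]
      rw [← (Fin.consEquiv (fun _ => α)).sum_comp]
      refine Finset.sum_congr rfl fun z _ => ?_
      simp [iid, Fin.prod_univ_succ, Fin.consEquiv]
    rw [key]
    refine (tv_triangle _ (fun z : α × (Fin B → α) => q z.1 * iid p z.2) _).trans ?_
    have h1 := tv_mul_kernel (β := Fin B → α) p q (fun _ => iid p) (fun _ => iid_mem hp)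
    have h2 : tv (fun z : α × (Fin B → α) => q z.1 * iid p z.2) (fun z => q z.1 * iid q z.2)
        = tv (iid p : (Fin B → α) → ℝ) (iid q) := by
      simp only [tv, Fintype.sum_prod_type, ← mul_sub, abs_mul, ← Finset.mul_sum]
      rw [← Finset.sum_mul, Finset.sum_congr rfl (fun a _ => abs_of_nonneg (hq.1 a)), hq.2, one_mul]
    rw [h2]
    push_cast
    linarith [h1.le]

/-! ### Entropies in nats -/

/-- The Shannon entropy, in nats, of a mass function. -/
def shannon {α : Type*} [Fintype α] (q : α → ℝ) : ℝ := ∑ a, negMulLog (q a)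

/-- The Shannon entropy, in nats, of the random variable `A`. -/
def ent {Ω α : Type*} [Fintype Ω] [Fintype α] (p : Ω → ℝ) (A : Ω → α) : ℝ := shannon (marg p A)

theorem negMulLog_eq (x : ℝ) : negMulLog x = -(x * Real.log x) := by
  rw [Real.negMulLog]; ring

theorem entropy_eq {Ω α : Type*} [Fintype Ω] [Fintype α] (p : Ω → ℝ) (A : Ω → α) :
    entropy p A = ent p A / Real.log 2 := by
  simp only [entropy, ent, shannon, Finset.sum_div, Real.logb, one_div, Real.log_inv, negMulLog_eq]
  exact Finset.sum_congr rfl fun a _ => by ring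

theorem ent_eq {Ω α : Type*} [Fintype Ω] [Fintype α] (p : Ω → ℝ) (A : Ω → α) :
    ent p A = -∑ ω, p ω * Real.log (marg p A (A ω)) := by
  rw [← sum_marg_mul p A (fun a => Real.log (marg p A a))]
  simp [ent, shannon, negMulLog_eq]

theorem marg_pair_le {Ω α β : Type*} [Fintype Ω] {p : Ω → ℝ} (hp : ∀ ω, 0 ≤ p ω)
    (A : Ω → α) (B : Ω → β) (a : α) (b : β) :
    marg p (fun ω => (A ω, B ω)) (a, b) ≤ marg p B b := by
  classical
  simp only [marg]
  refine Finset.sum_le_sum fun ω _ => ?_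
  by_cases h : B ω = b <;> by_cases h' : A ω = a <;> simp [h, h', hp]

theorem condEntropy_eq {Ω α β : Type*} [Fintype Ω] [Fintype α] [Fintype β] {p : Ω → ℝ}
    (hp : ∀ ω, 0 ≤ p ω) (A : Ω → α) (B : Ω → β) :
    condEntropy p A B = (ent p (fun ω => (A ω, B ω)) - ent p B) / Real.log 2 := by
  have h1 : ∀ a b, marg p (fun ω => (A ω, B ω)) (a, b) *
      Real.logb 2 (marg p B b / marg p (fun ω => (A ω, B ω)) (a, b))
      = (marg p (fun ω => (A ω, B ω)) (a, b) * Real.log (marg p B b)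
        + negMulLog (marg p (fun ω => (A ω, B ω)) (a, b))) / Real.log 2 := by
    intro a b
    rcases (marg_nonneg hp (fun ω => (A ω, B ω)) (a, b)).eq_or_lt with h | h
    · simp [← h]
    · have hb := h.trans_le (marg_pair_le hp A B a b)
      rw [Real.logb, Real.log_div hb.ne' h.ne', negMulLog_eq]
      ring
  have h2 : ∑ a, ∑ b, marg p (fun ω => (A ω, B ω)) (a, b) * Real.log (marg p B b)
      = - ent p B := by
    rw [ent_eq, neg_neg, ← Fintype.sum_prod_type'
      (f := fun a b => marg p (fun ω => (A ω, B ω)) (a, b) * Real.log (marg p B b))]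
    exact sum_marg_mul p (fun ω => (A ω, B ω)) (fun z => Real.log (marg p B z.2))
  simp only [condEntropy, h1, ← Finset.sum_div, Finset.sum_add_distrib]
  have h3 : ent p (fun ω => (A ω, B ω))
      = ∑ a, ∑ b, negMulLog (marg p (fun ω => (A ω, B ω)) (a, b)) := by
    rw [ent, shannon, Fintype.sum_prod_type]
  rw [h2, ← h3]
  ring

theorem marg_pos {Ω α : Type*} [Fintype Ω] {p : Ω → ℝ} (hp : ∀ ω, 0 ≤ p ω) (A : Ω → α) {ω : Ω}
    (h : 0 < p ω) : 0 < marg p A (A ω) :=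
  h.trans_le (le_marg hp A ω)

theorem marg_le_of_imp {Ω α β : Type*} [Fintype Ω] {p : Ω → ℝ} (hp : ∀ ω, 0 ≤ p ω)
    {A : Ω → α} {B : Ω → β} {a : α} {b : β} (h : ∀ ω, A ω = a → B ω = b) :
    marg p A a ≤ marg p B b := by
  classical
  simp only [marg]
  refine Finset.sum_le_sum fun ω _ => ?_
  by_cases h' : A ω = a
  · simp [h', h ω h']
  · rw [if_neg h']
    split_ifs <;> simp [hp]

/-- A variable that is determined by another one has the smaller entropy. -/
theorem ent_mono {Ω α β : Type*} [Fintype Ω] [Fintype α] [Fintype β] {p : Ω → ℝ}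
    (hp : ∀ ω, 0 ≤ p ω) {A : Ω → α} {B : Ω → β} (h : ∀ ω ω', A ω = A ω' → B ω = B ω') :
    ent p B ≤ ent p A := by
  rw [ent_eq, ent_eq, neg_le_neg_iff]
  refine Finset.sum_le_sum fun ω _ => ?_
  rcases (hp ω).eq_or_lt with h0 | h0
  · simp [← h0]
  · exact mul_le_mul_of_nonneg_left (Real.log_le_log (marg_pos hp A h0)
      (marg_le_of_imp hp fun ω' h' => h _ _ h')) h0.le

theorem ent_congr {Ω α β : Type*} [Fintype Ω] [Fintype α] [Fintype β] {p : Ω → ℝ}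
    (hp : ∀ ω, 0 ≤ p ω) {A : Ω → α} {B : Ω → β} (h : ∀ ω ω', A ω = A ω' ↔ B ω = B ω') :
    ent p A = ent p B :=
  le_antisymm (ent_mono hp fun ω ω' => (h ω ω').2) (ent_mono hp fun ω ω' => (h ω ω').1)

theorem le_one_of_mem {α : Type*} [Fintype α] {q : α → ℝ} (hq : q ∈ stdSimplex ℝ α) (a : α) :
    q a ≤ 1 := by
  rw [← hq.2]
  exact Finset.single_le_sum (fun b _ => hq.1 b) (Finset.mem_univ a)

theorem shannon_nonneg {α : Type*} [Fintype α] {q : α → ℝ} (hq : q ∈ stdSimplex ℝ α) :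
    0 ≤ shannon q :=
  Finset.sum_nonneg fun a _ => Real.negMulLog_nonneg (hq.1 a) (le_one_of_mem hq a)

theorem ent_nonneg {Ω α : Type*} [Fintype Ω] [Fintype α] {p : Ω → ℝ} (hp : p ∈ stdSimplex ℝ Ω)
    (A : Ω → α) : 0 ≤ ent p A := shannon_nonneg (marg_mem hp A)

/-- Gibbs' inequality. -/
theorem sum_mul_log_le {α : Type*} [Fintype α] {p q : α → ℝ} (hp : ∀ a, 0 ≤ p a)
    (hq : ∀ a, 0 ≤ q a) (hqp : ∀ a, 0 < p a → 0 < q a) (h : ∑ a, q a ≤ ∑ a, p a) :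
    ∑ a, p a * Real.log (q a) ≤ ∑ a, p a * Real.log (p a) := by
  have : ∀ a, p a * Real.log (q a) ≤ p a * Real.log (p a) + (q a - p a) := by
    intro a
    rcases (hp a).eq_or_lt with h0 | h0
    · simp [← h0, hq a]
    · have h1 := Real.log_le_sub_one_of_pos (div_pos (hqp a h0) h0)
      rw [Real.log_div (hqp a h0).ne' h0.ne'] at h1
      have h2 := mul_le_mul_of_nonneg_left h1 h0.le
      have h3 : p a * (q a / p a - 1) = q a - p a := by field_simp
      linarith
  calc _ ≤ ∑ a, (p a * Real.log (p a) + (q a - p a)) := Finset.sum_le_sum fun a _ => this a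
    _ ≤ _ := by rw [Finset.sum_add_distrib, Finset.sum_sub_distrib]; linarith

theorem shannon_le_log_card {α : Type*} [Fintype α] {q : α → ℝ} (hq : q ∈ stdSimplex ℝ α) :
    shannon q ≤ Real.log (Fintype.card α) := by
  have hne : Nonempty α := by
    by_contra h
    rw [not_nonempty_iff] at h
    simpa using hq.2
  have hc : (0 : ℝ) < Fintype.card α := by exact_mod_cast Fintype.card_pos
  have := sum_mul_log_le (q := fun _ : α => 1 / (Fintype.card α : ℝ)) hq.1
    (fun _ => by positivity) (fun _ _ => by positivity) (by simp [hq.2])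
  rw [← Finset.sum_mul, hq.2, one_div, Real.log_inv] at this
  simp only [shannon, negMulLog_eq, Finset.sum_neg_distrib]
  linarith

theorem ent_le_log_card {Ω α : Type*} [Fintype Ω] [Fintype α] {p : Ω → ℝ}
    (hp : p ∈ stdSimplex ℝ Ω) (A : Ω → α) : ent p A ≤ Real.log (Fintype.card α) :=
  shannon_le_log_card (marg_mem hp A)

/-- Submodularity of entropy: conditional mutual information is nonnegative. -/
theorem ent_submod {Ω α β γ : Type*} [Fintype Ω] [Fintype α] [Fintype β] [Fintype γ] {p : Ω → ℝ}
    (hp : ∀ ω, 0 ≤ p ω) (A : Ω → α) (B : Ω → β) (D : Ω → γ) :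
    ent p (fun ω => (A ω, B ω, D ω)) + ent p D
      ≤ ent p (fun ω => (A ω, D ω)) + ent p (fun ω => (B ω, D ω)) := by
  set mABD := marg p (fun ω => (A ω, B ω, D ω)) with hABD
  set mAD := marg p (fun ω => (A ω, D ω)) with hAD
  set mBD := marg p (fun ω => (B ω, D ω)) with hBD
  set mD := marg p D with hD
  have n1 := marg_nonneg hp (fun ω => (A ω, B ω, D ω))
  have n2 := marg_nonneg hp (fun ω => (A ω, D ω))
  have n3 := marg_nonneg hp (fun ω => (B ω, D ω))
  have n4 := marg_nonneg hp D
  have hle2 : ∀ a b d, mABD (a, b, d) ≤ mAD (a, d) := fun a b d =>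
    marg_le_of_imp hp fun ω h => by simp only [Prod.mk.injEq] at h ⊢; tauto
  have hle3 : ∀ a b d, mABD (a, b, d) ≤ mBD (b, d) := fun a b d =>
    marg_le_of_imp hp fun ω h => by simp only [Prod.mk.injEq] at h ⊢; tauto
  have hle4 : ∀ a b d, mABD (a, b, d) ≤ mD d := fun a b d =>
    marg_le_of_imp hp fun ω h => by simp only [Prod.mk.injEq] at h ⊢; tauto
  have hsum : ∑ z : α × β × γ, mAD (z.1, z.2.2) * mBD z.2 / mD z.2.2 ≤ ∑ z, mABD z := by
    rw [hABD, sum_marg, ← sum_marg p D, ← hD]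
    calc ∑ z : α × β × γ, mAD (z.1, z.2.2) * mBD z.2 / mD z.2.2
        = ∑ d, ∑ a, ∑ b, mAD (a, d) * mBD (b, d) / mD d := by
          simp only [Fintype.sum_prod_type]
          rw [show (∑ d, ∑ a, ∑ b, mAD (a, d) * mBD (b, d) / mD d)
            = ∑ a, ∑ d, ∑ b, mAD (a, d) * mBD (b, d) / mD d from Finset.sum_comm]
          exact Finset.sum_congr rfl fun a _ => Finset.sum_comm
      _ = ∑ d, mD d * mD d / mD d := by
          refine Finset.sum_congr rfl fun d _ => ?_
          have e1 : ∑ a, mAD (a, d) = mD d := by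
            have := sum_marg_pair p D A d
            rw [hD, ← this]
            refine Finset.sum_congr rfl fun a _ => ?_
            exact le_antisymm (marg_le_of_imp hp fun ω h => by simp_all)
              (marg_le_of_imp hp fun ω h => by simp_all)
          have e2 : ∑ b, mBD (b, d) = mD d := by
            have := sum_marg_pair p D B d
            rw [hD, ← this]
            refine Finset.sum_congr rfl fun a _ => ?_
            exact le_antisymm (marg_le_of_imp hp fun ω h => by simp_all)
              (marg_le_of_imp hp fun ω h => by simp_all)
          simp only [← Finset.sum_div, ← Finset.mul_sum]
          rw [← Finset.sum_mul, e1, e2]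
      _ ≤ ∑ d, mD d := Finset.sum_le_sum fun d _ => by rw [mul_self_div_self]
  have key := sum_mul_log_le (p := mABD) (q := fun z => mAD (z.1, z.2.2) * mBD z.2 / mD z.2.2)
    n1 (fun z => div_nonneg (mul_nonneg (n2 _) (n3 _)) (n4 _))
    (fun z h => div_pos (mul_pos (h.trans_le (hle2 z.1 z.2.1 z.2.2))
      (h.trans_le (hle3 z.1 z.2.1 z.2.2))) (h.trans_le (hle4 z.1 z.2.1 z.2.2))) hsum
  have split : ∑ z, mABD z * Real.log (mAD (z.1, z.2.2) * mBD z.2 / mD z.2.2)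
      = ∑ z, mABD z * Real.log (mAD (z.1, z.2.2)) + ∑ z, mABD z * Real.log (mBD z.2)
        - ∑ z, mABD z * Real.log (mD z.2.2) := by
    rw [← Finset.sum_add_distrib, ← Finset.sum_sub_distrib]
    refine Finset.sum_congr rfl fun z _ => ?_
    rcases (n1 z).eq_or_lt with h0 | h0
    · rw [hABD, ← h0]; simp
    · have p2 := h0.trans_le (hle2 z.1 z.2.1 z.2.2)
      have p3 := h0.trans_le (hle3 z.1 z.2.1 z.2.2)
      have p4 := h0.trans_le (hle4 z.1 z.2.1 z.2.2)
      rw [Real.log_div (mul_pos p2 p3).ne' p4.ne', Real.log_mul p2.ne' p3.ne']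
      ring
  rw [split, hABD, sum_marg_mul p _ (fun z : α × β × γ => Real.log (mAD (z.1, z.2.2))),
    sum_marg_mul p _ (fun z : α × β × γ => Real.log (mBD z.2)),
    sum_marg_mul p _ (fun z : α × β × γ => Real.log (mD z.2.2)),
    sum_marg_mul p _ (fun z : α × β × γ => Real.log (marg p (fun ω => (A ω, B ω, D ω)) z))] at key
  rw [ent_eq, ent_eq, ent_eq, ent_eq]
  linarith

theorem ent_unit {Ω : Type*} [Fintype Ω] {p : Ω → ℝ} (hp : p ∈ stdSimplex ℝ Ω) :
    ent p (fun _ => ()) = 0 := by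
  have := ent_le_log_card hp (fun _ => ())
  have h2 := ent_nonneg hp (fun _ => ())
  simp at this
  linarith

theorem ent_pair_le {Ω α β : Type*} [Fintype Ω] [Fintype α] [Fintype β] {p : Ω → ℝ}
    (hp : p ∈ stdSimplex ℝ Ω) (A : Ω → α) (B : Ω → β) :
    ent p (fun ω => (A ω, B ω)) ≤ ent p A + ent p B := by
  have h := ent_submod hp.1 A B (fun _ => ())
  rw [ent_unit hp, ent_congr hp.1 (B := fun ω => (A ω, B ω)) (fun ω ω' => by simp),
    ent_congr hp.1 (A := fun ω => (A ω, ())) (B := A) (fun ω ω' => by simp),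
    ent_congr hp.1 (A := fun ω => (B ω, ())) (B := B) (fun ω ω' => by simp)] at h
  linarith

/-- Conditioning on more reduces entropy: `H(A|D') ≤ H(A|D)` when `D'` determines `D`. -/
theorem ent_cond_anti {Ω α β γ : Type*} [Fintype Ω] [Fintype α] [Fintype β] [Fintype γ] {p : Ω → ℝ}
    (hp : ∀ ω, 0 ≤ p ω) (A : Ω → α) {D : Ω → β} {D' : Ω → γ}
    (h : ∀ ω ω', D' ω = D' ω' → D ω = D ω') :
    ent p (fun ω => (A ω, D' ω)) - ent p D' ≤ ent p (fun ω => (A ω, D ω)) - ent p D := by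
  have h1 := ent_submod hp A D' D
  rw [ent_congr hp (A := fun ω => (A ω, D' ω, D ω)) (B := fun ω => (A ω, D' ω))
      (fun ω ω' => by simp only [Prod.mk.injEq]; have := h ω ω'; tauto),
    ent_congr hp (A := fun ω => (D' ω, D ω)) (B := D')
      (fun ω ω' => by simp only [Prod.mk.injEq]; have := h ω ω'; tauto)] at h1
  linarith

/-- Conditional entropy is subadditive over a family of variables. The family restricted to `S` is
the variable that hides (as `none`) the members outside `S`. -/
theorem ent_family_le {Ω ι α γ : Type*} [Fintype Ω] [Fintype ι] [DecidableEq ι] [Fintype α]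
    [Fintype γ] {p : Ω → ℝ} (hp : ∀ ω, 0 ≤ p ω) (A : ι → Ω → α) (D : Ω → γ) (S : Finset ι) :
    ent p (fun ω => (fun i => if i ∈ S then some (A i ω) else none, D ω)) - ent p D
      ≤ ∑ i ∈ S, (ent p (fun ω => (A i ω, D ω)) - ent p D) := by
  induction S using Finset.induction_on with
  | empty =>
    simp only [Finset.notMem_empty, if_false, Finset.sum_empty]
    rw [ent_congr hp (B := D) (fun ω ω' => by simp), sub_self]
  | insert i S hi ih =>
    rw [Finset.sum_insert hi]
    have h1 := ent_submod hp (A i) (fun ω => (fun i => if i ∈ S then some (A i ω) else none)) D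
    have h2 : ent p (fun ω => (A i ω, (fun i => if i ∈ S then some (A i ω) else none), D ω))
        = ent p (fun ω => (fun j => if j ∈ insert i S then some (A j ω) else none, D ω)) := by
      refine ent_congr hp fun ω ω' => ?_
      simp only [Prod.mk.injEq, funext_iff]
      constructor
      · rintro ⟨ha, hb, hd⟩
        refine ⟨fun j => ?_, hd⟩
        by_cases hj : j = i
        · subst hj; simp [ha]
        · simpa [hj] using hb j
      · rintro ⟨hb, hd⟩
        refine ⟨by simpa using hb i, fun j => ?_, hd⟩
        by_cases hj : j = i
        · subst hj; simp [hi]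
        · simpa [hj] using hb j
    rw [h2] at h1
    linarith

theorem shannon_prodLaw {ι α : Type*} [Fintype ι] [DecidableEq ι] [Fintype α] {p : ι → α → ℝ}
    (hp : ∀ i, p i ∈ stdSimplex ℝ α) : shannon (prodLaw p) = ∑ i, shannon (p i) := by
  have h1 : ∀ w, negMulLog (prodLaw p w) = -∑ i, prodLaw p w * Real.log (p i (w i)) := by
    intro w
    rw [negMulLog_eq, ← Finset.mul_sum]
    by_cases h : ∃ i, p i (w i) = 0
    · obtain ⟨i, hi⟩ := h
      have : prodLaw p w = 0 := Finset.prod_eq_zero (Finset.mem_univ i) hi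
      simp [this]
    · push Not at h
      rw [prodLaw, Real.log_prod fun i _ => h i]
  simp only [shannon, h1, Finset.sum_neg_distrib]
  rw [Finset.sum_comm, ← Finset.sum_neg_distrib]
  refine Finset.sum_congr rfl fun i _ => ?_
  rw [sum_prodLaw_apply hp i (fun a => Real.log (p i a)), ← Finset.sum_neg_distrib]
  simp only [negMulLog_eq]

theorem shannon_iid {ι α : Type*} [Fintype ι] [DecidableEq ι] [Fintype α] {p : α → ℝ}
    (hp : p ∈ stdSimplex ℝ α) :
    shannon (iid p : (ι → α) → ℝ) = Fintype.card ι * shannon p := by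
  rw [iid_eq_prodLaw, shannon_prodLaw fun _ => hp]
  simp

/-- Concavity of entropy. -/
theorem sum_mul_shannon_le {ι α : Type*} [Fintype α] (S : Finset ι) {l : ι → ℝ} (hl : ∀ i ∈ S, 0 ≤ l i)
    (hl1 : ∑ i ∈ S, l i = 1) {q : ι → α → ℝ} (hq : ∀ i ∈ S, ∀ a, 0 ≤ q i a) :
    ∑ i ∈ S, l i * shannon (q i) ≤ shannon (fun a => ∑ i ∈ S, l i * q i a) := by
  simp only [shannon, Finset.mul_sum]
  rw [Finset.sum_comm]
  refine Finset.sum_le_sum fun a _ => ?_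
  have := Real.concaveOn_negMulLog.le_map_sum (t := S) (w := l) (p := fun i => q i a) hl hl1
    (fun i hi => hq i hi a)
  simpa [smul_eq_mul] using this

theorem negMulLog_add_le {x y : ℝ} (hx : 0 ≤ x) (hy : 0 ≤ y) :
    negMulLog (x + y) ≤ negMulLog x + negMulLog y := by
  rcases hx.eq_or_lt with rfl | hx
  · simp
  rcases hy.eq_or_lt with rfl | hy
  · simp
  simp only [negMulLog_eq]
  have h1 := mul_le_mul_of_nonneg_left (Real.log_le_log hx (by linarith : x ≤ x + y)) hx.le
  have h2 := mul_le_mul_of_nonneg_left (Real.log_le_log hy (by linarith : y ≤ x + y)) hy.le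
  linarith

theorem negMulLog_sub_le {x y : ℝ} (hx : 0 ≤ x) (hxy : x ≤ y) (hy : y ≤ 1) :
    negMulLog x - negMulLog y ≤ y - x := by
  rcases hx.eq_or_lt with rfl | hx
  · have := Real.negMulLog_nonneg hxy hy
    simp; linarith
  · have hy0 : 0 < y := hx.trans_le hxy
    simp only [negMulLog_eq]
    have h1 := Real.log_le_sub_one_of_pos (div_pos hy0 hx)
    rw [Real.log_div hy0.ne' hx.ne'] at h1
    have h2 := mul_le_mul_of_nonneg_left h1 hx.le
    have h3 : x * (y / x - 1) = y - x := by field_simp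
    have h4 : (y - x) * Real.log y ≤ 0 :=
      mul_nonpos_of_nonneg_of_nonpos (by linarith) (Real.log_nonpos hy0.le hy)
    nlinarith

theorem negMulLog_le_one {x : ℝ} (hx : 0 ≤ x) : negMulLog x ≤ 1 := by
  have := Real.negMulLog_le_one_sub_self hx
  linarith

/-- A bound on the entropy of a nonnegative function, in terms of its total mass. -/
theorem shannon_le_of_sum {α : Type*} [Fintype α] [Nonempty α] {d : α → ℝ} (hd : ∀ a, 0 ≤ d a) :
    shannon d ≤ (∑ a, d a) * Real.log (Fintype.card α) + negMulLog (∑ a, d a) := by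
  have hc : (0 : ℝ) < Fintype.card α := by exact_mod_cast Fintype.card_pos
  rcases (Finset.sum_nonneg fun a _ => hd a : 0 ≤ ∑ a, d a).eq_or_lt with h0 | h0
  · rw [← h0]
    have : ∀ a, d a = 0 := fun a =>
      (Finset.sum_eq_zero_iff_of_nonneg fun a _ => hd a).1 h0.symm a (Finset.mem_univ a)
    simp [shannon, this]
  · set D := ∑ a, d a with hD
    have := sum_mul_log_le (q := fun _ : α => D / (Fintype.card α : ℝ)) hd
      (fun _ => by positivity) (fun _ _ => by positivity) (by
        rw [Finset.sum_const, Finset.card_univ, nsmul_eq_mul]; field_simp; exact hD.le)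
    rw [← Finset.sum_mul, ← hD, Real.log_div h0.ne' hc.ne'] at this
    simp only [shannon, negMulLog_eq, Finset.sum_neg_distrib]
    linarith

/-- One-sided continuity of entropy in variational distance, with a modulus that is linear in the
logarithm of the size of the alphabet. -/
theorem shannon_sub_le {α : Type*} [Fintype α] {p q : α → ℝ} (hp : p ∈ stdSimplex ℝ α)
    (hq : q ∈ stdSimplex ℝ α) :
    shannon p - shannon q ≤ tv p q * Real.log (Fintype.card α) + tv p q + 1 := by
  have hne : Nonempty α := by
    by_contra h
    rw [not_nonempty_iff] at h
    simpa using hq.2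
  have hc : (1 : ℝ) ≤ Fintype.card α := by exact_mod_cast Fintype.card_pos
  have h1 : ∀ a, negMulLog (p a) - negMulLog (q a)
      ≤ negMulLog (max (p a - q a) 0) + |p a - q a| := by
    intro a
    rcases le_total (q a) (p a) with h | h
    · rw [max_eq_left (by linarith)]
      have := negMulLog_add_le (hq.1 a) (by linarith : 0 ≤ p a - q a)
      rw [add_sub_cancel] at this
      have := abs_nonneg (p a - q a)
      linarith
    · rw [max_eq_right (by linarith), abs_of_nonpos (by linarith)]
      have := negMulLog_sub_le (hp.1 a) h (le_one_of_mem hq a)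
      simp; linarith
  have h2 := shannon_le_of_sum (d := fun a => max (p a - q a) 0) (fun a => le_max_right _ _)
  have h3 : ∑ a, max (p a - q a) 0 ≤ tv p q :=
    Finset.sum_le_sum fun a _ => max_le (le_abs_self _) (abs_nonneg _)
  have h4 : 0 ≤ ∑ a, max (p a - q a) 0 := Finset.sum_nonneg fun a _ => le_max_right _ _
  have h5 := negMulLog_le_one h4
  have h6 := mul_le_mul_of_nonneg_right h3 (Real.log_nonneg hc)
  have h7 : shannon p - shannon q ≤ shannon (fun a => max (p a - q a) 0) + tv p q := by
    simp only [shannon, tv, ← Finset.sum_sub_distrib, ← Finset.sum_add_distrib]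
    exact Finset.sum_le_sum fun a _ => h1 a
  linarith

theorem continuous_shannon {α : Type*} [Fintype α] : Continuous (shannon : (α → ℝ) → ℝ) := by
  unfold shannon
  exact continuous_finsetSum _ fun a _ => Real.continuous_negMulLog.comp (continuous_apply a)

theorem continuous_marg {Ω α : Type*} [Fintype Ω] (f : Ω → α) :
    Continuous (fun p : Ω → ℝ => marg p f) := by
  classical
  refine continuous_pi fun a => ?_
  simp only [marg_eq_sum_filter]
  fun_prop

theorem continuous_ent {Ω α : Type*} [Fintype Ω] [Fintype α] (f : Ω → α) :
    Continuous (fun p : Ω → ℝ => ent p f) :=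
  continuous_shannon.comp (continuous_marg f)

/-! ### Convex hulls in finite dimension -/

section

/-- Carathéodory's theorem with a fixed index type. -/
theorem exists_fin_of_mem_convexHull {E : Type*} [AddCommGroup E] [Module ℝ E]
    [FiniteDimensional ℝ E] {s : Set E} {x : E} (hx : x ∈ convexHull ℝ s) :
    ∃ w ∈ stdSimplex ℝ (Fin (Module.finrank ℝ E + 1)), ∃ z : Fin (Module.finrank ℝ E + 1) → E,
      (∀ i, z i ∈ s) ∧ ∑ i, w i • z i = x := by
  classical
  obtain ⟨ι, _, z, w, hz, hind, hw, hw1, hsum⟩ := eq_pos_convex_span_of_mem_convexHull hx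
  have hcard : Fintype.card ι ≤ Fintype.card (Fin (Module.finrank ℝ E + 1)) := by
    rw [Fintype.card_fin]
    exact hind.card_le_finrank_succ.trans (Nat.succ_le_succ (Submodule.finrank_le _))
  obtain ⟨f⟩ := Function.Embedding.nonempty_of_card_le hcard
  have hne : Nonempty ι := by
    by_contra h
    rw [not_nonempty_iff] at h
    simp at hw1
  obtain ⟨i₀⟩ := hne
  have hinv : ∀ i, Function.extend f z (fun _ => z i₀) (f i) = z i :=
    fun i => f.injective.extend_apply _ _ _
  have hinv' : ∀ i, Function.extend f w (fun _ => 0) (f i) = w i :=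
    fun i => f.injective.extend_apply _ _ _
  have hoff : ∀ j, j ∉ Finset.univ.map f → Function.extend f w (fun _ => 0) j = 0 := by
    intro j hj
    refine Function.extend_apply' _ _ _ ?_
    rintro ⟨i, rfl⟩
    exact hj (Finset.mem_map_of_mem _ (Finset.mem_univ i))
  refine ⟨Function.extend f w (fun _ => 0), ⟨fun j => ?_, ?_⟩,
    Function.extend f z (fun _ => z i₀), fun j => ?_, ?_⟩
  · by_cases hj : j ∈ Finset.univ.map f
    · obtain ⟨i, -, rfl⟩ := Finset.mem_map.1 hj
      rw [hinv']
      exact (hw i).le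
    · rw [hoff j hj]
  · rw [← Finset.sum_subset (Finset.subset_univ (Finset.univ.map f)) fun j _ hj => hoff j hj,
      Finset.sum_map]
    simpa only [hinv'] using hw1
  · by_cases hj : ∃ i, f i = j
    · obtain ⟨i, rfl⟩ := hj
      rw [hinv]
      exact hz ⟨i, rfl⟩
    · rw [Function.extend_apply' _ _ _ hj]
      exact hz ⟨i₀, rfl⟩
  · rw [← Finset.sum_subset (Finset.subset_univ (Finset.univ.map f))
      fun j _ hj => by rw [hoff j hj, zero_smul], Finset.sum_map]
    simpa only [hinv, hinv'] using hsum

theorem isCompact_convexHull_of_finiteDimensional {E : Type*} [NormedAddCommGroup E]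
    [NormedSpace ℝ E] [FiniteDimensional ℝ E] {s : Set E} (hs : IsCompact s) :
    IsCompact (convexHull ℝ s) := by
  let m := Module.finrank ℝ E + 1
  have hK : IsCompact (stdSimplex ℝ (Fin m) ×ˢ Set.univ.pi fun _ : Fin m => s) :=
    (isCompact_stdSimplex ℝ (Fin m)).prod (isCompact_univ_pi fun _ => hs)
  have hF : Continuous fun a : (Fin m → ℝ) × (Fin m → E) => ∑ i, a.1 i • a.2 i := by fun_prop
  have := hK.image hF
  convert! this
  ext x
  constructor
  · intro hx
    obtain ⟨w, hw, z, hz, h⟩ := exists_fin_of_mem_convexHull hx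
    exact ⟨(w, z), ⟨hw, fun i _ => hz i⟩, h⟩
  · rintro ⟨⟨w, z⟩, ⟨hw, hz⟩, rfl⟩
    exact (convex_convexHull ℝ s).sum_mem (fun i _ => hw.1 i) hw.2
      fun i _ => subset_convexHull ℝ s (hz i (Set.mem_univ i))

/-! ### Entropies of mixtures -/

/-- The chain rule: `H(X, Y) = H(X) + H(Y|X)`. -/
theorem shannon_mul_kernel {α β : Type*} [Fintype α] [Fintype β] (a : α → ℝ) (k : α → β → ℝ)
    (hk : ∀ x, a x ≠ 0 → ∑ y, k x y = 1) :
    shannon (fun z : α × β => a z.1 * k z.1 z.2) = shannon a + ∑ x, a x * shannon (k x) := by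
  simp only [shannon, Fintype.sum_prod_type, ← Finset.sum_add_distrib]
  refine Finset.sum_congr rfl fun x _ => ?_
  simp only [Real.negMulLog_mul, Finset.sum_add_distrib, ← Finset.mul_sum, ← Finset.sum_mul]
  by_cases h : a x = 0
  · simp [h]
  · rw [hk x h, one_mul]

/-- The entropy of `(W, f)` for a mixture with weights `l` and components `q w`. -/
theorem ent_mixture {ι Z α : Type*} [Fintype ι] [Fintype Z] [Fintype α] (l : ι → ℝ) (q : ι → Z → ℝ)
    (hq : ∀ i, ∑ z, q i z = 1) (f : Z → α) :
    ent (fun a : ι × Z => l a.1 * q a.1 a.2) (fun a => (a.1, f a.2))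
      = shannon l + ∑ i, l i * ent (q i) f := by
  have : marg (fun a : ι × Z => l a.1 * q a.1 a.2) (fun a => (a.1, f a.2))
      = fun b : ι × α => l b.1 * marg (q b.1) f b.2 := by
    classical
    funext ⟨j, b⟩
    simp only [marg, Fintype.sum_prod_type, Prod.mk.injEq, Finset.mul_sum]
    rw [Finset.sum_eq_single j]
    · exact Finset.sum_congr rfl fun z _ => by simp
    · intro i _ hi
      exact Finset.sum_eq_zero fun z _ => by simp [hi]
    · simp
  rw [ent, this, shannon_mul_kernel l (fun i => marg (q i) f) fun i _ => by rw [sum_marg, hq]]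
  rfl

theorem marg_snd_mixture {ι Z : Type*} [Fintype ι] [Fintype Z] (l : ι → ℝ) (q : ι → Z → ℝ) :
    marg (fun a : ι × Z => l a.1 * q a.1 a.2) Prod.snd = fun z => ∑ i, l i * q i z := by
  classical
  funext z
  simp [marg, Fintype.sum_prod_type]

/-! ### The fibres of an auxiliary variable -/

variable {𝒰 𝒳 𝒴 𝒱 : Type*} [Fintype 𝒰] [Fintype 𝒳] [Fintype 𝒴] [Fintype 𝒱]

/-- The law `r(u, x) P_{Y|X}(y|x) κ(v|y)` of `(U, X, Y, V)`: the possible conditional laws given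
one value of the auxiliary variable `W`. -/
def fibreLaw (pYX : 𝒳 → 𝒴 → ℝ) (r : 𝒰 × 𝒳 → ℝ) (κ : 𝒴 → 𝒱 → ℝ) (z : 𝒰 × 𝒳 × 𝒴 × 𝒱) : ℝ :=
  r (z.1, z.2.1) * pYX z.2.1 z.2.2.1 * κ z.2.2.1 z.2.2.2

/-- A fibre law together with its conditional entropies `H(U|X)` and `H(U,X,V|Y)`. The quantities
that describe the outer region are averages of these points over the values of `W`. -/
def fibrePoint (pYX : 𝒳 → 𝒴 → ℝ) (r : 𝒰 × 𝒳 → ℝ) (κ : 𝒴 → 𝒱 → ℝ) :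
    (𝒰 × 𝒳 × 𝒴 × 𝒱 → ℝ) × ℝ × ℝ :=
  (fibreLaw pYX r κ, ent (fibreLaw pYX r κ) (fun z => (z.1, z.2.1))
    - ent (fibreLaw pYX r κ) (fun z => z.2.1),
    ent (fibreLaw pYX r κ) (fun z => z) - ent (fibreLaw pYX r κ) (fun z => z.2.2.1))

/-- The set of all averages of fibre points. -/
def fibreHull (𝒰 𝒱 : Type*) [Fintype 𝒰] [Fintype 𝒱] (pYX : 𝒳 → 𝒴 → ℝ) :
    Set ((𝒰 × 𝒳 × 𝒴 × 𝒱 → ℝ) × ℝ × ℝ) :=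
  convexHull ℝ ((fun a : (𝒰 × 𝒳 → ℝ) × (𝒴 → 𝒱 → ℝ) => fibrePoint pYX a.1 a.2) ''
    (stdSimplex ℝ (𝒰 × 𝒳) ×ˢ Set.univ.pi fun _ => stdSimplex ℝ 𝒱))

theorem continuous_fibrePoint (pYX : 𝒳 → 𝒴 → ℝ) :
    Continuous fun a : (𝒰 × 𝒳 → ℝ) × (𝒴 → 𝒱 → ℝ) => fibrePoint pYX a.1 a.2 := by
  have h : Continuous fun a : (𝒰 × 𝒳 → ℝ) × (𝒴 → 𝒱 → ℝ) => fibreLaw pYX a.1 a.2 := by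
    refine continuous_pi fun z => ?_
    unfold fibreLaw
    fun_prop
  exact h.prodMk ((((continuous_ent _).comp h).sub ((continuous_ent _).comp h)).prodMk
    (((continuous_ent _).comp h).sub ((continuous_ent _).comp h)))

theorem isCompact_fibreHull (pYX : 𝒳 → 𝒴 → ℝ) : IsCompact (fibreHull 𝒰 𝒱 pYX) :=
  isCompact_convexHull_of_finiteDimensional
    (((isCompact_stdSimplex ℝ _).prod
      (isCompact_univ_pi fun _ => isCompact_stdSimplex ℝ _)).image (continuous_fibrePoint pYX))

theorem sum_fibreLaw {pYX : 𝒳 → 𝒴 → ℝ} (hYX : IsKernel pYX) {r : 𝒰 × 𝒳 → ℝ} {κ : 𝒴 → 𝒱 → ℝ}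
    (hκ : IsKernel κ) (u : 𝒰) (x : 𝒳) : ∑ y, ∑ v, fibreLaw pYX r κ (u, x, y, v) = r (u, x) := by
  simp [fibreLaw, ← Finset.mul_sum, (hκ _).2, (hYX _).2]

theorem marg_fibreLaw_UX {pYX : 𝒳 → 𝒴 → ℝ} (hYX : IsKernel pYX) {r : 𝒰 × 𝒳 → ℝ} {κ : 𝒴 → 𝒱 → ℝ}
    (hκ : IsKernel κ) : marg (fibreLaw pYX r κ) (fun z => (z.1, z.2.1)) = r := by
  classical
  funext a
  rw [← sum_fibreLaw (r := r) hYX hκ a.1 a.2]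
  simp only [marg, Fintype.sum_prod_type]
  rw [Finset.sum_eq_single a.1, Finset.sum_eq_single a.2]
  · simp
  · intro x _ hx
    simp [Prod.ext_iff, hx]
  · simp
  · intro x _ hx
    simp [Prod.ext_iff, hx]
  · simp

theorem fibreLaw_mem {pYX : 𝒳 → 𝒴 → ℝ} (hYX : IsKernel pYX) {r : 𝒰 × 𝒳 → ℝ}
    (hr : r ∈ stdSimplex ℝ (𝒰 × 𝒳)) {κ : 𝒴 → 𝒱 → ℝ} (hκ : IsKernel κ) :
    fibreLaw pYX r κ ∈ stdSimplex ℝ (𝒰 × 𝒳 × 𝒴 × 𝒱) := by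
  refine ⟨fun z => mul_nonneg (mul_nonneg (hr.1 _) ((hYX _).1 _)) ((hκ _).1 _), ?_⟩
  simp only [Fintype.sum_prod_type, sum_fibreLaw hYX hκ]
  rw [← hr.2, Fintype.sum_prod_type]

/-- The mutual information `I(X;Y)`, in nats, when `Y` is the output of the channel `P_{Y|X}`. -/
def channelInfo (pYX : 𝒳 → 𝒴 → ℝ) (P : 𝒰 × 𝒳 × 𝒴 × 𝒱 → ℝ) : ℝ :=
  ent P (fun z => z.2.2.1) - ∑ x, marg P (fun z => z.2.1) x * shannon (pYX x)

theorem ent_fibreLaw_XY {pYX : 𝒳 → 𝒴 → ℝ} (hYX : IsKernel pYX) {r : 𝒰 × 𝒳 → ℝ} {κ : 𝒴 → 𝒱 → ℝ}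
    (hκ : IsKernel κ) :
    ent (fibreLaw pYX r κ) (fun z => (z.2.1, z.2.2.1)) = ent (fibreLaw pYX r κ) (fun z => z.2.1)
      + ∑ x, marg (fibreLaw pYX r κ) (fun z => z.2.1) x * shannon (pYX x) := by
  classical
  have h1 : ∀ x, marg (fibreLaw pYX r κ) (fun z => z.2.1) x = ∑ u, r (u, x) := by
    intro x
    simp only [marg, Fintype.sum_prod_type]
    refine Finset.sum_congr rfl fun u _ => ?_
    rw [← sum_fibreLaw (r := r) hYX hκ u x, Finset.sum_eq_single x]
    · simp
    · intro x' _ hx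
      simp [hx]
    · simp
  have h2 : marg (fibreLaw pYX r κ) (fun z => (z.2.1, z.2.2.1))
      = fun a : 𝒳 × 𝒴 => marg (fibreLaw pYX r κ) (fun z => z.2.1) a.1 * pYX a.1 a.2 := by
    funext a
    rw [h1, Finset.sum_mul]
    simp only [marg, Fintype.sum_prod_type]
    refine Finset.sum_congr rfl fun u _ => ?_
    rw [Finset.sum_eq_single a.1, Finset.sum_eq_single a.2]
    · simp [fibreLaw, ← Finset.mul_sum, (hκ _).2]
    · intro y _ hy
      simp [Prod.ext_iff, hy]
    · simp
    · intro x _ hx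
      simp [Prod.ext_iff, hx]
    · simp
  rw [ent, h2, shannon_mul_kernel _ _ fun x _ => (hYX x).2]
  rfl

/-- The average of fibre points is described by the entropies of the mixture. -/
theorem sum_smul_fibrePoint {ι : Type*} [Fintype ι] {pYX : 𝒳 → 𝒴 → ℝ} (hYX : IsKernel pYX)
    (l : ι → ℝ) {r : ι → 𝒰 × 𝒳 → ℝ}
    (hr : ∀ i, r i ∈ stdSimplex ℝ (𝒰 × 𝒳)) {κ : ι → 𝒴 → 𝒱 → ℝ} (hκ : ∀ i, IsKernel (κ i))
    {Q : ι × (𝒰 × 𝒳 × 𝒴 × 𝒱) → ℝ} (hQ : ∀ a, Q a = l a.1 * fibreLaw pYX (r a.1) (κ a.1) a.2) :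
    ∑ i, l i • fibrePoint pYX (r i) (κ i)
      = (marg Q Prod.snd, ent Q (fun a => (a.1, a.2.1, a.2.2.1)) - ent Q (fun a => (a.1, a.2.2.1)),
        ent Q (fun a => (a.1, a.2)) - ent Q (fun a => (a.1, a.2.2.2.1))) := by
  have hQ' : Q = fun a => l a.1 * fibreLaw pYX (r a.1) (κ a.1) a.2 := funext hQ
  have hs : ∀ i, ∑ z, fibreLaw pYX (r i) (κ i) z = 1 := fun i => (fibreLaw_mem hYX (hr i) (hκ i)).2
  subst hQ'
  rw [marg_snd_mixture l (fun i => fibreLaw pYX (r i) (κ i)),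
    ent_mixture l (fun i => fibreLaw pYX (r i) (κ i)) hs (fun z => (z.1, z.2.1)),
    ent_mixture l (fun i => fibreLaw pYX (r i) (κ i)) hs (fun z => z.2.1),
    ent_mixture l (fun i => fibreLaw pYX (r i) (κ i)) hs (fun z => z),
    ent_mixture l (fun i => fibreLaw pYX (r i) (κ i)) hs (fun z => z.2.2.1)]
  simp only [fibrePoint, Prod.smul_mk, smul_eq_mul]
  refine Prod.ext ?_ (Prod.ext ?_ ?_)
  · funext z
    simp [Prod.fst_sum]
  · simp only [Prod.fst_sum, Prod.snd_sum, mul_sub, Finset.sum_sub_distrib]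
    ring
  · simp only [Prod.snd_sum, mul_sub, Finset.sum_sub_distrib]
    ring

/-- The law of `(W, U, X, Y, V)` yields a point of the hull whenever `Y` is the channel output for
the input `X`, independently of `(W, U)`, and `V` is a stochastic function of `(W, Y)`. -/
theorem mem_fibreHull_of_joint {𝒲 : Type*} [Fintype 𝒲] {pYX : 𝒳 → 𝒴 → ℝ} (hYX : IsKernel pYX)
    {q : 𝒲 → 𝒰 × 𝒳 → ℝ} (hq : ∀ w a, 0 ≤ q w a) (hq1 : ∑ w, ∑ a, q w a = 1)
    {κ : 𝒲 → 𝒴 → 𝒱 → ℝ} (hκ : ∀ w, IsKernel (κ w))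
    {Q : 𝒲 × (𝒰 × 𝒳 × 𝒴 × 𝒱) → ℝ} (hQ : ∀ a, Q a = fibreLaw pYX (q a.1) (κ a.1) a.2) :
    (marg Q Prod.snd, ent Q (fun a => (a.1, a.2.1, a.2.2.1)) - ent Q (fun a => (a.1, a.2.2.1)),
        ent Q (fun a => (a.1, a.2)) - ent Q (fun a => (a.1, a.2.2.2.1))) ∈ fibreHull 𝒰 𝒱 pYX := by
  classical
  have hne : Nonempty (𝒰 × 𝒳) := by
    by_contra h
    rw [not_nonempty_iff] at h
    simp at hq1
  obtain ⟨a₀⟩ := hne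
  let l : 𝒲 → ℝ := fun w => ∑ a, q w a
  have hl : ∀ w, 0 ≤ l w := fun w => Finset.sum_nonneg fun a _ => hq w a
  let r : 𝒲 → 𝒰 × 𝒳 → ℝ := fun w => if l w = 0 then Pi.single a₀ 1 else fun a => q w a / l w
  have hr : ∀ w, r w ∈ stdSimplex ℝ (𝒰 × 𝒳) := by
    intro w
    by_cases h : l w = 0
    · simp only [r, if_pos h]
      exact single_mem_stdSimplex ℝ a₀
    · simp only [r, if_neg h]
      refine ⟨fun a => div_nonneg (hq w a) (hl w), ?_⟩
      rw [← Finset.sum_div]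
      exact div_self h
  have hlr : ∀ w a, l w * r w a = q w a := by
    intro w a
    by_cases h : l w = 0
    · rw [h, zero_mul]
      exact ((Finset.sum_eq_zero_iff_of_nonneg fun a _ => hq w a).1 h a (Finset.mem_univ a)).symm
    · simp only [r, if_neg h]
      field_simp
  rw [← sum_smul_fibrePoint hYX l hr hκ (fun a => by rw [hQ]; simp only [fibreLaw, ← hlr]; ring)]
  exact (convex_convexHull ℝ _).sum_mem (fun w _ => hl w) hq1 fun w _ => subset_convexHull ℝ _
    ⟨(r w, κ w), ⟨hr w, fun y _ => hκ w y⟩, rfl⟩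

end

/-! ### The outer region in terms of fibre points -/

section

variable {𝒰 𝒳 𝒴 𝒱 : Type*} [Fintype 𝒰] [Fintype 𝒳] [Fintype 𝒴] [Fintype 𝒱]

theorem marg_sum_mul {Ω ι α : Type*} [Fintype Ω] (S : Finset ι) (l : ι → ℝ) (q : ι → Ω → ℝ)
    (f : Ω → α) (a : α) :
    marg (fun ω => ∑ i ∈ S, l i * q i ω) f a = ∑ i ∈ S, l i * marg (q i) f a := by
  classical
  simp only [marg_eq_sum_filter, Finset.mul_sum]
  exact Finset.sum_comm

/-- The outer region in terms of the hull of the fibre points: `a` lists the law of `(U, X, Y, V)`,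
`H(U|X,W)` and `H(U,X,V|Y,W)`. -/
def IsOuterPoint (pU : 𝒰 → ℝ) (pYX : 𝒳 → 𝒴 → ℝ) (R : ℝ)
    (a : (𝒰 × 𝒳 × 𝒴 × 𝒱 → ℝ) × ℝ × ℝ) : Prop :=
  a ∈ fibreHull 𝒰 𝒱 pYX ∧
  (∀ u x, marg a.1 (fun z => (z.1, z.2.1)) (u, x) = pU u * marg a.1 (fun z => z.2.1) x) ∧
  shannon pU - a.2.1 ≤ channelInfo pYX a.1 ∧
  shannon a.1 - ent a.1 (fun z => z.2.2.1) - a.2.2 ≤ R * Real.log 2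

theorem continuous_channelInfo (pYX : 𝒳 → 𝒴 → ℝ) :
    Continuous (channelInfo pYX : (𝒰 × 𝒳 × 𝒴 × 𝒱 → ℝ) → ℝ) := by
  unfold channelInfo
  refine (continuous_ent _).sub (continuous_finsetSum _ fun x _ => ?_)
  exact ((continuous_apply x).comp (continuous_marg _)).mul continuous_const

/-- The conditions of the outer region pass to limits, because the fibre hull is compact. -/
theorem exists_isOuterPoint_of_tendsto {pU : 𝒰 → ℝ} {pYX : 𝒳 → 𝒴 → ℝ}
    {a : ℕ → (𝒰 × 𝒳 × 𝒴 × 𝒱 → ℝ) × ℝ × ℝ} {s R : ℕ → ℝ} {P : 𝒰 × 𝒳 × 𝒴 × 𝒱 → ℝ} {R' : ℝ}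
    (h1 : ∀ k, a k ∈ fibreHull 𝒰 𝒱 pYX)
    (h2 : ∀ k u x, marg (a k).1 (fun z => (z.1, z.2.1)) (u, x)
      = pU u * marg (a k).1 (fun z => z.2.1) x)
    (h3 : ∀ k, shannon pU - (a k).2.1 ≤ channelInfo pYX (a k).1 + s k)
    (h4 : ∀ k, shannon (a k).1 - ent (a k).1 (fun z => z.2.2.1) - (a k).2.2 ≤ R k * Real.log 2)
    (hP : Tendsto (fun k => (a k).1) atTop (𝓝 P)) (hs : Tendsto s atTop (𝓝 0))
    (hR : Tendsto R atTop (𝓝 R')) :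
    ∃ b, b.1 = P ∧ IsOuterPoint pU pYX R' b := by
  obtain ⟨b, hb, φ, hφ, hlim⟩ := (isCompact_fibreHull (𝒰 := 𝒰) (𝒱 := 𝒱) pYX).tendsto_subseq h1
  have hφ' := hφ.tendsto_atTop
  have hl1 : Tendsto (fun k => (a (φ k)).1) atTop (𝓝 b.1) := (continuous_fst.tendsto b).comp hlim
  have hl2 : Tendsto (fun k => (a (φ k)).2.1) atTop (𝓝 b.2.1) :=
    ((continuous_fst.comp continuous_snd).tendsto b).comp hlim
  have hl3 : Tendsto (fun k => (a (φ k)).2.2) atTop (𝓝 b.2.2) :=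
    ((continuous_snd.comp continuous_snd).tendsto b).comp hlim
  refine ⟨b, tendsto_nhds_unique hl1 (hP.comp hφ'), hb, fun u x => ?_, ?_, ?_⟩
  · have e1 := (((continuous_apply (u, x)).comp
      (continuous_marg (fun z : 𝒰 × 𝒳 × 𝒴 × 𝒱 => (z.1, z.2.1)))).tendsto b.1).comp hl1
    have e2 := ((((continuous_apply x).comp
      (continuous_marg (fun z : 𝒰 × 𝒳 × 𝒴 × 𝒱 => z.2.1))).tendsto b.1).comp hl1).const_mul (pU u)
    refine tendsto_nhds_unique e1 (e2.congr fun k => ?_)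
    exact (h2 (φ k) u x).symm
  · have e := ((continuous_channelInfo pYX).tendsto b.1).comp hl1
    have := le_of_tendsto_of_tendsto' (hl2.const_sub (shannon pU)) (e.add (hs.comp hφ'))
      fun k => h3 (φ k)
    simpa using this
  · have e1 := (continuous_shannon.tendsto b.1).comp hl1
    have e2 := ((continuous_ent (fun z : 𝒰 × 𝒳 × 𝒴 × 𝒱 => z.2.2.1)).tendsto b.1).comp hl1
    exact le_of_tendsto_of_tendsto' ((e1.sub e2).sub hl3)
      ((hR.comp hφ').mul_const (Real.log 2)) fun k => h4 (φ k)

theorem finrank_fibreSpace :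
    Module.finrank ℝ ((𝒰 × 𝒳 × 𝒴 × 𝒱 → ℝ) × ℝ × ℝ) = Fintype.card (𝒰 × 𝒳 × 𝒴 × 𝒱) + 2 := by
  rw [Module.finrank_prod, Module.finrank_prod, Module.finrank_self, Module.finrank_fintype_fun_eq_card]

/-- The bijection that moves the auxiliary variable to the front. -/
def auxEquiv (𝒰 𝒳 𝒲 𝒴 𝒱 : Type*) : 𝒰 × 𝒳 × 𝒲 × 𝒴 × 𝒱 ≃ 𝒲 × (𝒰 × 𝒳 × 𝒴 × 𝒱) where
  toFun z := (z.2.2.1, z.1, z.2.1, z.2.2.2.1, z.2.2.2.2)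
  invFun z := (z.2.1, z.2.2.1, z.1, z.2.2.2.1, z.2.2.2.2)
  left_inv _ := rfl
  right_inv _ := rfl

theorem mutualInfo_eq {Ω α β : Type*} [Fintype Ω] [Fintype α] [Fintype β] {p : Ω → ℝ}
    (hp : ∀ ω, 0 ≤ p ω) (A : Ω → α) (B : Ω → β) :
    mutualInfo p A B = (ent p A + ent p B - ent p (fun ω => (A ω, B ω))) / Real.log 2 := by
  rw [mutualInfo, entropy_eq, condEntropy_eq hp]
  ring

theorem condMutualInfo_eq {Ω α β γ : Type*} [Fintype Ω] [Fintype α] [Fintype β] [Fintype γ]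
    {p : Ω → ℝ} (hp : ∀ ω, 0 ≤ p ω) (A : Ω → α) (B : Ω → β) (C : Ω → γ) :
    condMutualInfo p A B C = (ent p (fun ω => (A ω, C ω)) + ent p (fun ω => (B ω, C ω))
      - ent p (fun ω => (A ω, B ω, C ω)) - ent p C) / Real.log 2 := by
  rw [condMutualInfo, condEntropy_eq hp, condEntropy_eq hp]
  ring

theorem ent_comp_equiv {Ω Ω' α : Type*} [Fintype Ω] [Fintype Ω'] [Fintype α] (p : Ω → ℝ)
    (e : Ω' ≃ Ω) (f : Ω → α) : ent (fun ω => p (e ω)) (fun ω => f (e ω)) = ent p f := by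
  rw [ent, marg_equiv_comp, ent]

theorem ent_marg {Ω α β : Type*} [Fintype Ω] [Fintype α] [Fintype β] (p : Ω → ℝ) (f : Ω → α)
    (g : α → β) : ent (marg p f) g = ent p (fun ω => g (f ω)) := by
  rw [ent, marg_marg, ent]

/-- A nonnegative function with row sums `s` is `s` times a kernel; the rows of the kernel on which `s`
vanishes are taken from `k₀`. -/
theorem exists_kernel_of_sum_eq {β α : Type*} [Fintype α] {s : β → ℝ} {f : β → α → ℝ}
    (hf : ∀ b a, 0 ≤ f b a) (hs : ∀ b, ∑ a, f b a = s b) {k₀ : β → α → ℝ} (hk₀ : IsKernel k₀) :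
    ∃ k : β → α → ℝ, IsKernel k ∧ ∀ b a, f b a = s b * k b a := by
  classical
  refine ⟨fun b => if s b = 0 then k₀ b else fun a => f b a / s b, fun b => ?_, fun b a => ?_⟩
  · by_cases h : s b = 0
    · simp only [if_pos h]; exact hk₀ b
    · simp only [if_neg h]
      refine ⟨fun a => div_nonneg (hf b a) (hs b ▸ Finset.sum_nonneg fun a _ => hf b a), ?_⟩
      rw [← Finset.sum_div, hs, div_self h]
  · by_cases h : s b = 0
    · rw [h, zero_mul]
      exact (Finset.sum_eq_zero_iff_of_nonneg fun a _ => hf b a).1 ((hs b).trans h) a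
        (Finset.mem_univ a)
    · simp only [if_neg h]
      field_simp

/-- By Carathéodory's theorem the point is an average of `|𝒰 × 𝒳 × 𝒴 × 𝒱| + 3` fibre points; the index
of the fibre is the auxiliary variable. -/
theorem mem_outerRegion_of_isOuterPoint {pU : 𝒰 → ℝ} {pYX : 𝒳 → 𝒴 → ℝ} (hYX : IsKernel pYX)
    {R : ℝ} {a : (𝒰 × 𝒳 × 𝒴 × 𝒱 → ℝ) × ℝ × ℝ} (ha : IsOuterPoint pU pYX R a) :
    (a.1, R) ∈ outerRegion pU pYX := by
  obtain ⟨hmem, hfac, hI, hR⟩ := ha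
  obtain ⟨l, hl, z, hz, hsum⟩ := exists_fin_of_mem_convexHull hmem
  -- the fibre space has dimension `|𝒰 × 𝒳 × 𝒴 × 𝒱| + 2`, which leaves one value of `W` to spare
  have hm : Module.finrank ℝ ((𝒰 × 𝒳 × 𝒴 × 𝒱 → ℝ) × ℝ × ℝ) + 1
      = Fintype.card (𝒰 × 𝒳 × 𝒴 × 𝒱) + 3 := by rw [finrank_fibreSpace]
  generalize Module.finrank ℝ ((𝒰 × 𝒳 × 𝒴 × 𝒱 → ℝ) × ℝ × ℝ) + 1 = m at l hl z hz hsum hm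
  choose g hg hgz using hz
  let r : Fin m → 𝒰 × 𝒳 → ℝ := fun i => (g i).1
  let κ : Fin m → 𝒴 → 𝒱 → ℝ := fun i => (g i).2
  have hr : ∀ i, r i ∈ stdSimplex ℝ (𝒰 × 𝒳) := fun i => (hg i).1
  have hκ : ∀ i, IsKernel (κ i) := fun i y => (hg i).2 y (Set.mem_univ y)
  let Q₀ : Fin m × (𝒰 × 𝒳 × 𝒴 × 𝒱) → ℝ := fun b => l b.1 * fibreLaw pYX (r b.1) (κ b.1) b.2
  have hrepr := sum_smul_fibrePoint hYX l hr hκ (Q := Q₀) fun _ => rfl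
  have hz' : ∀ i, z i = fibrePoint pYX (r i) (κ i) := fun i => (hgz i).symm
  simp only [← hz'] at hrepr
  rw [hsum] at hrepr
  have hfib : ∀ i, fibreLaw pYX (r i) (κ i) ∈ stdSimplex ℝ (𝒰 × 𝒳 × 𝒴 × 𝒱) :=
    fun i => fibreLaw_mem hYX (hr i) (hκ i)
  have hQ₀ : Q₀ ∈ stdSimplex ℝ (Fin m × (𝒰 × 𝒳 × 𝒴 × 𝒱)) := by
    refine ⟨fun b => mul_nonneg (hl.1 _) ((hfib _).1 _), ?_⟩
    rw [Fintype.sum_prod_type]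
    simp [Q₀, ← Finset.mul_sum, (hfib _).2, hl.2]
  obtain ⟨P, h1, h2⟩ := a
  simp only [Prod.mk.injEq] at hrepr hfac hI hR ⊢
  obtain ⟨hP, hh1, hh2⟩ := hrepr
  have hPmem : P ∈ stdSimplex ℝ (𝒰 × 𝒳 × 𝒴 × 𝒱) := hP ▸ marg_mem hQ₀ _
  have hPsum : P = fun z => ∑ i, l i * fibreLaw pYX (r i) (κ i) z := by
    rw [hP]
    exact marg_snd_mixture l fun i => fibreLaw pYX (r i) (κ i)
  set pX := marg P (fun z => z.2.1) with hpX
  have hpXmem : pX ∈ stdSimplex ℝ 𝒳 := marg_mem hPmem _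
  have hUX : ∀ u x, ∑ i, l i * r i (u, x) = pU u * pX x := by
    intro u x
    rw [← hfac, hPsum, marg_sum_mul]
    simp only [marg_fibreLaw_UX hYX (hκ _)]
  have hU : marg P (fun z => z.1) = pU := by
    funext u
    have h3 := sum_marg_pair P (fun z => z.1) (fun z => z.2.1) u
    simp only [hfac, ← Finset.mul_sum, hpXmem.2, mul_one] at h3
    exact h3.symm
  have hne : Nonempty (Fin m) := ⟨⟨0, by omega⟩⟩
  obtain ⟨i₀⟩ := hne
  -- the kernels
  obtain ⟨pV, hpV, hPV⟩ := exists_kernel_of_sum_eq (β := 𝒰 × 𝒳 × 𝒴)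
    (s := fun b => pU b.1 * pX b.2.1 * pYX b.2.1 b.2.2) (f := fun b v => P (b.1, b.2.1, b.2.2, v))
    (fun b v => hPmem.1 _) (fun b => by
      rw [hPsum, Finset.sum_comm, ← hUX, Finset.sum_mul]
      refine Finset.sum_congr rfl fun i _ => ?_
      simp only [fibreLaw, ← Finset.mul_sum, (hκ i _).2]
      ring) (k₀ := fun b => κ i₀ b.2.2) (fun b => hκ i₀ _)
  obtain ⟨pW, hpW, hPW⟩ := exists_kernel_of_sum_eq (β := 𝒰 × 𝒳)
    (s := fun b => pU b.1 * pX b.2) (f := fun b i => l i * r i b)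
    (fun b i => mul_nonneg (hl.1 i) ((hr i).1 _)) (fun b => hUX b.1 b.2)
    (k₀ := fun _ => l) (fun b => hl)
  let Q : 𝒰 × 𝒳 × Fin m × 𝒴 × 𝒱 → ℝ := fun z => Q₀ (auxEquiv _ _ _ _ _ z)
  have hQn : ∀ z, 0 ≤ Q z := fun z => hQ₀.1 _
  have hlog : 0 < Real.log 2 := Real.log_pos (by norm_num)
  refine ⟨m, Q, ⟨⟨pX, hpXmem, ⟨pV, hpV, fun u x y v => hPV (u, x, y) v⟩, pW, fun b => κ b.1 b.2,
    hpW, fun b => hκ _ _, ?_⟩, ?_, ?_⟩, ?_, by omega⟩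
  · funext ⟨u, x, i, y, v⟩
    have := hPW (u, x) i
    simp only [Q, Q₀, auxEquiv, Equiv.coe_fn_mk, joint, fibreLaw] at this ⊢
    rw [← this]
    ring
  · rw [hP]
    exact marg_equiv_comp Q₀ (auxEquiv _ _ _ _ _) Prod.snd
  · rw [mutualInfo_eq hQn, mutualInfo_eq hQn]
    refine div_le_div_of_nonneg_right ?_ hlog.le
    have e1 : ent Q (fun z => ((rvW z, rvX z), rvU z))
        = ent Q₀ (fun a => (a.1, a.2.1, a.2.2.1)) := by
      rw [← ent_comp_equiv Q₀ (auxEquiv 𝒰 𝒳 (Fin m) 𝒴 𝒱)]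
      exact ent_congr hQn fun ω ω' => by
        simp only [rvW, rvX, rvU, auxEquiv, Equiv.coe_fn_mk, Prod.mk.injEq]; tauto
    have e2 : ent Q (fun z => (rvW z, rvX z)) = ent Q₀ (fun a => (a.1, a.2.2.1)) :=
      ent_comp_equiv Q₀ (auxEquiv 𝒰 𝒳 (Fin m) 𝒴 𝒱) (fun a => (a.1, a.2.2.1))
    have e3 : ent Q rvU = shannon pU := by
      rw [← hU, hP, marg_marg]
      exact ent_comp_equiv Q₀ (auxEquiv 𝒰 𝒳 (Fin m) 𝒴 𝒱) (fun a => a.2.1)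
    have e4 : ent Q rvY = ent P (fun z => z.2.2.1) := by
      rw [hP, ent_marg]
      exact ent_comp_equiv Q₀ (auxEquiv 𝒰 𝒳 (Fin m) 𝒴 𝒱) (fun a => a.2.2.2.1)
    have e5 : ent Q (fun z => ((rvW z, rvX z), rvY z))
        = ent Q₀ (fun a => (a.1, a.2.2.1)) + ∑ x, pX x * shannon (pYX x) := by
      have h3 : ent Q (fun z => ((rvW z, rvX z), rvY z))
          = ent Q₀ (fun a => (a.1, (a.2.2.1, a.2.2.2.1))) := by
        rw [← ent_comp_equiv Q₀ (auxEquiv 𝒰 𝒳 (Fin m) 𝒴 𝒱)]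
        exact ent_congr hQn fun ω ω' => by
          simp only [rvW, rvX, rvY, auxEquiv, Equiv.coe_fn_mk, Prod.mk.injEq]; tauto
      rw [h3, ent_mixture l (fun i => fibreLaw pYX (r i) (κ i)) (fun i => (hfib i).2)
        (fun z => (z.2.1, z.2.2.1)),
        ent_mixture l (fun i => fibreLaw pYX (r i) (κ i)) (fun i => (hfib i).2) (fun z => z.2.1)]
      simp only [ent_fibreLaw_XY hYX (hκ _), mul_add, Finset.sum_add_distrib, add_assoc]
      congr 2
      rw [hpX, hPsum]
      simp only [marg_sum_mul, Finset.mul_sum, Finset.sum_mul]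
      rw [Finset.sum_comm]
      exact Finset.sum_congr rfl fun _ _ => Finset.sum_congr rfl fun _ _ => by ring
    rw [e1, e2, e3, e4, e5]
    rw [channelInfo] at hI
    linarith
  · rw [condMutualInfo_eq hQn, div_le_iff₀ hlog]
    have e1 : ent Q (fun z => (rvW z, rvY z)) = ent Q₀ (fun a => (a.1, a.2.2.2.1)) :=
      ent_comp_equiv Q₀ (auxEquiv 𝒰 𝒳 (Fin m) 𝒴 𝒱) (fun a => (a.1, a.2.2.2.1))
    have e2 : ent Q rvY = ent P (fun z => z.2.2.1) := by
      rw [hP, ent_marg]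
      exact ent_comp_equiv Q₀ (auxEquiv 𝒰 𝒳 (Fin m) 𝒴 𝒱) (fun a => a.2.2.2.1)
    have e3 : ent Q (fun z => (rvW z, (rvU z, rvX z, rvV z), rvY z))
        = ent Q₀ (fun a => (a.1, a.2)) := by
      rw [← ent_comp_equiv Q₀ (auxEquiv 𝒰 𝒳 (Fin m) 𝒴 𝒱)]
      exact ent_congr hQn fun ω ω' => by
        simp only [rvW, rvX, rvU, rvV, rvY, auxEquiv, Equiv.coe_fn_mk, Prod.mk.injEq]; tauto
    have e4 : ent Q (fun z => ((rvU z, rvX z, rvV z), rvY z)) = shannon P := by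
      have : shannon P = ent P (fun z => z) := by rw [ent, marg_id]
      rw [this, hP, ent_marg, ← ent_comp_equiv Q₀ (auxEquiv 𝒰 𝒳 (Fin m) 𝒴 𝒱)]
      exact ent_congr hQn fun ω ω' => by
        simp only [rvX, rvU, rvV, rvY, auxEquiv, Equiv.coe_fn_mk, Prod.mk.injEq]; tauto
    rw [e1, e2, e3, e4]
    linarith

end

/-! ### Independence of a coordinate from the others -/

section

theorem marg_comp_apply {Ω α : Type*} [Fintype Ω] [Fintype α] {p : Ω → ℝ} {f : Ω → α} {q : α → ℝ}
    (h : marg p f = q) (φ : α → ℝ) : ∑ ω, p ω * φ (f ω) = ∑ a, q a * φ a := by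
  rw [← h, sum_marg_mul]

/-- A function of the other coordinates is independent of the coordinate `t`. -/
theorem sum_iid_mul_indep {ι α : Type*} [Fintype ι] [DecidableEq ι] [Fintype α] {p : α → ℝ}
    (hp : p ∈ stdSimplex ℝ α) (t : ι) (ψ : α → ℝ) (φ : (ι → α) → ℝ)
    (hφ : ∀ u b, φ (Function.update u t b) = φ u) :
    ∑ u : ι → α, iid p u * (ψ (u t) * φ u) = (∑ a, p a * ψ a) * ∑ u : ι → α, iid p u * φ u := by
  have hne : Nonempty α := by
    by_contra h
    rw [not_nonempty_iff] at h
    simpa using hp.2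
  obtain ⟨b₀⟩ := hne
  have key : ∀ χ : α → ℝ, ∑ u : ι → α, iid p u * (χ (u t) * φ u)
      = (∑ a, p a * χ a) * ∑ r : {j // j ≠ t} → α,
        (∏ j, p (r j)) * φ ((Equiv.funSplitAt t α).symm (b₀, r)) := by
    intro χ
    rw [← (Equiv.funSplitAt t α).symm.sum_comp, Fintype.sum_prod_type, Finset.sum_mul_sum]
    refine Finset.sum_congr rfl fun b _ => Finset.sum_congr rfl fun r _ => ?_
    have h1 : (Equiv.funSplitAt t α).symm (b, r)
        = Function.update ((Equiv.funSplitAt t α).symm (b₀, r)) t b := by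
      funext j
      by_cases hj : j = t
      · subst hj; simp [Equiv.funSplitAt, Equiv.piSplitAt]
      · simp [Equiv.funSplitAt, Equiv.piSplitAt, hj]
    have h2 : φ ((Equiv.funSplitAt t α).symm (b, r)) = φ ((Equiv.funSplitAt t α).symm (b₀, r)) := by
      rw [h1, hφ]
    have h3 : iid p ((Equiv.funSplitAt t α).symm (b, r)) = p b * ∏ j, p (r j) := by
      rw [iid, Fintype.prod_eq_mul_prod_subtype_ne _ t]
      congr 1
      · simp [Equiv.funSplitAt, Equiv.piSplitAt]
      · refine Finset.prod_congr rfl fun j _ => ?_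
        simp [Equiv.funSplitAt, Equiv.piSplitAt, j.2]
    have h4 : (Equiv.funSplitAt t α).symm (b, r) t = b := by
      simp [Equiv.funSplitAt, Equiv.piSplitAt]
    rw [h2, h3, h4]
    ring
  have h1 := key (fun _ => 1)
  simp only [one_mul, mul_one, hp.2] at h1
  rw [key ψ, h1]

variable {𝒰 𝒳 𝒴 𝒱 : Type*} [Fintype 𝒰] [Fintype 𝒳] [Fintype 𝒴] [Fintype 𝒱]

/-! ### The sample space of a code -/

variable {n M : ℕ} (K : Code 𝒰 𝒳 𝒴 𝒱 n M)

/-- The channel input `Xᵢ` as a function of the common randomness, the local randomness and the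
source sequence. -/
def Code.input (c : Fin M) (s : Fin K.numS) (u : Fin n → 𝒰) (i : Fin n) : 𝒳 :=
  K.f i (past u i) c s

/-- The sample points `(C, S, U^n, Y^n, V^n)` of a code. -/
abbrev Code.Sample : Type _ :=
  Fin M × Fin K.numS × (Fin n → 𝒰) × (Fin n → 𝒴) × (Fin n → 𝒱)

/-- The joint law of `(C, S, U^n)`. -/
def Code.base (pU : 𝒰 → ℝ) (d : Fin M × Fin K.numS × (Fin n → 𝒰)) : ℝ :=
  1 / (M : ℝ) * K.pS d.2.1 * iid pU d.2.2

/-- The joint law of `(C, S, U^n, Y^n, V^n)`. -/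
def Code.full (pU : 𝒰 → ℝ) (pYX : 𝒳 → 𝒴 → ℝ) (ω : K.Sample) : ℝ :=
  K.base pU (ω.1, ω.2.1, ω.2.2.1) *
    prodLaw (fun i => pYX (K.input ω.1 ω.2.1 ω.2.2.1 i)) ω.2.2.2.1 * K.g (ω.2.2.2.1, ω.1) ω.2.2.2.2

variable {K} {pU : 𝒰 → ℝ} {pYX : 𝒳 → 𝒴 → ℝ}

theorem Code.base_mem (hU : pU ∈ stdSimplex ℝ 𝒰) (hM : 0 < M) :
    K.base pU ∈ stdSimplex ℝ (Fin M × Fin K.numS × (Fin n → 𝒰)) := by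
  refine ⟨fun d => mul_nonneg (mul_nonneg (by positivity) (K.pS_mem.1 _)) ((iid_mem hU).1 _), ?_⟩
  have hM' : (M : ℝ) ≠ 0 := by exact_mod_cast hM.ne'
  simp only [Fintype.sum_prod_type, Code.base, ← Finset.mul_sum, (iid_mem hU).2, mul_one, K.pS_mem.2]
  simp [hM']

/-- The law of `(C, S, U^n, Y^n)`. -/
theorem Code.marg_full_pre :
    marg (K.full pU pYX) (fun ω => ((ω.1, ω.2.1, ω.2.2.1), ω.2.2.2.1))
      = fun z => K.base pU z.1 * prodLaw (fun i => pYX (K.input z.1.1 z.1.2.1 z.1.2.2 i)) z.2 := by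
  classical
  funext ⟨⟨c, s, u⟩, y⟩
  simp only [marg, Fintype.sum_prod_type, Prod.mk.injEq]
  rw [Finset.sum_eq_single c, Finset.sum_eq_single s, Finset.sum_eq_single u,
    Finset.sum_eq_single y]
  · simp [Code.full, ← Finset.mul_sum, (K.g_kernel _).2]
  all_goals simp +contextual

theorem Code.marg_full_base (hYX : IsKernel pYX) :
    marg (K.full pU pYX) (fun ω => (ω.1, ω.2.1, ω.2.2.1)) = K.base pU := by
  have := marg_marg (K.full pU pYX) (fun ω => ((ω.1, ω.2.1, ω.2.2.1), ω.2.2.2.1)) Prod.fst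
  simp only at this
  rw [← this, Code.marg_full_pre]
  funext d
  rw [marg_fst]
  simp only
  rw [← Finset.mul_sum, (prodLaw_mem fun i => hYX _).2, mul_one]

theorem Code.full_mem (hU : pU ∈ stdSimplex ℝ 𝒰) (hYX : IsKernel pYX) (hM : 0 < M) :
    K.full pU pYX ∈ stdSimplex ℝ K.Sample := by
  refine ⟨fun ω => mul_nonneg (mul_nonneg ((Code.base_mem hU hM).1 _)
    ((prodLaw_mem fun i => hYX _).1 _)) ((K.g_kernel _).1 _), ?_⟩
  rw [← sum_marg _ (fun ω : K.Sample => (ω.1, ω.2.1, ω.2.2.1)), Code.marg_full_base hYX,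
    (Code.base_mem hU hM).2]

theorem Code.law_eq :
    K.law pU pYX = marg (K.full pU pYX)
      (fun ω => (ω.2.2.1, K.input ω.1 ω.2.1 ω.2.2.1, ω.2.2.2.1, ω.2.2.2.2)) := by
  classical
  funext ⟨u, x, y, v⟩
  simp only [marg, Fintype.sum_prod_type, Prod.mk.injEq, Code.law]
  refine Finset.sum_congr rfl fun c _ => Finset.sum_congr rfl fun s _ => ?_
  rw [Finset.sum_eq_single u, Finset.sum_eq_single y, Finset.sum_eq_single v]
  · by_cases h : ∀ i, x i = K.f i (past u i) c s
    · have h' : K.input c s u = x := funext fun i => (h i).symm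
      have h'' : ∀ i, K.input c s u i = x i := fun i => (h i).symm
      simp [h, h', h'', Code.full, Code.base, prodLaw, iid]
    · have h' : K.input c s u ≠ x := fun h' => h fun i => by rw [← h']; rfl
      simp [h, h']
  all_goals simp +contextual

theorem Code.lawOn_eq (A : Finset (Fin n)) :
    K.lawOn pU pYX A = marg (K.full pU pYX)
      (fun ω (t : A) => (ω.2.2.1 t, K.input ω.1 ω.2.1 ω.2.2.1 t, ω.2.2.2.1 t, ω.2.2.2.2 t)) := by
  rw [Code.lawOn, Code.law_eq, marg_marg]

/-! ### Single-letter quantities of a code -/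

/-- `(Uₜ, Xₜ, Yₜ, Vₜ)`. -/
def Code.letter (t : Fin n) (ω : K.Sample) : 𝒰 × 𝒳 × 𝒴 × 𝒱 :=
  (ω.2.2.1 t, K.input ω.1 ω.2.1 ω.2.2.1 t, ω.2.2.2.1 t, ω.2.2.2.2 t)

/-- The auxiliary variable of the converse at time `t`: the common randomness and the channel
outputs at all other times (the output at time `t` is overwritten by a fixed symbol). -/
def Code.aux (y₀ : 𝒴) (t : Fin n) (ω : K.Sample) : Fin M × (Fin n → 𝒴) :=
  (ω.1, Function.update ω.2.2.2.1 t y₀)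

theorem past_update {α : Type*} (u : Fin n → α) (t : Fin n) (b : α) :
    past (Function.update u t b) t = past u t := by
  funext j
  have : (⟨j.val, j.isLt.trans t.isLt⟩ : Fin n) ≠ t := by
    intro h
    have := congrArg Fin.val h
    have := j.isLt
    simp at *
    omega
  simp [past, this]

/-- Strict causality makes `Xₜ` independent of `Uₜ`. -/
theorem Code.marg_letter_UX (hU : pU ∈ stdSimplex ℝ 𝒰) (hYX : IsKernel pYX) (t : Fin n)
    (u : 𝒰) (x : 𝒳) :
    marg (K.full pU pYX) (fun ω => (ω.2.2.1 t, K.input ω.1 ω.2.1 ω.2.2.1 t)) (u, x)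
      = pU u * marg (K.full pU pYX) (fun ω => K.input ω.1 ω.2.1 ω.2.2.1 t) x := by
  classical
  have e1 : marg (K.full pU pYX) (fun ω => (ω.2.2.1 t, K.input ω.1 ω.2.1 ω.2.2.1 t))
      = marg (K.base pU) (fun d => (d.2.2 t, K.input d.1 d.2.1 d.2.2 t)) := by
    rw [← Code.marg_full_base (K := K) (pU := pU) hYX, marg_marg]
  have e2 : marg (K.full pU pYX) (fun ω => K.input ω.1 ω.2.1 ω.2.2.1 t)
      = marg (K.base pU) (fun d => K.input d.1 d.2.1 d.2.2 t) := by
    rw [← Code.marg_full_base (K := K) (pU := pU) hYX, marg_marg]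
  rw [e1, e2]
  simp only [marg, Fintype.sum_prod_type, Prod.mk.injEq, Finset.mul_sum (a := pU u)]
  refine Finset.sum_congr rfl fun c _ => Finset.sum_congr rfl fun s _ => ?_
  have h := sum_iid_mul_indep hU t (fun a => if a = u then 1 else 0)
    (fun w => if K.input c s w t = x then (1 / (M : ℝ) * K.pS s) else 0)
    (fun w b => by simp only [Code.input, past_update]; congr)
  simp only [mul_ite, mul_one, mul_zero, Finset.sum_ite_eq', Finset.mem_univ, if_true] at h
  rw [← Finset.mul_sum, Finset.sum_congr rfl (fun w _ => show
    (if K.input c s w t = x then K.base pU (c, s, w) else 0)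
      = (if K.input c s w t = x then iid pU w * (1 / (M : ℝ) * K.pS s) else 0) by
      simp only [Code.base]; split_ifs <;> ring), ← h]
  refine Finset.sum_congr rfl fun w _ => ?_
  by_cases h1 : w t = u <;> by_cases h2 : K.input c s w t = x <;> simp [h1, h2, Code.base]
  ring

theorem Code.marg_letter_U (hU : pU ∈ stdSimplex ℝ 𝒰) (hYX : IsKernel pYX) (hM : 0 < M)
    (t : Fin n) : marg (K.full pU pYX) (fun ω => ω.2.2.1 t) = pU := by
  funext u
  rw [← sum_marg_pair _ _ (fun ω => K.input ω.1 ω.2.1 ω.2.2.1 t)]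
  simp only [Code.marg_letter_UX hU hYX, ← Finset.mul_sum]
  rw [(marg_mem (Code.full_mem hU hYX hM) _).2, mul_one]

open Classical in
/-- The law of the auxiliary variable together with `(Uₜ, Xₜ, Yₜ, Vₜ)` has the Markov structure
required of an auxiliary variable. -/
theorem Code.exists_fibres (hU : pU ∈ stdSimplex ℝ 𝒰) (hYX : IsKernel pYX) (y₀ : 𝒴) (t : Fin n) :
    ∃ q : Fin M × (Fin n → 𝒴) → 𝒰 × 𝒳 → ℝ, ∃ κ : Fin M × (Fin n → 𝒴) → 𝒴 → 𝒱 → ℝ,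
      (∀ w a, 0 ≤ q w a) ∧ (∀ w, IsKernel (κ w)) ∧
      ∀ a, marg (K.full pU pYX) (fun ω => (Code.aux y₀ t ω, Code.letter t ω)) a
        = fibreLaw pYX (q a.1) (κ a.1) a.2 := by
  refine ⟨fun w a => ∑ s, ∑ u : Fin n → 𝒰, if w.2 t = y₀ ∧ u t = a.1 ∧ K.input w.1 s u t = a.2 then
      K.base pU (w.1, s, u) * ∏ i : {i // i ≠ t}, pYX (K.input w.1 s u i) (w.2 i) else 0,
    fun w y => marg (K.g (Function.update w.2 t y, w.1)) (fun v => v t), ?_, ?_, ?_⟩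
  · intro w a
    refine Finset.sum_nonneg fun s _ => Finset.sum_nonneg fun u _ => ?_
    split_ifs
    · exact mul_nonneg (mul_nonneg (mul_nonneg (by positivity) (K.pS_mem.1 _)) ((iid_mem hU).1 _))
        (Finset.prod_nonneg fun i _ => (hYX _).1 _)
    · exact le_rfl
  · exact fun w y => marg_mem (K.g_kernel _) _
  · rintro ⟨⟨c, w⟩, u₁, x₁, y₁, v₁⟩
    simp only [marg, Fintype.sum_prod_type, fibreLaw, Code.aux, Code.letter, Prod.mk.injEq]
    rw [Finset.sum_eq_single c]
    rotate_left
    · intro c' _ hc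
      simp [hc]
    · simp
    simp only [Finset.sum_mul]
    refine Finset.sum_congr rfl fun s _ => Finset.sum_congr rfl fun u _ => ?_
    rw [Finset.sum_eq_single (Function.update w t y₁)]
    · simp only [Function.update_idem, Function.update_self, true_and]
      by_cases h1 : w t = y₀
      · by_cases h2 : u t = u₁
        · by_cases h3 : K.input c s u t = x₁
          · have hw : Function.update w t y₀ = w := by rw [← h1]; simp
            simp only [h1, h2, h3, hw, true_and, and_true, if_true, Finset.mul_sum]
            refine Finset.sum_congr rfl fun v _ => ?_
            by_cases h4 : v t = v₁
            · simp only [h4, if_true, Code.full, prodLaw]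
              rw [Fintype.prod_eq_mul_prod_subtype_ne _ t]
              simp only [Function.update_self, h3]
              have : ∀ i : {i // i ≠ t}, Function.update w t y₁ i = w i := fun i => by simp [i.2]
              simp only [this]
              ring
            · simp [h4]
          · simp [h3]
        · simp [h2]
      · have hw : Function.update w t y₀ ≠ w := by
          intro h
          apply h1
          rw [← h]; simp
        simp [h1, hw]
    · intro y _ hy
      refine Finset.sum_eq_zero fun v _ => if_neg ?_
      rintro ⟨⟨-, h⟩, -, -, h', -⟩
      apply hy
      rw [← h, ← h']
      simp
    · simp

end

section

variable {𝒰 𝒳 𝒴 𝒱 : Type*} [Fintype 𝒰] [Fintype 𝒳] [Fintype 𝒴] [Fintype 𝒱]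
variable {n M : ℕ} {K : Code 𝒰 𝒳 𝒴 𝒱 n M} {pU : 𝒰 → ℝ} {pYX : 𝒳 → 𝒴 → ℝ}

/-! ### The converse -/

/-- `(P_{UₜXₜYₜVₜ}, H(Uₜ|Xₜ,Wₜ), H(Uₜ,Xₜ,Vₜ|Yₜ,Wₜ))` for the auxiliary variable `Wₜ`. -/
def Code.point (K : Code 𝒰 𝒳 𝒴 𝒱 n M) (pU : 𝒰 → ℝ) (pYX : 𝒳 → 𝒴 → ℝ) (y₀ : 𝒴) (t : Fin n) :
    (𝒰 × 𝒳 × 𝒴 × 𝒱 → ℝ) × ℝ × ℝ :=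
  (marg (K.full pU pYX) (Code.letter t),
    ent (K.full pU pYX) (fun ω => (ω.2.2.1 t, (Code.aux y₀ t ω, K.input ω.1 ω.2.1 ω.2.2.1 t)))
      - ent (K.full pU pYX) (fun ω => (Code.aux y₀ t ω, K.input ω.1 ω.2.1 ω.2.2.1 t)),
    ent (K.full pU pYX) (fun ω => (Code.letter t ω, (ω.1, ω.2.2.2.1)))
      - ent (K.full pU pYX) (fun ω => (ω.1, ω.2.2.2.1)))

theorem Code.point_mem (hU : pU ∈ stdSimplex ℝ 𝒰) (hYX : IsKernel pYX) (hM : 0 < M) (y₀ : 𝒴)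
    (t : Fin n) : K.point pU pYX y₀ t ∈ fibreHull 𝒰 𝒱 pYX := by
  obtain ⟨q, κ, hq, hκ, hQ⟩ := Code.exists_fibres (K := K) hU hYX y₀ t
  have hp := Code.full_mem (K := K) hU hYX hM
  have hq1 : ∑ w, ∑ a, q w a = 1 := by
    have h := (marg_mem hp (fun ω => (Code.aux y₀ t ω, Code.letter t ω))).2
    rw [Fintype.sum_prod_type] at h
    rw [← h]
    refine Finset.sum_congr rfl fun w _ => ?_
    simp only [hQ]
    simp only [Fintype.sum_prod_type, sum_fibreLaw hYX (hκ _)]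
  have h := mem_fibreHull_of_joint hYX hq hq1 hκ hQ
  simp only [ent_marg, marg_marg] at h
  convert! h using 1
  refine Prod.ext rfl (Prod.ext ?_ ?_)
  · simp only [Code.point]
    congr 1
    exact ent_congr hp.1 fun ω ω' => by
      simp only [Code.letter, Prod.mk.injEq]; tauto
  · simp only [Code.point]
    have key : ∀ ω ω' : K.Sample, (ω.1, ω.2.2.2.1) = (ω'.1, ω'.2.2.2.1) ↔
        Code.aux y₀ t ω = Code.aux y₀ t ω' ∧ ω.2.2.2.1 t = ω'.2.2.2.1 t := by
      intro ω ω'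
      simp only [Code.aux, Prod.mk.injEq]
      constructor
      · rintro ⟨h1, h2⟩
        simp [h1, h2]
      · rintro ⟨⟨h1, h2⟩, h3⟩
        refine ⟨h1, ?_⟩
        have := congrArg (fun f => Function.update f t (ω.2.2.2.1 t)) h2
        simp only [Function.update_idem, Function.update_eq_self] at this
        rw [this, h3]
        simp
    congr 1
    · exact ent_congr hp.1 fun ω ω' => by
        rw [Prod.mk.injEq, key]
        simp only [Code.letter, Prod.mk.injEq]; tauto
    · exact ent_congr hp.1 fun ω ω' => by
        rw [key]
        simp only [Code.letter, Prod.mk.injEq]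

theorem Code.point_factor (hU : pU ∈ stdSimplex ℝ 𝒰) (hYX : IsKernel pYX) (y₀ : 𝒴)
    (t : Fin n) (u : 𝒰) (x : 𝒳) :
    marg (K.point pU pYX y₀ t).1 (fun z => (z.1, z.2.1)) (u, x)
      = pU u * marg (K.point pU pYX y₀ t).1 (fun z => z.2.1) x := by
  simp only [Code.point, marg_marg, Code.letter]
  exact Code.marg_letter_UX hU hYX t u x

theorem Code.point_le (hU : pU ∈ stdSimplex ℝ 𝒰) (hYX : IsKernel pYX) (hM : 0 < M) (y₀ : 𝒴)
    (t : Fin n) : (K.point pU pYX y₀ t).2.1 ≤ shannon pU := by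
  have hp := Code.full_mem (K := K) hU hYX hM
  have h := ent_pair_le hp (fun ω => ω.2.2.1 t)
    (fun ω => (Code.aux y₀ t ω, K.input ω.1 ω.2.1 ω.2.2.1 t))
  have e : ent (K.full pU pYX) (fun ω => ω.2.2.1 t) = shannon pU := by
    rw [ent, Code.marg_letter_U hU hYX hM t]
  simp only [Code.point]
  linarith

theorem ent_pi_le {Ω ι α : Type*} [Fintype Ω] [Fintype ι] [DecidableEq ι] [Fintype α]
    {p : Ω → ℝ} (hp : p ∈ stdSimplex ℝ Ω) (A : Ω → ι → α) :
    ent p A ≤ ∑ i, ent p (fun ω => A ω i) := by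
  have h := ent_family_le hp.1 (fun i ω => A ω i) (fun _ => ()) Finset.univ
  simp only [Finset.mem_univ, if_true] at h
  rw [ent_unit hp, ent_congr hp.1 (B := A) (fun ω ω' => by simp [funext_iff])] at h
  simp only [sub_zero] at h
  refine h.trans (Finset.sum_le_sum fun i _ => (ent_congr hp.1 fun ω ω' => by simp).le)

/-- The chain rule for the source sequence: `∑ₜ H(Uₜ|Wₜ,Xₜ) ≥ H(U^n|C,S,Y^n)`, because `(Wₜ, Xₜ)`
is determined by `(C, S, Y^n)` and the past of the source. -/
theorem Code.ent_source_le (hU : pU ∈ stdSimplex ℝ 𝒰) (hYX : IsKernel pYX) (hM : 0 < M) (y₀ : 𝒴) :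
    ent (K.full pU pYX) (fun ω => (ω.2.2.1, (ω.1, ω.2.1, ω.2.2.2.1)))
      - ent (K.full pU pYX) (fun ω => (ω.1, ω.2.1, ω.2.2.2.1))
      ≤ ∑ t, (K.point pU pYX y₀ t).2.1 := by
  have hp := Code.full_mem (K := K) hU hYX hM
  let D : K.Sample → Fin M × Fin K.numS × (Fin n → 𝒴) := fun ω => (ω.1, ω.2.1, ω.2.2.2.1)
  let V : ℕ → K.Sample → Fin n → Option 𝒰 := fun k ω i => if i.val < k then some (ω.2.2.1 i) else none
  have main : ∀ k ≤ n, ent (K.full pU pYX) (fun ω => (V k ω, D ω)) - ent (K.full pU pYX) D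
      ≤ ∑ t with t.val < k, (K.point pU pYX y₀ t).2.1 := by
    intro k
    induction k with
    | zero =>
      intro _
      rw [ent_congr hp.1 (B := D) (fun ω ω' => by simp [V])]
      simp
    | succ k ih =>
      intro hk
      have ih := ih (by omega)
      let t : Fin n := ⟨k, hk⟩
      have hset : Finset.univ.filter (fun i : Fin n => i.val < k + 1)
          = insert t (Finset.univ.filter fun i : Fin n => i.val < k) := by
        ext i
        simp only [Finset.mem_filter, Finset.mem_univ, true_and, Finset.mem_insert, t, Fin.ext_iff]
        omega
      rw [hset, Finset.sum_insert (by simp [t])]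
      have h1 := ent_cond_anti hp.1 (fun ω => ω.2.2.1 t)
        (D := fun ω => (Code.aux y₀ t ω, K.input ω.1 ω.2.1 ω.2.2.1 t))
        (D' := fun ω => (V k ω, D ω)) (by
          intro ω ω' h
          simp only [V, D, Prod.mk.injEq, funext_iff] at h
          obtain ⟨hV, hc, hs, hy⟩ := h
          have hy' : ω.2.2.2.1 = ω'.2.2.2.1 := funext hy
          have hpast : past ω.2.2.1 t = past ω'.2.2.1 t := by
            funext j
            have := hV ⟨j.val, j.isLt.trans t.isLt⟩
            have hj : j.val < k := j.isLt
            simp only [hj, if_true, Option.some.injEq] at this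
            exact this
          simp only [Code.aux, Code.input, hc, hs, hy', hpast])
      have h2 : ent (K.full pU pYX) (fun ω => (ω.2.2.1 t, V k ω, D ω))
          = ent (K.full pU pYX) (fun ω => (V (k + 1) ω, D ω)) := by
        refine ent_congr hp.1 fun ω ω' => ?_
        simp only [Prod.mk.injEq, funext_iff, V]
        constructor
        · rintro ⟨h1, h2, h3⟩
          refine ⟨fun i => ?_, h3⟩
          by_cases hi : i = t
          · subst hi; simp [t]; exact h1
          · have hi' : i.val ≠ k := fun h => hi (Fin.ext h)
            have := h2 i
            by_cases hik : i.val < k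
            · simpa [hik, Nat.lt_succ_of_lt hik] using this
            · simp [show ¬ i.val < k + 1 by omega]
        · rintro ⟨h1, h2⟩
          refine ⟨by simpa [t] using h1 t, fun i => ?_, h2⟩
          by_cases hik : i.val < k
          · simpa [hik, Nat.lt_succ_of_lt hik] using h1 i
          · simp [hik]
      rw [h2] at h1
      have h3 : (K.point pU pYX y₀ t).2.1 = ent (K.full pU pYX) (fun ω =>
          (ω.2.2.1 t, (Code.aux y₀ t ω, K.input ω.1 ω.2.1 ω.2.2.1 t)))
        - ent (K.full pU pYX) (fun ω => (Code.aux y₀ t ω, K.input ω.1 ω.2.1 ω.2.2.1 t)) := rfl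
      linarith
  have h := main n le_rfl
  rw [ent_congr hp.1 (A := fun ω => (V n ω, D ω)) (B := fun ω => (ω.2.2.1, D ω))
    (fun ω ω' => by simp [V, funext_iff])] at h
  simpa using h

/-- The entropy of `(U^n, C, S, Y^n)`: the source and the channel are memoryless. -/
theorem Code.ent_sourceOutput (hU : pU ∈ stdSimplex ℝ 𝒰) (hYX : IsKernel pYX) (hM : 0 < M) :
    ent (K.full pU pYX) (fun ω => (ω.2.2.1, (ω.1, ω.2.1, ω.2.2.2.1)))
      = ent (K.full pU pYX) (fun ω => (ω.1, ω.2.1)) + n * shannon pU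
        + ∑ t, ∑ x, marg (K.full pU pYX) (fun ω => K.input ω.1 ω.2.1 ω.2.2.1 t) x
          * shannon (pYX x) := by
  have hp := Code.full_mem (K := K) hU hYX hM
  rw [ent_congr hp.1 (B := fun ω => ((ω.1, ω.2.1, ω.2.2.1), ω.2.2.2.1)) (fun ω ω' => by
    simp only [Prod.mk.injEq]; tauto)]
  rw [ent, Code.marg_full_pre, shannon_mul_kernel _
    (fun d : Fin M × Fin K.numS × (Fin n → 𝒰) => prodLaw fun i => pYX (K.input d.1 d.2.1 d.2.2 i))
    fun d _ => (prodLaw_mem fun i => hYX _).2]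
  simp only [shannon_prodLaw fun i => hYX _]
  congr 1
  · -- the entropy of the product law of `(C, S)` and the source
    let r : Fin M × Fin K.numS → ℝ := fun a => 1 / (M : ℝ) * K.pS a.2
    have e1 : marg (K.full pU pYX) (fun ω => (ω.1, ω.2.1)) = r := by
      have h := marg_marg (K.full pU pYX) (fun ω => (ω.1, ω.2.1, ω.2.2.1)) (fun d => (d.1, d.2.1))
      simp only at h
      rw [← h, Code.marg_full_base hYX]
      classical
      funext ⟨c, s⟩
      simp only [marg, Fintype.sum_prod_type, Prod.mk.injEq]
      rw [Finset.sum_eq_single c, Finset.sum_eq_single s]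
      · simp [Code.base, ← Finset.mul_sum, (iid_mem hU).2, r]
      all_goals simp +contextual
    have hr : ∑ a, r a = 1 := by
      rw [← e1]; exact (marg_mem hp _).2
    have e2 : shannon (K.base pU) = shannon (fun z : (Fin M × Fin K.numS) × (Fin n → 𝒰) =>
        r z.1 * iid pU z.2) := by
      simp only [shannon]
      exact ((Equiv.prodAssoc _ _ _).sum_comp (fun d => negMulLog (K.base pU d))).symm
    rw [e2, shannon_mul_kernel r (fun _ => iid pU) fun _ _ => (iid_mem hU).2, ← Finset.sum_mul, hr,
      one_mul, shannon_iid hU, Fintype.card_fin, ent, e1]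
  · simp only [Finset.mul_sum]
    rw [Finset.sum_comm]
    refine Finset.sum_congr rfl fun t _ => ?_
    rw [sum_marg_mul _ _ (fun x => shannon (pYX x))]
    exact (marg_comp_apply (Code.marg_full_base (K := K) (pU := pU) hYX)
      (fun d => shannon (pYX (K.input d.1 d.2.1 d.2.2 t)))).symm

/-- The information constraint `I(WX;U) ≤ I(WX;Y)`, summed over all times. -/
theorem Code.sum_sub_point_le (hU : pU ∈ stdSimplex ℝ 𝒰) (hYX : IsKernel pYX) (hM : 0 < M)
    (y₀ : 𝒴) :
    ∑ t, (shannon pU - (K.point pU pYX y₀ t).2.1)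
      ≤ ∑ t, channelInfo pYX (K.point pU pYX y₀ t).1 := by
  have hp := Code.full_mem (K := K) hU hYX hM
  have h1 := Code.ent_source_le (K := K) hU hYX hM y₀
  rw [Code.ent_sourceOutput hU hYX hM] at h1
  have h2 := ent_pair_le hp (fun ω => (ω.1, ω.2.1)) (fun ω => ω.2.2.2.1)
  rw [ent_congr hp.1 (A := fun ω => ((ω.1, ω.2.1), ω.2.2.2.1))
    (B := fun ω => (ω.1, ω.2.1, ω.2.2.2.1)) (fun ω ω' => by
      simp only [Prod.mk.injEq]; tauto)] at h2
  have h3 := ent_pi_le hp (fun ω => ω.2.2.2.1)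
  simp only [channelInfo, Code.point, ent_marg, marg_marg, Finset.sum_sub_distrib, Code.letter] at h1 ⊢
  simp only [Finset.sum_const, Finset.card_univ, Fintype.card_fin, nsmul_eq_mul]
  linarith

theorem channelInfo_le (hYX : IsKernel pYX) {P : 𝒰 × 𝒳 × 𝒴 × 𝒱 → ℝ}
    (hP : P ∈ stdSimplex ℝ (𝒰 × 𝒳 × 𝒴 × 𝒱)) :
    channelInfo pYX P ≤ Real.log (Fintype.card 𝒴) := by
  have h1 := ent_le_log_card hP (fun z => z.2.2.1)
  have h2 : 0 ≤ ∑ x, marg P (fun z => z.2.1) x * shannon (pYX x) :=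
    Finset.sum_nonneg fun x _ => mul_nonneg (marg_nonneg hP.1 _ _) (shannon_nonneg (hYX x))
  rw [channelInfo]
  linarith

/-- The information constraint summed over `A`: each time outside `A` contributes at most `log |𝒴|`. -/
theorem Code.sum_sub_point_on_le (hU : pU ∈ stdSimplex ℝ 𝒰) (hYX : IsKernel pYX) (hM : 0 < M)
    (y₀ : 𝒴) (A : Finset (Fin n)) :
    ∑ t ∈ A, (shannon pU - (K.point pU pYX y₀ t).2.1)
      ≤ ∑ t ∈ A, channelInfo pYX (K.point pU pYX y₀ t).1
        + (n - A.card) * Real.log (Fintype.card 𝒴) := by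
  have hp := Code.full_mem (K := K) hU hYX hM
  have h1 := Code.sum_sub_point_le (K := K) hU hYX hM y₀
  have h2 : ∑ t ∈ A, (shannon pU - (K.point pU pYX y₀ t).2.1)
      ≤ ∑ t, (shannon pU - (K.point pU pYX y₀ t).2.1) :=
    Finset.sum_le_univ_sum_of_nonneg fun t => sub_nonneg.2 (Code.point_le hU hYX hM y₀ t)
  have h3 : ∑ t ∈ Aᶜ, channelInfo pYX (K.point pU pYX y₀ t).1
      ≤ (Aᶜ.card : ℝ) * Real.log (Fintype.card 𝒴) := by
    rw [← nsmul_eq_mul]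
    exact Finset.sum_le_card_nsmul _ _ _ fun t _ => channelInfo_le hYX (marg_mem hp _)
  rw [Finset.card_compl, Fintype.card_fin, Nat.cast_sub (by simpa using A.card_le_univ)] at h3
  rw [← Finset.sum_add_sum_compl A (fun t => channelInfo pYX (K.point pU pYX y₀ t).1)] at h1
  linarith

/-- The rate of common randomness bounds the information that `C` carries beyond `Y^n`. -/
theorem Code.shannon_lawOn_le (hU : pU ∈ stdSimplex ℝ 𝒰) (hYX : IsKernel pYX) (hM : 0 < M)
    (y₀ : 𝒴) (A : Finset (Fin n)) :
    shannon (K.lawOn pU pYX A) ≤ ∑ t ∈ A, (K.point pU pYX y₀ t).2.2 + Real.log M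
      + ∑ t ∈ A, ent (K.point pU pYX y₀ t).1 (fun z => z.2.2.1)
      + (n - A.card) * Real.log (Fintype.card 𝒴) := by
  have hp := Code.full_mem (K := K) hU hYX hM
  have h1 := ent_family_le hp.1 Code.letter (fun ω => (ω.1, ω.2.2.2.1)) A
  have h2 : shannon (K.lawOn pU pYX A) ≤ ent (K.full pU pYX)
      (fun ω => (fun i => if i ∈ A then some (Code.letter i ω) else none, (ω.1, ω.2.2.2.1))) := by
    rw [Code.lawOn_eq]
    refine ent_mono hp.1 fun ω ω' h => ?_
    simp only [Prod.mk.injEq, funext_iff] at h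
    funext t
    have := h.1 t
    simpa [t.2, Code.letter] using this
  have h3 := ent_pair_le hp (fun ω => ω.1) (fun ω => ω.2.2.2.1)
  have h4 := ent_le_log_card hp (fun ω => ω.1)
  have h5 := ent_pi_le hp (fun ω => ω.2.2.2.1)
  have h6 : ∑ t ∈ Aᶜ, ent (K.full pU pYX) (fun ω => ω.2.2.2.1 t)
      ≤ (Aᶜ.card : ℝ) * Real.log (Fintype.card 𝒴) := by
    rw [← nsmul_eq_mul]
    exact Finset.sum_le_card_nsmul _ _ _ fun t _ => ent_le_log_card hp _
  rw [Finset.card_compl, Fintype.card_fin, Nat.cast_sub (by simpa using A.card_le_univ)] at h6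
  rw [← Finset.sum_add_sum_compl A] at h5
  rw [Fintype.card_fin] at h4
  simp only [Code.point, ent_marg, Code.letter] at h1 h2 ⊢
  linarith

end

/-! ### The outer bound -/

section

variable {𝒰 𝒳 𝒴 𝒱 : Type*} [Fintype 𝒰] [Fintype 𝒳] [Fintype 𝒴] [Fintype 𝒱]

theorem Code.lawOn_mem {n M : ℕ} {K : Code 𝒰 𝒳 𝒴 𝒱 n M} {pU : 𝒰 → ℝ} {pYX : 𝒳 → 𝒴 → ℝ}
    (hU : pU ∈ stdSimplex ℝ 𝒰) (hYX : IsKernel pYX) (hM : 0 < M) (A : Finset (Fin n)) :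
    K.lawOn pU pYX A ∈ stdSimplex ℝ (A → 𝒰 × 𝒳 × 𝒴 × 𝒱) := by
  rw [Code.lawOn_eq]
  exact marg_mem (Code.full_mem hU hYX hM) _

/-- Averaging the single-letter points of a code over `A` gives a point that satisfies the
conditions of the outer region up to small terms. -/
theorem Code.exists_average {n M : ℕ} (K : Code 𝒰 𝒳 𝒴 𝒱 n M) {pU : 𝒰 → ℝ} {pYX : 𝒳 → 𝒴 → ℝ}
    (hU : pU ∈ stdSimplex ℝ 𝒰) (hYX : IsKernel pYX) (hM : 0 < M) {A : Finset (Fin n)}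
    (hA : 0 < A.card) {P : 𝒰 × 𝒳 × 𝒴 × 𝒱 → ℝ} (hP : P ∈ stdSimplex ℝ (𝒰 × 𝒳 × 𝒴 × 𝒱))
    {δ : ℝ} (hδ : tv (K.lawOn pU pYX A) (iid P) = δ) :
    ∃ a ∈ fibreHull 𝒰 𝒱 pYX,
      (∀ u x, marg a.1 (fun z => (z.1, z.2.1)) (u, x) = pU u * marg a.1 (fun z => z.2.1) x) ∧
      tv a.1 P ≤ δ ∧
      shannon pU - a.2.1 ≤ channelInfo pYX a.1
        + ((n : ℝ) / A.card - 1) * Real.log (Fintype.card 𝒴) ∧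
      shannon a.1 - ent a.1 (fun z => z.2.2.1) - a.2.2 ≤ shannon a.1 - shannon P
        + δ * Real.log (Fintype.card (𝒰 × 𝒳 × 𝒴 × 𝒱)) + (δ + 1) / A.card + Real.log M / A.card
        + ((n : ℝ) / A.card - 1) * Real.log (Fintype.card 𝒴) := by
  have hp := Code.full_mem (K := K) hU hYX hM
  obtain ⟨-, -, y₀, -⟩ := (nonempty_of_mem_stdSimplex hP).some
  have hc : (0 : ℝ) < A.card := by exact_mod_cast hA
  set c : ℝ := (A.card : ℝ) with hcdef
  set pt := K.point pU pYX y₀ with hpt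
  have hl : ∀ t ∈ A, (0 : ℝ) ≤ 1 / c := fun _ _ => by positivity
  have hl1 : ∑ _t ∈ A, 1 / c = 1 := by
    rw [Finset.sum_const, nsmul_eq_mul, ← hcdef]; field_simp
  have hptmem : ∀ t, (pt t).1 ∈ stdSimplex ℝ (𝒰 × 𝒳 × 𝒴 × 𝒱) := fun t => marg_mem hp _
  let a := ∑ t ∈ A, (1 / c) • pt t
  have ha1 : a.1 = fun z => ∑ t ∈ A, 1 / c * (pt t).1 z := by
    funext z
    simp [a, Prod.fst_sum, Finset.sum_apply]
  have ha2 : a.2.1 = 1 / c * ∑ t ∈ A, (pt t).2.1 := by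
    simp [a, Prod.fst_sum, Prod.snd_sum, Finset.mul_sum]
  have ha3 : a.2.2 = 1 / c * ∑ t ∈ A, (pt t).2.2 := by
    simp [a, Prod.snd_sum, Finset.mul_sum]
  have hentY : 1 / c * ∑ t ∈ A, ent (pt t).1 (fun z => z.2.2.1) ≤ ent a.1 (fun z => z.2.2.1) := by
    have := sum_mul_shannon_le A hl hl1 (q := fun t => marg (pt t).1 (fun z => z.2.2.1))
      fun t _ => marg_nonneg (hptmem t).1 _
    rw [Finset.mul_sum, ent, ha1]
    convert! this using 2
    funext y
    rw [marg_sum_mul]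
  refine ⟨a, ?_, ?_, ?_, ?_, ?_⟩
  · exact (convex_convexHull ℝ _).sum_mem hl hl1 fun t _ => Code.point_mem hU hYX hM y₀ t
  · intro u x
    rw [ha1, marg_sum_mul, marg_sum_mul, Finset.mul_sum]
    refine Finset.sum_congr rfl fun t _ => ?_
    rw [hpt, Code.point_factor hU hYX y₀ t]
    ring
  · have h1 : ∀ t ∈ A, tv (pt t).1 P ≤ δ := by
      intro t ht
      classical
      have e1 : (pt t).1 = marg (K.lawOn pU pYX A) (fun z => z ⟨t, ht⟩) := by
        rw [Code.lawOn_eq, marg_marg]; rfl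
      have e2 : P = marg (iid P : (A → 𝒰 × 𝒳 × 𝒴 × 𝒱) → ℝ) (fun z => z ⟨t, ht⟩) := by
        funext b
        have := sum_prodLaw_apply (p := fun _ : A => P) (fun _ => hP) ⟨t, ht⟩
          (fun z => if z = b then 1 else 0)
        simp only [mul_ite, mul_one, mul_zero, Finset.sum_ite_eq', Finset.mem_univ, if_true] at this
        rw [← this, marg]
        refine Finset.sum_congr rfl fun w _ => ?_
        congr
      calc tv (pt t).1 P = tv (marg (K.lawOn pU pYX A) (fun z => z ⟨t, ht⟩))
            (marg (iid P : (A → 𝒰 × 𝒳 × 𝒴 × 𝒱) → ℝ) (fun z => z ⟨t, ht⟩)) := by rw [← e1, ← e2]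
        _ ≤ _ := (tv_marg_le _ _ _).trans hδ.le
    calc tv a.1 P ≤ ∑ z, ∑ t ∈ A, 1 / c * |(pt t).1 z - P z| := by
          refine Finset.sum_le_sum fun z _ => ?_
          have : a.1 z - P z = ∑ t ∈ A, 1 / c * ((pt t).1 z - P z) := by
            simp only [mul_sub, Finset.sum_sub_distrib, ← Finset.sum_mul, hl1, one_mul, ha1]
          rw [this]
          refine (Finset.abs_sum_le_sum_abs _ _).trans (le_of_eq ?_)
          refine Finset.sum_congr rfl fun t ht => ?_
          rw [abs_mul, abs_of_nonneg (hl t ht)]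
      _ = ∑ t ∈ A, 1 / c * tv (pt t).1 P := by
          rw [Finset.sum_comm]
          simp only [tv, Finset.mul_sum]
      _ ≤ ∑ t ∈ A, 1 / c * δ :=
          Finset.sum_le_sum fun t ht => mul_le_mul_of_nonneg_left (h1 t ht) (hl t ht)
      _ = δ := by rw [← Finset.sum_mul, hl1, one_mul]
  · have h1 := Code.sum_sub_point_on_le (K := K) hU hYX hM y₀ A
    rw [← hpt, ← hcdef, Finset.sum_sub_distrib, Finset.sum_const, nsmul_eq_mul, ← hcdef] at h1
    have h2 : 1 / c * ∑ t ∈ A, channelInfo pYX (pt t).1 ≤ channelInfo pYX a.1 := by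
      simp only [channelInfo, Finset.sum_sub_distrib, mul_sub]
      have : 1 / c * ∑ t ∈ A, ∑ x, marg (pt t).1 (fun z => z.2.1) x * shannon (pYX x)
          = ∑ x, marg a.1 (fun z => z.2.1) x * shannon (pYX x) := by
        rw [ha1]
        simp only [marg_sum_mul, Finset.sum_mul, Finset.mul_sum]
        rw [Finset.sum_comm]
        exact Finset.sum_congr rfl fun _ _ => Finset.sum_congr rfl fun _ _ => by ring
      linarith
    have h3 := mul_le_mul_of_nonneg_left h1 (by positivity : 0 ≤ 1 / c)
    rw [ha2]
    have e1 : 1 / c * (c * shannon pU - ∑ t ∈ A, (pt t).2.1)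
        = shannon pU - 1 / c * ∑ t ∈ A, (pt t).2.1 := by field_simp
    have e2 : 1 / c * (∑ t ∈ A, channelInfo pYX (pt t).1 + (n - c) * Real.log (Fintype.card 𝒴))
        = 1 / c * ∑ t ∈ A, channelInfo pYX (pt t).1
          + ((n : ℝ) / c - 1) * Real.log (Fintype.card 𝒴) := by field_simp
    linarith
  · have h1 := Code.shannon_lawOn_le (K := K) hU hYX hM y₀ A
    have h2 := shannon_sub_le (iid_mem hP) (Code.lawOn_mem (K := K) hU hYX hM A)
    rw [tv_comm, hδ, shannon_iid hP, Fintype.card_coe, ← hcdef, Fintype.card_fun,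
      Fintype.card_coe, Nat.cast_pow, Real.log_pow, ← hcdef] at h2
    rw [← hpt, ← hcdef] at h1
    have h3 := mul_le_mul_of_nonneg_left (h2.trans' (sub_le_sub_left h1 _))
      (by positivity : 0 ≤ 1 / c)
    have e1 : 1 / c * (c * shannon P - (∑ t ∈ A, (pt t).2.2 + Real.log M
        + ∑ t ∈ A, ent (pt t).1 (fun z => z.2.2.1) + (n - c) * Real.log (Fintype.card 𝒴)))
        = shannon P - 1 / c * ∑ t ∈ A, (pt t).2.2 - Real.log M / c
          - 1 / c * ∑ t ∈ A, ent (pt t).1 (fun z => z.2.2.1)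
          - ((n : ℝ) / c - 1) * Real.log (Fintype.card 𝒴) := by field_simp; ring
    have e2 : 1 / c * (δ * (c * Real.log (Fintype.card (𝒰 × 𝒳 × 𝒴 × 𝒱))) + δ + 1)
        = δ * Real.log (Fintype.card (𝒰 × 𝒳 × 𝒴 × 𝒱)) + (δ + 1) / c := by field_simp; ring
    rw [ha3]
    linarith

theorem floor_two_rpow_pos {n : ℕ} {R : ℝ} (hR : 0 ≤ R) : 0 < ⌊(2 : ℝ) ^ ((n : ℝ) * R)⌋₊ :=
  Nat.floor_pos.2 (Real.one_le_rpow (by norm_num) (by positivity))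

theorem tendsto_of_tv_tendsto {α : Type*} [Fintype α] {p : ℕ → α → ℝ} {q : α → ℝ}
    (h : Tendsto (fun k => tv (p k) q) atTop (𝓝 0)) : Tendsto p atTop (𝓝 q) := by
  refine tendsto_pi_nhds.2 fun a => ?_
  rw [tendsto_iff_dist_tendsto_zero]
  refine squeeze_zero (fun _ => dist_nonneg) (fun k => ?_) h
  rw [Real.dist_eq]
  exact Finset.single_le_sum (f := fun a => |p k a - q a|) (fun _ _ => abs_nonneg _)
    (Finset.mem_univ a)

/-- A limit of the averaged single-letter points of a sequence of codes, along block lengths at which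
the sets `A_n` exhaust almost all times. -/
theorem exists_isOuterPoint_of_achievable {pU : 𝒰 → ℝ} (hU : pU ∈ stdSimplex ℝ 𝒰)
    {pYX : 𝒳 → 𝒴 → ℝ} (hYX : IsKernel pYX) {P : 𝒰 × 𝒳 × 𝒴 × 𝒱 → ℝ} {R : ℝ}
    (h : Achievable pU pYX P R) : ∃ b, b.1 = P ∧ IsOuterPoint pU pYX R b := by
  obtain ⟨hP, hR, K, hK⟩ := h
  have hstep : ∀ k : ℕ, ∃ n : ℕ, ∃ A : Finset (Fin n),
      (k : ℝ) + 1 ≤ n ∧ (1 - 1 / ((k : ℝ) + 2)) * n < A.card ∧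
      tv ((K n).lawOn pU pYX A) (iid P) ≤ 1 / ((k : ℝ) + 1) := by
    intro k
    obtain ⟨A, hA1, hA2⟩ := hK (1 / ((k : ℝ) + 2)) (by positivity)
    have h3 := hA2.eventually (ge_mem_nhds (by positivity : (0 : ℝ) < 1 / ((k : ℝ) + 1)))
    obtain ⟨n, h1, h2, h3⟩ := (hA1.and (h3.and (eventually_ge_atTop (k + 1)))).exists
    exact ⟨n, A n, by exact_mod_cast h3, h1, h2⟩
  choose n A hn hA htv using hstep
  have hcpos : ∀ k, (0 : ℝ) < (A k).card := by
    intro k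
    refine lt_of_le_of_lt ?_ (hA k)
    have : 1 / ((k : ℝ) + 2) ≤ 1 := by
      rw [div_le_one (by positivity)]
      have : (0 : ℝ) ≤ k := k.cast_nonneg
      linarith
    exact mul_nonneg (by linarith) (Nat.cast_nonneg _)
  have hM : ∀ k, 0 < ⌊(2 : ℝ) ^ ((n k : ℝ) * R)⌋₊ := fun k => floor_two_rpow_pos hR
  choose a ha1 ha2 ha3 ha4 ha5 using fun k => (K (n k)).exists_average hU hYX (hM k)
    (by exact_mod_cast hcpos k : 0 < (A k).card) hP rfl
  have hlog : 0 < Real.log 2 := Real.log_pos (by norm_num)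
  have lim0 : Tendsto (fun k : ℕ => 1 / ((k : ℝ) + 1)) atTop (𝓝 0) :=
    tendsto_one_div_add_atTop_nhds_zero_nat
  have limδ : Tendsto (fun k => tv ((K (n k)).lawOn pU pYX (A k)) (iid P)) atTop (𝓝 0) :=
    squeeze_zero (fun k => tv_nonneg _ _) htv lim0
  have limP : Tendsto (fun k => (a k).1) atTop (𝓝 P) :=
    tendsto_of_tv_tendsto (squeeze_zero (fun k => tv_nonneg _ _) ha3 limδ)
  -- the ratio of the block length to the number of coordinated time slots
  have limρ : Tendsto (fun k => (n k : ℝ) / (A k).card) atTop (𝓝 1) := by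
    have hup : ∀ k, (n k : ℝ) / (A k).card ≤ 1 + 1 / ((k : ℝ) + 1) := by
      intro k
      rw [div_le_iff₀ (hcpos k)]
      have hk : (0 : ℝ) ≤ k := k.cast_nonneg
      have h1 := mul_le_mul_of_nonneg_left (hA k).le (by positivity : 0 ≤ 1 + 1 / ((k : ℝ) + 1))
      have h2 : (1 + 1 / ((k : ℝ) + 1)) * ((1 - 1 / ((k : ℝ) + 2)) * n k) = n k := by
        field_simp; ring
      linarith
    have hlo : ∀ k, 1 ≤ (n k : ℝ) / (A k).card := by
      intro k
      rw [le_div_iff₀ (hcpos k), one_mul]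
      exact_mod_cast (by simpa using (A k).card_le_univ : (A k).card ≤ n k)
    have : Tendsto (fun k : ℕ => 1 + 1 / ((k : ℝ) + 1)) atTop (𝓝 1) := by
      simpa using lim0.const_add 1
    exact tendsto_of_tendsto_of_tendsto_of_le_of_le tendsto_const_nhds this hlo hup
  have limc : Tendsto (fun k => 1 / ((A k).card : ℝ)) atTop (𝓝 0) := by
    have h1 : Tendsto (fun k => (n k : ℝ) / (A k).card * (1 / ((k : ℝ) + 1))) atTop (𝓝 0) := by
      simpa using limρ.mul lim0
    refine squeeze_zero (fun k => by positivity) (fun k => ?_) h1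
    rw [div_mul_div_comm, mul_one, div_le_div_iff₀ (hcpos k) (by have := hcpos k; positivity), one_mul,
      mul_comm (n k : ℝ)]
    exact mul_le_mul_of_nonneg_left (hn k) (hcpos k).le
  let δ : ℕ → ℝ := fun k => tv ((K (n k)).lawOn pU pYX (A k)) (iid P)
  have hlogM : ∀ k, Real.log ⌊(2 : ℝ) ^ ((n k : ℝ) * R)⌋₊ / (A k).card
      ≤ (n k : ℝ) / (A k).card * (R * Real.log 2) := by
    intro k
    rw [div_mul_eq_mul_div]
    refine div_le_div_of_nonneg_right ?_ (hcpos k).le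
    calc Real.log ⌊(2 : ℝ) ^ ((n k : ℝ) * R)⌋₊ ≤ Real.log ((2 : ℝ) ^ ((n k : ℝ) * R)) :=
          Real.log_le_log (by exact_mod_cast hM k) (Nat.floor_le (by positivity))
      _ = _ := by rw [Real.log_rpow (by norm_num)]; ring
  refine exists_isOuterPoint_of_tendsto (a := a)
    (s := fun k => ((n k : ℝ) / (A k).card - 1) * Real.log (Fintype.card 𝒴))
    (R := fun k => (shannon (a k).1 - shannon P
        + δ k * Real.log (Fintype.card (𝒰 × 𝒳 × 𝒴 × 𝒱)) + (δ k + 1) * (1 / (A k).card)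
        + (n k : ℝ) / (A k).card * (R * Real.log 2)
        + ((n k : ℝ) / (A k).card - 1) * Real.log (Fintype.card 𝒴)) / Real.log 2)
    ha1 ha2 ha4 (fun k => ?_) limP ?_ ?_
  · rw [div_mul_cancel₀ _ hlog.ne', mul_one_div]
    have := ha5 k
    have := hlogM k
    simp only [δ]
    linarith
  · simpa using (limρ.sub_const 1).mul_const (Real.log (Fintype.card 𝒴))
  · have h1 : Tendsto (fun k => shannon (a k).1 - shannon P) atTop (𝓝 0) := by
      simpa using ((continuous_shannon.tendsto P).comp limP).sub_const (shannon P)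
    have h2 := limδ.mul_const (Real.log (Fintype.card (𝒰 × 𝒳 × 𝒴 × 𝒱)))
    have h3 := (limδ.add_const 1).mul limc
    have h4 := limρ.mul_const (R * Real.log 2)
    have h5 := (limρ.sub_const 1).mul_const (Real.log (Fintype.card 𝒴))
    have h6 := ((((h1.add h2).add h3).add h4).add h5).div_const (Real.log 2)
    convert! h6 using 2
    field_simp
    ring

theorem region_subset_outerRegion {pU : 𝒰 → ℝ} (hU : pU ∈ stdSimplex ℝ 𝒰)
    {pYX : 𝒳 → 𝒴 → ℝ} (hYX : IsKernel pYX) :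
    (region pU pYX : Set ((𝒰 × 𝒳 × 𝒴 × 𝒱 → ℝ) × ℝ)) ⊆ outerRegion pU pYX := by
  rintro ⟨P, R⟩ hq
  obtain ⟨q, hq, hlim⟩ := mem_closure_iff_seq_limit.1 hq
  choose b hb1 hb2 using fun k => exists_isOuterPoint_of_achievable hU hYX (hq k)
  have h1 : Tendsto (fun k => (b k).1) atTop (𝓝 P) := by
    simp only [hb1]
    exact (continuous_fst.tendsto _).comp hlim
  obtain ⟨c, rfl, hc⟩ := exists_isOuterPoint_of_tendsto (s := fun _ => 0) (R := fun k => (q k).2)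
    (fun k => (hb2 k).1) (fun k => (hb2 k).2.1) (fun k => by simpa using (hb2 k).2.2.1)
    (fun k => (hb2 k).2.2.2) h1 tendsto_const_nhds ((continuous_snd.tendsto _).comp hlim)
  exact mem_outerRegion_of_isOuterPoint hYX hc

end

/-! ### One-shot covering and packing -/

open Classical in
/-- The probability of the event `E`. -/
def prob {Ω : Type*} [Fintype Ω] (p : Ω → ℝ) (E : Ω → Prop) : ℝ := ∑ ω, if E ω then p ω else 0

theorem prob_nonneg {Ω : Type*} [Fintype Ω] {p : Ω → ℝ} (hp : ∀ ω, 0 ≤ p ω) (E : Ω → Prop) :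
    0 ≤ prob p E := by
  classical
  exact Finset.sum_nonneg fun ω _ => by split_ifs <;> simp [hp]

theorem prob_mono {Ω : Type*} [Fintype Ω] {p : Ω → ℝ} (hp : ∀ ω, 0 ≤ p ω) {E F : Ω → Prop}
    (h : ∀ ω, 0 < p ω → E ω → F ω) : prob p E ≤ prob p F := by
  classical
  refine Finset.sum_le_sum fun ω _ => ?_
  rcases (hp ω).eq_or_lt with h0 | h0
  · simp [← h0]
  · by_cases hE : E ω
    · simp [hE, h ω h0 hE]
    · simp only [hE, if_false]
      split_ifs <;> simp [h0.le]

theorem exists_le_of_sum_le {Ω : Type*} [Fintype Ω] {p : Ω → ℝ} (hp : p ∈ stdSimplex ℝ Ω)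
    {F : Ω → ℝ} {e : ℝ} (h : ∑ ω, p ω * F ω ≤ e) : ∃ ω, F ω ≤ e := by
  by_contra! hcon
  have hne : ∃ ω, 0 < p ω := by
    by_contra! h0
    have : ∑ ω, p ω ≤ 0 := Finset.sum_nonpos fun ω _ => h0 ω
    rw [hp.2] at this
    linarith
  obtain ⟨ω₀, h₀⟩ := hne
  have : ∑ ω, p ω * e < ∑ ω, p ω * F ω := by
    refine Finset.sum_lt_sum (fun ω _ => mul_le_mul_of_nonneg_left (hcon ω).le (hp.1 ω))
      ⟨ω₀, Finset.mem_univ _, ?_⟩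
    exact mul_lt_mul_of_pos_left (hcon ω₀) h₀
  rw [← Finset.sum_mul, hp.2, one_mul] at this
  linarith

theorem sum_mul_abs_le_sqrt {Ω : Type*} [Fintype Ω] {p : Ω → ℝ} (hp : p ∈ stdSimplex ℝ Ω)
    (F : Ω → ℝ) : ∑ ω, p ω * |F ω| ≤ √(∑ ω, p ω * F ω ^ 2) := by
  refine Real.le_sqrt_of_sq_le ?_
  have h := Finset.sum_mul_sq_le_sq_mul_sq Finset.univ (fun ω => √(p ω)) (fun ω => √(p ω) * |F ω|)
  have e1 : ∀ ω, √(p ω) * (√(p ω) * |F ω|) = p ω * |F ω| := fun ω => by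
    rw [← mul_assoc, Real.mul_self_sqrt (hp.1 ω)]
  have e2 : ∀ ω, √(p ω) ^ 2 = p ω := fun ω => Real.sq_sqrt (hp.1 ω)
  have e3 : ∀ ω, (√(p ω) * |F ω|) ^ 2 = p ω * F ω ^ 2 := fun ω => by
    rw [mul_pow, e2, sq_abs]
  simp only [e1, e2, e3, hp.2, one_mul] at h
  exact h

/-- Soft covering: the average of the rows `T (w i)` over a random codebook `w` is close to the
output law `q`. The rows are truncated where `T a b > γ q b`; the truncated part contributes the
probability of that event, the rest is controlled by its variance. -/
theorem soft_covering {α β ι : Type*} [Fintype α] [Fintype β] [Fintype ι] [DecidableEq ι]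
    [Nonempty ι] {p : α → ℝ} (hp : p ∈ stdSimplex ℝ α) {T : α → β → ℝ} (hT : ∀ a b, 0 ≤ T a b)
    {q : β → ℝ} (hq : ∀ b, ∑ a, p a * T a b = q b) (hq1 : ∑ b, q b ≤ 1) {γ : ℝ} (hγ : 0 ≤ γ) :
    ∑ w : ι → α, iid p w * tv (fun b => 1 / (Fintype.card ι : ℝ) * ∑ i, T (w i) b) q
      ≤ 2 * prob (fun z : α × β => p z.1 * T z.1 z.2) (fun z => γ * q z.2 < T z.1 z.2)
        + √(γ / Fintype.card ι) := by
  classical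
  set c : ℝ := (Fintype.card ι : ℝ) with hc
  have hcpos : 0 < c := by rw [hc]; exact_mod_cast Fintype.card_pos
  have hiid : iid p ∈ stdSimplex ℝ (ι → α) := iid_mem hp
  have hqn : ∀ b, 0 ≤ q b := fun b => hq b ▸ Finset.sum_nonneg fun a _ => mul_nonneg (hp.1 a) (hT a b)
  let g : α → β → ℝ := fun a b => if γ * q b < T a b then 0 else T a b
  let h : α → β → ℝ := fun a b => if γ * q b < T a b then T a b else 0
  let μ : β → ℝ := fun b => ∑ a, p a * g a b
  have hgh : ∀ a b, T a b = g a b + h a b := fun a b => by simp only [g, h]; split_ifs <;> simp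
  have hg0 : ∀ a b, 0 ≤ g a b := fun a b => by simp only [g]; split_ifs <;> simp [hT]
  have hh0 : ∀ a b, 0 ≤ h a b := fun a b => by simp only [h]; split_ifs <;> simp [hT]
  have hgle : ∀ a b, g a b ≤ γ * q b := by
    intro a b
    simp only [g]
    split_ifs with h1
    · exact mul_nonneg hγ (hqn b)
    · exact not_lt.1 h1
  have hμ : ∀ b, q b - μ b = ∑ a, p a * h a b := by
    intro b
    rw [← hq b]
    simp only [μ, ← Finset.sum_sub_distrib, hgh]
    exact Finset.sum_congr rfl fun a _ => by ring
  have hμq : ∀ b, μ b ≤ q b := by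
    intro b
    have := Finset.sum_nonneg fun a (_ : a ∈ Finset.univ) => mul_nonneg (hp.1 a) (hh0 a b)
    have := hμ b
    linarith
  have hbad : prob (fun z : α × β => p z.1 * T z.1 z.2) (fun z => γ * q z.2 < T z.1 z.2)
      = ∑ b, (q b - μ b) := by
    simp only [hμ, prob, Fintype.sum_prod_type]
    rw [Finset.sum_comm]
    refine Finset.sum_congr rfl fun b _ => Finset.sum_congr rfl fun a _ => ?_
    simp only [h]
    split_ifs <;> simp
  have key : ∀ b, ∑ w : ι → α, iid p w * |1 / c * ∑ i, T (w i) b - q b|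
      ≤ q b * √(γ / c) + 2 * (q b - μ b) := by
    intro b
    have h1 : ∀ w : ι → α, |1 / c * ∑ i, T (w i) b - q b|
        ≤ |1 / c * ∑ i, (g (w i) b - μ b)| + 1 / c * ∑ i, h (w i) b + (q b - μ b) := by
      intro w
      have e : 1 / c * ∑ i, T (w i) b - q b = 1 / c * ∑ i, (g (w i) b - μ b)
          + 1 / c * ∑ i, h (w i) b - (q b - μ b) := by
        simp only [hgh, Finset.sum_add_distrib, Finset.sum_sub_distrib, Finset.sum_const,
          Finset.card_univ, nsmul_eq_mul, ← hc]
        field_simp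
        ring
      rw [e]
      have a1 : 0 ≤ 1 / c * ∑ i, h (w i) b :=
        mul_nonneg (by positivity) (Finset.sum_nonneg fun i _ => hh0 _ _)
      have a2 : 0 ≤ q b - μ b := sub_nonneg.2 (hμq b)
      refine (abs_sub _ _).trans (add_le_add ((abs_add_le _ _).trans ?_) (abs_of_nonneg a2).le)
      rw [abs_of_nonneg a1]
    have h2 : ∑ w : ι → α, iid p w * (1 / c * ∑ i, h (w i) b) = q b - μ b := by
      have : ∀ w : ι → α, iid p w * (1 / c * ∑ i, h (w i) b)
          = 1 / c * ∑ i, iid p w * h (w i) b := fun w => by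
        rw [← Finset.mul_sum]; ring
      rw [Finset.sum_congr rfl fun w _ => this w, ← Finset.mul_sum, Finset.sum_comm]
      have h3 : ∀ i : ι, ∑ w : ι → α, iid p w * h (w i) b = q b - μ b := fun i => by
        rw [iid_eq_prodLaw, sum_prodLaw_apply (fun _ => hp) i (fun a => h a b), hμ]
      simp only [h3, Finset.sum_const, Finset.card_univ, nsmul_eq_mul, ← hc]
      field_simp
    have h3 : ∑ w : ι → α, iid p w * |1 / c * ∑ i, (g (w i) b - μ b)| ≤ q b * √(γ / c) := by
      refine (sum_mul_abs_le_sqrt hiid _).trans ?_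
      have e0 : ∑ a, p a * (g a b - μ b) = 0 := by
        simp only [mul_sub, Finset.sum_sub_distrib, ← Finset.sum_mul, hp.2, one_mul, μ, sub_self]
      have e1 : ∑ w : ι → α, iid p w * (1 / c * ∑ i, (g (w i) b - μ b)) ^ 2
          = 1 / c * ∑ a, p a * (g a b - μ b) ^ 2 := by
        have := sum_iid_mul_sq (ι := ι) hp (fun a => g a b - μ b) e0
        simp only [mul_pow, mul_left_comm (iid p _), ← Finset.mul_sum, this, ← hc]
        field_simp
      have e2 : ∑ a, p a * (g a b - μ b) ^ 2 ≤ γ * q b * q b := by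
        calc ∑ a, p a * (g a b - μ b) ^ 2 = ∑ a, p a * g a b ^ 2 - μ b ^ 2 := by
              have : ∀ a, p a * (g a b - μ b) ^ 2
                  = p a * g a b ^ 2 - 2 * μ b * (p a * g a b) + p a * μ b ^ 2 := fun a => by ring
              simp only [this, Finset.sum_add_distrib, Finset.sum_sub_distrib, ← Finset.sum_mul,
                ← Finset.mul_sum, hp.2]
              simp only [μ]; ring
          _ ≤ ∑ a, p a * g a b ^ 2 := sub_le_self _ (sq_nonneg _)
          _ ≤ ∑ a, γ * q b * (p a * g a b) := Finset.sum_le_sum fun a _ => by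
              have := mul_le_mul_of_nonneg_right (hgle a b) (mul_nonneg (hp.1 a) (hg0 a b))
              linarith [this, sq (g a b)]
          _ = γ * q b * μ b := by rw [← Finset.mul_sum]
          _ ≤ γ * q b * q b := mul_le_mul_of_nonneg_left (hμq b) (mul_nonneg hγ (hqn b))
      rw [e1]
      calc √(1 / c * ∑ a, p a * (g a b - μ b) ^ 2) ≤ √(q b ^ 2 * (γ / c)) := by
            refine Real.sqrt_le_sqrt ?_
            calc _ ≤ 1 / c * (γ * q b * q b) := mul_le_mul_of_nonneg_left e2 (by positivity)
              _ = _ := by ring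
        _ = q b * √(γ / c) := by rw [Real.sqrt_mul (sq_nonneg _), Real.sqrt_sq (hqn b)]
    calc _ ≤ ∑ w : ι → α, iid p w * (|1 / c * ∑ i, (g (w i) b - μ b)| + 1 / c * ∑ i, h (w i) b
            + (q b - μ b)) :=
          Finset.sum_le_sum fun w _ => mul_le_mul_of_nonneg_left (h1 w) (hiid.1 w)
      _ ≤ _ := by
          simp only [mul_add, Finset.sum_add_distrib, h2, ← Finset.sum_mul, hiid.2, one_mul]
          linarith
  calc _ = ∑ b, ∑ w : ι → α, iid p w * |1 / c * ∑ i, T (w i) b - q b| := by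
        simp only [tv, Finset.mul_sum]
        exact Finset.sum_comm
    _ ≤ ∑ b, (q b * √(γ / c) + 2 * (q b - μ b)) := Finset.sum_le_sum fun b _ => key b
    _ ≤ _ := by
        rw [hbad, Finset.sum_add_distrib, ← Finset.sum_mul, ← Finset.mul_sum]
        have := mul_le_mul_of_nonneg_right hq1 (Real.sqrt_nonneg (γ / c))
        linarith

/-- The threshold decoder: an index `m` whose codeword is much more likely than the average. -/
def thresholdDecoder {α β μ κ : Type*} [Nonempty μ] (T : α → β → ℝ) (q : β → ℝ) (γ : ℝ)
    (x : μ × κ → α) (z : β × κ) : μ :=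
  Classical.epsilon fun m => γ * q z.1 < T (x (m, z.2)) z.1

open Classical in
/-- Packing: the average error probability of the threshold decoder for a random codebook; the
decoder knows the second index. -/
theorem threshold_decoding {α β μ κ : Type*} [Fintype α] [Fintype β] [Fintype μ] [DecidableEq μ]
    [Fintype κ] [DecidableEq κ] [Nonempty μ] [Nonempty κ] {p : α → ℝ} (hp : p ∈ stdSimplex ℝ α)
    {T : α → β → ℝ} (hT : IsKernel T) {q : β → ℝ} (hq : ∀ b, ∑ a, p a * T a b = q b)
    {γ : ℝ} (hγ : 0 < γ) :
    ∑ x : μ × κ → α, iid p x * (1 / (Fintype.card (μ × κ) : ℝ) * ∑ a, ∑ b,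
        if thresholdDecoder T q γ x (b, a.2) ≠ a.1 then T (x a) b else 0)
      ≤ prob (fun z : α × β => p z.1 * T z.1 z.2) (fun z => T z.1 z.2 ≤ γ * q z.2)
        + (Fintype.card μ - 1) / γ := by
  have hc : (0 : ℝ) < Fintype.card (μ × κ) := by exact_mod_cast Fintype.card_pos
  have hqn : ∀ b, 0 ≤ q b := fun b =>
    hq b ▸ Finset.sum_nonneg fun a _ => mul_nonneg (hp.1 a) ((hT a).1 b)
  have hq1 : ∑ b, q b = 1 := by
    simp only [← hq]
    rw [Finset.sum_comm]
    simp only [← Finset.mul_sum, (hT _).2, mul_one, hp.2]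
  have hpt : ∀ (x : μ × κ → α) (a : μ × κ) (b : β),
      (if thresholdDecoder T q γ x (b, a.2) ≠ a.1 then T (x a) b else 0)
        ≤ (if T (x a) b ≤ γ * q b then T (x a) b else 0)
          + ∑ m with m ≠ a.1, if γ * q b < T (x (m, a.2)) b then T (x a) b else 0 := by
    intro x a b
    have n1 : 0 ≤ if T (x a) b ≤ γ * q b then T (x a) b else 0 := by
      split_ifs <;> simp [(hT _).1]
    have n2 : ∀ m, 0 ≤ if γ * q b < T (x (m, a.2)) b then T (x a) b else 0 := by
      intro m
      split_ifs <;> simp [(hT _).1]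
    by_cases h : thresholdDecoder T q γ x (b, a.2) = a.1
    · rw [if_neg (not_not.2 h)]
      exact add_nonneg n1 (Finset.sum_nonneg fun m _ => n2 m)
    · rw [if_pos h]
      by_cases h1 : T (x a) b ≤ γ * q b
      · rw [if_pos h1]
        exact le_add_of_nonneg_right (Finset.sum_nonneg fun m _ => n2 m)
      · have hex : ∃ m, γ * q b < T (x (m, a.2)) b := ⟨a.1, not_le.1 h1⟩
        have hspec : γ * q b < T (x (thresholdDecoder T q γ x (b, a.2), a.2)) b :=
          Classical.epsilon_spec (p := fun m => γ * q b < T (x (m, a.2)) b) hex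
        refine le_add_of_nonneg_of_le n1 ?_
        refine le_trans ?_ (Finset.single_le_sum (fun m _ => n2 m)
          (Finset.mem_filter.2 ⟨Finset.mem_univ _, h⟩))
        rw [if_pos hspec]
  have hE1 : ∀ a : μ × κ, ∑ x : μ × κ → α, ∑ b, iid p x *
      (if T (x a) b ≤ γ * q b then T (x a) b else 0)
      = prob (fun z : α × β => p z.1 * T z.1 z.2) (fun z => T z.1 z.2 ≤ γ * q z.2) := by
    intro a
    rw [Finset.sum_comm, prob, Fintype.sum_prod_type_right]
    refine Finset.sum_congr rfl fun b _ => ?_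
    rw [iid_eq_prodLaw, sum_prodLaw_apply (fun _ => hp) a
      (fun y => if T y b ≤ γ * q b then T y b else 0)]
    exact Finset.sum_congr rfl fun y _ => by rw [mul_ite, mul_zero]
  have hE2 : ∀ (a : μ × κ) (m : μ), m ≠ a.1 → ∑ x : μ × κ → α, ∑ b, iid p x *
      (if γ * q b < T (x (m, a.2)) b then T (x a) b else 0) ≤ 1 / γ := by
    intro a m hm
    rw [Finset.sum_comm]
    have hne : a ≠ (m, a.2) := fun h => hm (congrArg Prod.fst h).symm
    have : ∀ b, ∑ x : μ × κ → α, iid p x * (if γ * q b < T (x (m, a.2)) b then T (x a) b else 0)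
        ≤ q b * (1 / γ) := by
      intro b
      rw [iid_eq_prodLaw, sum_prodLaw_pair (fun _ => hp) hne
        (fun y y' => if γ * q b < T y' b then T y b else 0)]
      have e : ∀ y y', p y * p y' * (if γ * q b < T y' b then T y b else 0)
          = (p y * T y b) * (if γ * q b < T y' b then p y' else 0) := fun y y' => by
        split_ifs <;> ring
      simp only [e, ← Finset.mul_sum, ← Finset.sum_mul, hq]
      rcases (hqn b).eq_or_lt with h0 | h0
      · simp [← h0]
      · refine mul_le_mul_of_nonneg_left ?_ h0.le
        have : ∀ y', (if γ * q b < T y' b then p y' else 0) ≤ (p y' * T y' b) / (γ * q b) := by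
          intro y'
          split_ifs with h1
          · rw [le_div_iff₀ (by positivity)]
            exact mul_le_mul_of_nonneg_left h1.le (hp.1 y')
          · exact div_nonneg (mul_nonneg (hp.1 _) ((hT _).1 _)) (by positivity)
        refine (Finset.sum_le_sum fun y' _ => this y').trans ?_
        rw [← Finset.sum_div, hq]
        exact le_of_eq (by field_simp)
    refine (Finset.sum_le_sum fun b _ => this b).trans ?_
    rw [← Finset.sum_mul, hq1, one_mul]
  set bad := prob (fun z : α × β => p z.1 * T z.1 z.2) (fun z => T z.1 z.2 ≤ γ * q z.2) with hbad
  have hcardm : ∀ a : μ × κ, ((Finset.univ.filter fun m => m ≠ a.1).card : ℝ)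
      = Fintype.card μ - 1 := by
    intro a
    rw [Finset.filter_ne' Finset.univ a.1, Finset.card_erase_of_mem (Finset.mem_univ _),
      Finset.card_univ, Nat.cast_sub Fintype.card_pos, Nat.cast_one]
  have hfin : ∀ a : μ × κ, ∑ x : μ × κ → α, iid p x * (∑ b,
      if thresholdDecoder T q γ x (b, a.2) ≠ a.1 then T (x a) b else 0)
      ≤ bad + (Fintype.card μ - 1) / γ := by
    intro a
    calc _ ≤ ∑ x : μ × κ → α, iid p x * ∑ b, ((if T (x a) b ≤ γ * q b then T (x a) b else 0)
          + ∑ m with m ≠ a.1, if γ * q b < T (x (m, a.2)) b then T (x a) b else 0) :=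
          Finset.sum_le_sum fun x _ => mul_le_mul_of_nonneg_left
            (Finset.sum_le_sum fun b _ => hpt x a b) ((iid_mem hp).1 x)
      _ = bad + ∑ m with m ≠ a.1, ∑ x : μ × κ → α, ∑ b, iid p x *
            (if γ * q b < T (x (m, a.2)) b then T (x a) b else 0) := by
          rw [← hE1 a]
          simp only [Finset.mul_sum, mul_add, Finset.sum_add_distrib]
          congr 1
          rw [Finset.sum_comm (s := Finset.univ.filter fun m => m ≠ a.1)]
          exact Finset.sum_congr rfl fun x _ => Finset.sum_comm
      _ ≤ bad + ∑ m with m ≠ a.1, 1 / γ := by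
          refine add_le_add_right (Finset.sum_le_sum fun m hm => hE2 a m (Finset.mem_filter.1 hm).2) _
      _ = _ := by
          rw [Finset.sum_const, nsmul_eq_mul, hcardm]; ring
  calc _ = 1 / (Fintype.card (μ × κ) : ℝ) * ∑ a, ∑ x : μ × κ → α, iid p x * (∑ b,
        if thresholdDecoder T q γ x (b, a.2) ≠ a.1 then T (x a) b else 0) := by
        rw [Finset.sum_comm, Finset.mul_sum]
        refine Finset.sum_congr rfl fun x _ => ?_
        rw [← Finset.mul_sum]
        ring
    _ ≤ 1 / (Fintype.card (μ × κ) : ℝ) * ∑ _a : μ × κ, (bad + (Fintype.card μ - 1) / γ) :=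
        mul_le_mul_of_nonneg_left (Finset.sum_le_sum fun a _ => hfin a) (by positivity)
    _ = _ := by
        rw [Finset.sum_const, Finset.card_univ, nsmul_eq_mul]
        field_simp

/-- The weak law of large numbers. -/
theorem tendsto_prob_iid {α : Type*} [Fintype α] {p : α → ℝ} (hp : p ∈ stdSimplex ℝ α) (f : α → ℝ)
    {c : ℝ} (hc : ∑ a, p a * f a < c) :
    Tendsto (fun N : ℕ => prob (iid p : (Fin N → α) → ℝ) (fun a => N * c ≤ ∑ i, f (a i)))
      atTop (𝓝 0) := by
  classical
  set μ := ∑ a, p a * f a with hμ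
  set V := ∑ a, p a * (f a - μ) ^ 2 with hV
  have hd : 0 < c - μ := sub_pos.2 hc
  have h0 : ∑ a, p a * (f a - μ) = 0 := by
    simp only [mul_sub, Finset.sum_sub_distrib, ← Finset.sum_mul, hp.2, one_mul, ← hμ, sub_self]
  have hbound : ∀ N : ℕ, 0 < N → prob (iid p : (Fin N → α) → ℝ) (fun a => N * c ≤ ∑ i, f (a i))
      ≤ V / (c - μ) ^ 2 * (1 / (N : ℝ)) := by
    intro N hN
    have hN' : (0 : ℝ) < N := by exact_mod_cast hN
    have hi : iid p ∈ stdSimplex ℝ (Fin N → α) := iid_mem hp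
    have hs := sum_iid_mul_sq (ι := Fin N) hp (fun a => f a - μ) h0
    rw [Fintype.card_fin, ← hV] at hs
    calc _ ≤ ∑ a : Fin N → α, iid p a * ((∑ i, (f (a i) - μ)) ^ 2 / (N * (c - μ)) ^ 2) := by
          refine Finset.sum_le_sum fun a _ => ?_
          split_ifs with h
          · refine le_mul_of_one_le_right (hi.1 a) ?_
            rw [one_le_div (by positivity)]
            refine pow_le_pow_left₀ (by positivity) ?_ 2
            rw [Finset.sum_sub_distrib, Finset.sum_const, Finset.card_univ, Fintype.card_fin,
              nsmul_eq_mul]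
            linarith
          · exact mul_nonneg (hi.1 a) (by positivity)
      _ = (∑ a : Fin N → α, iid p a * (∑ i, (f (a i) - μ)) ^ 2) / (N * (c - μ)) ^ 2 := by
          rw [Finset.sum_div]
          exact Finset.sum_congr rfl fun a _ => by ring
      _ = _ := by rw [hs]; field_simp
  have hlim : Tendsto (fun N : ℕ => V / (c - μ) ^ 2 * (1 / (N : ℝ))) atTop (𝓝 0) := by
    simpa using (tendsto_one_div_atTop_nhds_zero_nat (𝕜 := ℝ)).const_mul (V / (c - μ) ^ 2)
  refine tendsto_of_tendsto_of_tendsto_of_le_of_le' tendsto_const_nhds hlim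
    (Eventually.of_forall fun N => prob_nonneg (iid_mem hp).1 _) ?_
  filter_upwards [eventually_gt_atTop 0] with N hN using hbound N hN

/-! ### Typicality of product laws -/

theorem prob_comp_equiv {Ω Ω' : Type*} [Fintype Ω] [Fintype Ω'] (p : Ω → ℝ) (e : Ω' ≃ Ω)
    (E : Ω → Prop) : prob (fun ω => p (e ω)) (fun ω => E (e ω)) = prob p E := by
  classical
  exact e.sum_comp (fun ω => if E ω then p ω else 0)

/-- Families of pairs are pairs of families. -/
def unzip (ι A B : Type*) : (ι → A × B) ≃ (ι → A) × (ι → B) where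
  toFun a := (fun i => (a i).1, fun i => (a i).2)
  invFun z i := (z.1 i, z.2 i)
  left_inv _ := rfl
  right_inv _ := rfl

theorem prob_iid_pair {ι A B : Type*} [Fintype ι] [DecidableEq ι] [Fintype A] [Fintype B]
    (f : A × B → ℝ) (E : (ι → A) × (ι → B) → Prop) :
    prob (fun z : (ι → A) × (ι → B) => ∏ i, f (z.1 i, z.2 i)) E
      = prob (iid f) (fun a => E (unzip ι A B a)) := by
  rw [← prob_comp_equiv _ (unzip ι A B)]
  rfl

theorem sum_iid_mul_prob {ι A B : Type*} [Fintype ι] [DecidableEq ι] [Fintype A] [Fintype B]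
    (f : A → ℝ) (g : A → B → ℝ) (E : (ι → A) → (ι → B) → Prop) :
    ∑ x : ι → A, iid f x * prob (fun b : ι → B => ∏ i, g (x i) (b i)) (E x)
      = prob (iid fun a : A × B => f a.1 * g a.1 a.2)
          (fun a => E (fun i => (a i).1) (fun i => (a i).2)) := by
  classical
  have := prob_iid_pair (fun a : A × B => f a.1 * g a.1 a.2) (fun z : (ι → A) × (ι → B) => E z.1 z.2)
  refine Eq.trans ?_ this
  simp only [prob, Fintype.sum_prod_type, Finset.mul_sum, Finset.prod_mul_distrib, iid]
  refine Finset.sum_congr rfl fun x _ => Finset.sum_congr rfl fun b _ => ?_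
  rw [mul_ite, mul_zero]

/-- The error term of conditional soft covering: the probability that the likelihood ratio of the
rows `h` to their mean `s` exceeds `exp (N c)` vanishes when `c` is larger than the conditional mutual
information. -/
theorem tendsto_covering {A W B : Type*} [Fintype A] [Fintype W] [Fintype B] {f : A → ℝ}
    (hf : f ∈ stdSimplex ℝ A) {g : A → W → ℝ} (hg : IsKernel g) {h : A → W → B → ℝ}
    (hh : ∀ a w b, 0 ≤ h a w b) {s : A → B → ℝ} (hs : ∀ a b, ∑ w, g a w * h a w b = s a b)
    (hs1 : ∀ a, ∑ b, s a b = 1) {c : ℝ}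
    (hc : ∑ a, ∑ w, ∑ b, f a * g a w * h a w b * Real.log (h a w b / s a b) < c) :
    Tendsto (fun N : ℕ => ∑ x : Fin N → A, iid f x *
      prob (fun z : (Fin N → W) × (Fin N → B) =>
          prodLaw (fun i => g (x i)) z.1 * ∏ i, h (x i) (z.1 i) (z.2 i))
        (fun z => Real.exp (N * c) * ∏ i, s (x i) (z.2 i) < ∏ i, h (x i) (z.1 i) (z.2 i)))
      atTop (𝓝 0) := by
  let J : A × W × B → ℝ := fun a => f a.1 * (g a.1 a.2.1 * h a.1 a.2.1 a.2.2)
  let φ : A × W × B → ℝ := fun a => Real.log (h a.1 a.2.1 a.2.2 / s a.1 a.2.2)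
  have hJ0 : ∀ a, 0 ≤ J a := fun a => mul_nonneg (hf.1 _) (mul_nonneg ((hg _).1 _) (hh _ _ _))
  have hJ : J ∈ stdSimplex ℝ (A × W × B) := by
    refine ⟨hJ0, ?_⟩
    simp only [Fintype.sum_prod_type, J, ← Finset.mul_sum]
    have : ∀ a, ∑ w, g a w * ∑ b, h a w b = 1 := by
      intro a
      rw [← hs1 a]
      simp only [← hs, Finset.mul_sum]
      exact Finset.sum_comm
    simp only [this, mul_one, hf.2]
  have hc' : ∑ a, J a * φ a < c := by
    simp only [Fintype.sum_prod_type, J, φ, ← mul_assoc]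
    exact hc
  have lim := tendsto_prob_iid hJ φ hc'
  refine squeeze_zero (fun N => ?_) (fun N => ?_) lim
  · refine Finset.sum_nonneg fun x _ => mul_nonneg ((iid_mem hf).1 _) (prob_nonneg (fun z => ?_) _)
    exact mul_nonneg ((prodLaw_mem fun i => hg _).1 _) (Finset.prod_nonneg fun i _ => hh _ _ _)
  have e1 : ∀ x : Fin N → A, prob (fun z : (Fin N → W) × (Fin N → B) =>
          prodLaw (fun i => g (x i)) z.1 * ∏ i, h (x i) (z.1 i) (z.2 i))
        (fun z => Real.exp (N * c) * ∏ i, s (x i) (z.2 i) < ∏ i, h (x i) (z.1 i) (z.2 i))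
      = prob (fun b : Fin N → W × B => ∏ i, (g (x i) (b i).1 * h (x i) (b i).1 (b i).2))
        (fun b => Real.exp (N * c) * ∏ i, s (x i) (b i).2 < ∏ i, h (x i) (b i).1 (b i).2) := by
    intro x
    rw [← prob_comp_equiv _ (unzip (Fin N) W B)]
    simp only [prodLaw, unzip, Equiv.coe_fn_mk, Finset.prod_mul_distrib]
  simp only [e1]
  rw [sum_iid_mul_prob f (fun a (b : W × B) => g a b.1 * h a b.1 b.2)
    (fun x b => Real.exp (N * c) * ∏ i, s (x i) (b i).2 < ∏ i, h (x i) (b i).1 (b i).2)]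
  refine prob_mono (iid_mem hJ).1 fun a ha hE => ?_
  have hpos : ∀ i, 0 < J (a i) := fun i =>
    (hJ0 _).lt_of_ne fun h0 => ha.ne' (Finset.prod_eq_zero (Finset.mem_univ i) h0.symm)
  have hh' : ∀ i, 0 < h (a i).1 (a i).2.1 (a i).2.2 := fun i =>
    (hh _ _ _).lt_of_ne fun h0 => (hpos i).ne' (by simp only [J, ← h0, mul_zero])
  have hg' : ∀ i, 0 < g (a i).1 (a i).2.1 := fun i =>
    ((hg _).1 _).lt_of_ne fun h0 => (hpos i).ne' (by simp only [J, ← h0, zero_mul, mul_zero])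
  have hs' : ∀ i, 0 < s (a i).1 (a i).2.2 := fun i => by
    rw [← hs]
    exact (mul_pos (hg' i) (hh' i)).trans_le (Finset.single_le_sum
      (f := fun w => g (a i).1 w * h (a i).1 w (a i).2.2)
      (fun w _ => mul_nonneg ((hg _).1 _) (hh _ _ _)) (Finset.mem_univ _))
  have h1 := Real.log_le_log (mul_pos (Real.exp_pos _) (Finset.prod_pos fun i _ => hs' i)) hE.le
  rw [Real.log_mul (Real.exp_pos _).ne' (Finset.prod_pos fun i _ => hs' i).ne', Real.log_exp,
    Real.log_prod fun i _ => (hs' i).ne', Real.log_prod fun i _ => (hh' i).ne'] at h1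
  have h2 : ∑ i, φ (a i) = ∑ i, Real.log (h (a i).1 (a i).2.1 (a i).2.2)
      - ∑ i, Real.log (s (a i).1 (a i).2.2) := by
    rw [← Finset.sum_sub_distrib]
    exact Finset.sum_congr rfl fun i _ => Real.log_div (hh' i).ne' (hs' i).ne'
  rw [h2]
  linarith

/-- The error term of packing: the probability that the likelihood ratio of a channel is below
`exp (N c)` vanishes when `c` is smaller than the mutual information. -/
theorem tendsto_packing {A B : Type*} [Fintype A] [Fintype B] {f : A → ℝ}
    (hf : f ∈ stdSimplex ℝ A) {T : A → B → ℝ} (hT : IsKernel T) {q : B → ℝ}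
    (hq : ∀ b, ∑ a, f a * T a b = q b) {c : ℝ}
    (hc : c < ∑ a, ∑ b, f a * T a b * Real.log (T a b / q b)) :
    Tendsto (fun N : ℕ => prob (fun z : (Fin N → A) × (Fin N → B) =>
          iid f z.1 * prodLaw (fun i => T (z.1 i)) z.2)
        (fun z => prodLaw (fun i => T (z.1 i)) z.2 ≤ Real.exp (N * c) * iid q z.2))
      atTop (𝓝 0) := by
  let J : A × B → ℝ := fun a => f a.1 * T a.1 a.2
  let φ : A × B → ℝ := fun a => -Real.log (T a.1 a.2 / q a.2)
  have hJ0 : ∀ a, 0 ≤ J a := fun a => mul_nonneg (hf.1 _) ((hT _).1 _)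
  have hJ : J ∈ stdSimplex ℝ (A × B) := by
    refine ⟨hJ0, ?_⟩
    simp only [Fintype.sum_prod_type, J, ← Finset.mul_sum, (hT _).2, mul_one, hf.2]
  have hc' : ∑ a, J a * φ a < -c := by
    simp only [Fintype.sum_prod_type, J, φ, mul_neg, Finset.sum_neg_distrib]
    exact neg_lt_neg hc
  have lim := tendsto_prob_iid hJ φ hc'
  refine squeeze_zero (fun N => prob_nonneg (fun z => ?_) _) (fun N => ?_) lim
  · exact mul_nonneg ((iid_mem hf).1 _) ((prodLaw_mem fun i => hT _).1 _)
  have e1 := prob_iid_pair J (fun z : (Fin N → A) × (Fin N → B) =>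
    prodLaw (fun i => T (z.1 i)) z.2 ≤ Real.exp (N * c) * iid q z.2)
  simp only [J, Finset.prod_mul_distrib] at e1
  refine e1.le.trans ?_
  refine prob_mono (iid_mem hJ).1 fun a ha hE => ?_
  have hpos : ∀ i, 0 < J (a i) := fun i =>
    (hJ0 _).lt_of_ne fun h0 => ha.ne' (Finset.prod_eq_zero (Finset.mem_univ i) h0.symm)
  have hT' : ∀ i, 0 < T (a i).1 (a i).2 := fun i =>
    ((hT _).1 _).lt_of_ne fun h0 => (hpos i).ne' (by simp only [J, ← h0, mul_zero])
  have hq' : ∀ i, 0 < q (a i).2 := fun i => by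
    rw [← hq]
    exact (hpos i).trans_le (Finset.single_le_sum (f := fun x => f x * T x (a i).2)
      (fun w _ => mul_nonneg (hf.1 _) ((hT _).1 _)) (Finset.mem_univ _))
  simp only [unzip, Equiv.coe_fn_mk, prodLaw, iid] at hE
  have h1 := Real.log_le_log (Finset.prod_pos fun i _ => hT' i) hE
  rw [Real.log_mul (Real.exp_pos _).ne' (Finset.prod_pos fun i _ => hq' i).ne', Real.log_exp,
    Real.log_prod fun i _ => (hq' i).ne', Real.log_prod fun i _ => (hT' i).ne'] at h1
  have h2 : ∑ i, φ (a i) = ∑ i, Real.log (q (a i).2) - ∑ i, Real.log (T (a i).1 (a i).2) := by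
    rw [← Finset.sum_sub_distrib]
    refine Finset.sum_congr rfl fun i _ => ?_
    simp only [φ]
    rw [Real.log_div (hT' i).ne' (hq' i).ne']
    ring
  rw [h2]
  linarith

/-- The error term of covering a source by random sequences: sequences of probability less than
`exp (-N c)` are unlikely when `c` is larger than the entropy. -/
theorem tendsto_source {A : Type*} [Fintype A] {f : A → ℝ} (hf : f ∈ stdSimplex ℝ A) {c : ℝ}
    (hc : shannon f < c) :
    Tendsto (fun N : ℕ => prob (iid f : (Fin N → A) → ℝ) (fun x => Real.exp (N * c) * iid f x < 1))
      atTop (𝓝 0) := by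
  have hc' : ∑ a, f a * (-Real.log (f a)) < c := by
    simpa [shannon, negMulLog_eq] using hc
  refine squeeze_zero (fun N => prob_nonneg (iid_mem hf).1 _) (fun N => ?_) (tendsto_prob_iid hf _ hc')
  refine prob_mono (iid_mem hf).1 fun a ha hE => ?_
  have hpos : ∀ i, 0 < f (a i) := fun i =>
    (hf.1 _).lt_of_ne fun h0 => ha.ne' (Finset.prod_eq_zero (Finset.mem_univ i) h0.symm)
  have h1 := Real.log_le_log (mul_pos (Real.exp_pos _) ha) hE.le
  rw [Real.log_mul (Real.exp_pos _).ne' ha.ne', Real.log_exp, Real.log_one, iid,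
    Real.log_prod fun i _ => (hpos i).ne'] at h1
  rw [Finset.sum_neg_distrib]
  linarith

/-! ### Block codes -/

/-- A code for one block of super-letters. The input codeword has an index `a = (m, k)`, where the
message `m = (j', ℓ)` reports the satellite index `j'` of another block together with local
randomness `ℓ`, and `k` is common randomness. The satellite codewords have an index `(k', j)`, where
`k'` is common randomness and `j` is drawn from `κ a k' u`, `u` being the source block. The decoder
`dec` recovers `m` from the output and `k`. -/
structure BlockCode (𝒰 𝒳 𝒴 𝒲 J L K K' : Type*) [Fintype J] where
  x : (J × L) × K → 𝒳
  w : (J × L) × K → K' × J → 𝒲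
  κ : (J × L) × K → K' → 𝒰 → J → ℝ
  κ_kernel : ∀ a k', IsKernel (κ a k')
  dec : 𝒴 × K → J × L

section

variable {𝒰 𝒳 𝒴 𝒱 𝒲 J L K K' : Type*} [Fintype 𝒰] [Fintype 𝒳] [Fintype 𝒴] [Fintype 𝒱] [Fintype 𝒲]
  [Fintype J] [Fintype L] [Fintype K] [Fintype K']

/-- The law of the indices `(a, k', j)` of a block given the source block `u`. -/
def BlockCode.index (C : BlockCode 𝒰 𝒳 𝒴 𝒲 J L K K') (u : 𝒰) (τ : ((J × L) × K) × K' × J) : ℝ :=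
  1 / (Fintype.card ((J × L) × K) * Fintype.card K' : ℝ) * C.κ τ.1 τ.2.1 u τ.2.2

/-- The law of the indices, the source block and the output block. -/
def BlockCode.pre (C : BlockCode 𝒰 𝒳 𝒴 𝒲 J L K K') (pU : 𝒰 → ℝ) (pYX : 𝒳 → 𝒴 → ℝ)
    (z : ((((J × L) × K) × K' × J) × 𝒰) × 𝒴) : ℝ :=
  C.index z.1.2 z.1.1 * pU z.1.2 * pYX (C.x z.1.1.1) z.2

/-- The law of a block when `V` is generated from the correct satellite codeword. -/
def BlockCode.law (C : BlockCode 𝒰 𝒳 𝒴 𝒲 J L K K') (pU : 𝒰 → ℝ) (pYX : 𝒳 → 𝒴 → ℝ)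
    (pV : 𝒲 × 𝒴 → 𝒱 → ℝ) (z : (((((J × L) × K) × K' × J) × 𝒰) × 𝒴) × 𝒱) : ℝ :=
  C.pre pU pYX z.1 * pV (C.w z.1.1.1.1 z.1.1.1.2, z.1.2) z.2

/-- The law of `(U, X, Y, V)` in a block. -/
def BlockCode.out (C : BlockCode 𝒰 𝒳 𝒴 𝒲 J L K K') (pU : 𝒰 → ℝ) (pYX : 𝒳 → 𝒴 → ℝ)
    (pV : 𝒲 × 𝒴 → 𝒱 → ℝ) : 𝒰 × 𝒳 × 𝒴 × 𝒱 → ℝ :=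
  marg (C.law pU pYX pV) (fun z => (z.1.1.2, C.x z.1.1.1.1, z.1.2, z.2))

/-- The probability that the message of a block is decoded incorrectly. -/
def BlockCode.err (C : BlockCode 𝒰 𝒳 𝒴 𝒲 J L K K') (pU : 𝒰 → ℝ) (pYX : 𝒳 → 𝒴 → ℝ) : ℝ :=
  prob (C.pre pU pYX) (fun z => C.dec (z.2, z.1.1.1.2) ≠ z.1.1.1.1)

theorem BlockCode.err_nonneg (C : BlockCode 𝒰 𝒳 𝒴 𝒲 J L K K') {pU : 𝒰 → ℝ}
    (hU : pU ∈ stdSimplex ℝ 𝒰) {pYX : 𝒳 → 𝒴 → ℝ} (hYX : IsKernel pYX) : 0 ≤ C.err pU pYX := by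
  refine prob_nonneg (fun z => ?_) _
  have := (C.κ_kernel z.1.1.1 z.1.1.2.1 z.1.2).1 z.1.1.2.2
  have := hU.1 z.1.2
  have := (hYX (C.x z.1.1.1)).1 z.2
  simp only [BlockCode.pre, BlockCode.index]
  positivity

open Classical in
theorem BlockCode.err_eq [Nonempty J] [Nonempty L] [Nonempty K] [Nonempty K']
    (C : BlockCode 𝒰 𝒳 𝒴 𝒲 J L K K') {pU : 𝒰 → ℝ}
    (hU : pU ∈ stdSimplex ℝ 𝒰) (pYX : 𝒳 → 𝒴 → ℝ) :
    C.err pU pYX = 1 / (Fintype.card ((J × L) × K) : ℝ) * ∑ a, ∑ b,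
        if C.dec (b, a.2) ≠ a.1 then pYX (C.x a) b else 0 := by
  have hc : (Fintype.card ((J × L) × K) : ℝ) ≠ 0 := by exact_mod_cast Fintype.card_ne_zero
  have hc' : (Fintype.card K' : ℝ) ≠ 0 := by exact_mod_cast Fintype.card_ne_zero
  have h0 : C.err pU pYX = ∑ a, ∑ τ : K' × J, ∑ u, ∑ y, if C.dec (y, a.2) ≠ a.1 then
      C.pre pU pYX (((a, τ), u), y) else 0 := by
    simp only [BlockCode.err, prob, Fintype.sum_prod_type]
    congr!
  rw [h0, Finset.mul_sum]
  refine Finset.sum_congr rfl fun a _ => ?_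
  have h1 : ∀ (τ : K' × J) (u : 𝒰), (∑ y, if C.dec (y, a.2) ≠ a.1 then
        C.pre pU pYX (((a, τ), u), y) else 0)
      = C.index u (a, τ) * pU u * ∑ y, if C.dec (y, a.2) ≠ a.1 then pYX (C.x a) y else 0 := by
    intro τ u
    rw [Finset.mul_sum]
    refine Finset.sum_congr rfl fun y _ => ?_
    simp only [BlockCode.pre]
    split_ifs <;> simp
  simp only [h1, ← Finset.sum_mul]
  congr 1
  rw [Finset.sum_comm]
  simp only [← Finset.sum_mul]
  have h2 : ∀ u, ∑ τ : K' × J, C.index u (a, τ) = 1 / (Fintype.card ((J × L) × K) : ℝ) := by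
    intro u
    simp only [BlockCode.index, ← Finset.mul_sum, Fintype.sum_prod_type, (C.κ_kernel _ _ _).2]
    rw [Finset.sum_const, Finset.card_univ, nsmul_eq_mul]
    field_simp
  simp only [h2, ← Finset.mul_sum, hU.2, mul_one]

end

/-! ### Single-letter data -/

/-- The factors of a law `P_U P_X P_{W|UX} P_{Y|X} P_{V|WY}` of `(U, X, W, Y, V)`. -/
structure AuxData (𝒰 𝒳 𝒴 𝒱 𝒲 : Type*) [Fintype 𝒰] [Fintype 𝒳] [Fintype 𝒴] [Fintype 𝒱]
    [Fintype 𝒲] where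
  pU : 𝒰 → ℝ
  hU : pU ∈ stdSimplex ℝ 𝒰
  pX : 𝒳 → ℝ
  hX : pX ∈ stdSimplex ℝ 𝒳
  pW : 𝒰 × 𝒳 → 𝒲 → ℝ
  hW : IsKernel pW
  pYX : 𝒳 → 𝒴 → ℝ
  hYX : IsKernel pYX
  pV : 𝒲 × 𝒴 → 𝒱 → ℝ
  hV : IsKernel pV

namespace AuxData

variable {𝒰 𝒳 𝒴 𝒱 𝒲 : Type*} [Fintype 𝒰] [Fintype 𝒳] [Fintype 𝒴] [Fintype 𝒱] [Fintype 𝒲]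
  (D : AuxData 𝒰 𝒳 𝒴 𝒱 𝒲)

/-- `P_{W|X}`. -/
def qW (x : 𝒳) (w : 𝒲) : ℝ := ∑ u, D.pU u * D.pW (u, x) w

/-- `P_{U|XW}` (it vanishes where `P_{W|X}` does). -/
def post (x : 𝒳) (w : 𝒲) (u : 𝒰) : ℝ := D.pU u * (D.pW (u, x) w / D.qW x w)

/-- `P_{UYV|XW}`. -/
def postUYV (x : 𝒳) (w : 𝒲) (b : 𝒰 × 𝒴 × 𝒱) : ℝ :=
  D.post x w b.1 * D.pYX x b.2.1 * D.pV (w, b.2.1) b.2.2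

/-- `P_{V|UXY}`. -/
def condV (u : 𝒰) (x : 𝒳) (y : 𝒴) (v : 𝒱) : ℝ := ∑ w, D.pW (u, x) w * D.pV (w, y) v

/-- `P_{UYV|X}`. -/
def outUYV (x : 𝒳) (b : 𝒰 × 𝒴 × 𝒱) : ℝ := D.pU b.1 * D.pYX x b.2.1 * D.condV b.1 x b.2.1 b.2.2

/-- `P_Y`. -/
def qY (y : 𝒴) : ℝ := ∑ x, D.pX x * D.pYX x y

/-- `P_{UXYV}`. -/
def target (z : 𝒰 × 𝒳 × 𝒴 × 𝒱) : ℝ := D.pX z.2.1 * D.outUYV z.2.1 (z.1, z.2.2)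

theorem qW_kernel : IsKernel D.qW := by
  intro x
  refine ⟨fun w => Finset.sum_nonneg fun u _ => mul_nonneg (D.hU.1 _) ((D.hW _).1 _), ?_⟩
  simp only [qW]
  rw [Finset.sum_comm]
  simp only [← Finset.mul_sum, (D.hW _).2, mul_one, D.hU.2]

theorem post_nonneg (x : 𝒳) (w : 𝒲) (u : 𝒰) : 0 ≤ D.post x w u :=
  mul_nonneg (D.hU.1 _) (div_nonneg ((D.hW _).1 _) ((D.qW_kernel _).1 _))

theorem qW_mul_post (x : 𝒳) (w : 𝒲) (u : 𝒰) : D.qW x w * D.post x w u = D.pU u * D.pW (u, x) w := by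
  by_cases h : D.qW x w = 0
  · rw [h, zero_mul]
    exact ((Finset.sum_eq_zero_iff_of_nonneg fun u _ => mul_nonneg (D.hU.1 u) ((D.hW _).1 w)).1 h u
      (Finset.mem_univ u)).symm
  · rw [post]; field_simp

theorem sum_qW_mul_post (x : 𝒳) (u : 𝒰) : ∑ w, D.qW x w * D.post x w u = D.pU u := by
  simp only [qW_mul_post, ← Finset.mul_sum, (D.hW _).2, mul_one]

theorem postUYV_nonneg (x : 𝒳) (w : 𝒲) (b : 𝒰 × 𝒴 × 𝒱) : 0 ≤ D.postUYV x w b :=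
  mul_nonneg (mul_nonneg (D.post_nonneg _ _ _) ((D.hYX _).1 _)) ((D.hV _).1 _)

theorem sum_qW_mul_postUYV (x : 𝒳) (b : 𝒰 × 𝒴 × 𝒱) :
    ∑ w, D.qW x w * D.postUYV x w b = D.outUYV x b := by
  simp only [postUYV, outUYV, condV, Finset.mul_sum]
  refine Finset.sum_congr rfl fun w _ => ?_
  have := D.qW_mul_post x w b.1
  calc _ = (D.qW x w * D.post x w b.1) * D.pYX x b.2.1 * D.pV (w, b.2.1) b.2.2 := by ring
    _ = _ := by rw [this]; ring

theorem outUYV_kernel : IsKernel D.outUYV := by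
  intro x
  refine ⟨fun b => mul_nonneg (mul_nonneg (D.hU.1 _) ((D.hYX _).1 _))
    (Finset.sum_nonneg fun w _ => mul_nonneg ((D.hW _).1 _) ((D.hV _).1 _)), ?_⟩
  have h : ∀ u y, ∑ v, D.condV u x y v = 1 := by
    intro u y
    simp only [condV]
    rw [Finset.sum_comm]
    simp only [← Finset.mul_sum, (D.hV _).2, mul_one, (D.hW _).2]
  simp only [outUYV, Fintype.sum_prod_type, ← Finset.mul_sum, h, mul_one, (D.hYX _).2, D.hU.2]

theorem target_mem : D.target ∈ stdSimplex ℝ (𝒰 × 𝒳 × 𝒴 × 𝒱) := by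
  refine ⟨fun z => mul_nonneg (D.hX.1 _) ((D.outUYV_kernel _).1 _), ?_⟩
  have h := fun x => (D.outUYV_kernel x).2
  simp only [Fintype.sum_prod_type, target, ← Finset.mul_sum] at h ⊢
  rw [Finset.sum_comm]
  simp only [← Finset.mul_sum, h, mul_one, D.hX.2]

/-- `I(W;U,Y,V|X)`. -/
def rateUYV : ℝ := ∑ x, ∑ w, ∑ b, D.pX x * D.qW x w * D.postUYV x w b *
  Real.log (D.postUYV x w b / D.outUYV x b)

/-- `I(W;U|X)`. -/
def rateU : ℝ := ∑ x, ∑ w, ∑ u, D.pX x * D.qW x w * D.post x w u *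
  Real.log (D.post x w u / D.pU u)

/-- `I(X;Y)`. -/
def rateY : ℝ := ∑ x, ∑ y, D.pX x * D.pYX x y * Real.log (D.pYX x y / D.qY y)

/-- `P_{V|WY}` for blocks. -/
def blockV (N : ℕ) (a : (Fin N → 𝒲) × (Fin N → 𝒴)) : (Fin N → 𝒱) → ℝ :=
  prodLaw fun i => D.pV (a.1 i, a.2 i)

/-- The channel for blocks. -/
def blockYX (N : ℕ) (x : Fin N → 𝒳) : (Fin N → 𝒴) → ℝ := prodLaw fun i => D.pYX (x i)

/-- The i.i.d. target law on blocks, as a law of four sequences. -/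
def blockTarget (N : ℕ) (z : (Fin N → 𝒰) × (Fin N → 𝒳) × (Fin N → 𝒴) × (Fin N → 𝒱)) : ℝ :=
  ∏ i, D.target (z.1 i, z.2.1 i, z.2.2.1 i, z.2.2.2 i)

theorem blockV_kernel (N : ℕ) : IsKernel (D.blockV N) := fun _ => prodLaw_mem fun _ => D.hV _

theorem blockYX_kernel (N : ℕ) : IsKernel (D.blockYX N) := fun _ => prodLaw_mem fun _ => D.hYX _

end AuxData

/-! ### Satellite codebooks -/

section

variable {𝒰 𝒳 𝒴 𝒱 𝒲 : Type*} [Fintype 𝒰] [Fintype 𝒳] [Fintype 𝒴] [Fintype 𝒱] [Fintype 𝒲]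
  (D : AuxData 𝒰 𝒳 𝒴 𝒱 𝒲) {N : ℕ}

namespace AuxData

/-- `P_{U|XW}` for blocks. -/
def blockPost (x : Fin N → 𝒳) (w : Fin N → 𝒲) (u : Fin N → 𝒰) : ℝ := ∏ i, D.post (x i) (w i) (u i)

/-- `P_{UYV|XW}` for blocks. -/
def blockPostUYV (x : Fin N → 𝒳) (w : Fin N → 𝒲) (b : Fin N → 𝒰 × 𝒴 × 𝒱) : ℝ :=
  ∏ i, D.postUYV (x i) (w i) (b i)

/-- The error term of the covering of `(U, Y, V)`, for the input sequence `x`. -/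
def badUYV (c : ℝ) (x : Fin N → 𝒳) : ℝ :=
  prob (fun z : (Fin N → 𝒲) × (Fin N → 𝒰 × 𝒴 × 𝒱) =>
      prodLaw (fun i => D.qW (x i)) z.1 * ∏ i, D.postUYV (x i) (z.1 i) (z.2 i))
    (fun z => Real.exp (N * c) * ∏ i, D.outUYV (x i) (z.2 i) < ∏ i, D.postUYV (x i) (z.1 i) (z.2 i))

/-- The error term of the covering of `U`, for the input sequence `x`. -/
def badU (c : ℝ) (x : Fin N → 𝒳) : ℝ :=
  prob (fun z : (Fin N → 𝒲) × (Fin N → 𝒰) =>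
      prodLaw (fun i => D.qW (x i)) z.1 * ∏ i, D.post (x i) (z.1 i) (z.2 i))
    (fun z => Real.exp (N * c) * ∏ i, D.pU (z.2 i) < ∏ i, D.post (x i) (z.1 i) (z.2 i))

end AuxData

/-- Satellite codebooks: for every input sequence `x` there are codewords `w (k', j)` that cover
`(U, Y, V)` when `(k', j)` is uniform, and that cover `U` for (almost) every `k'` when `j` is
uniform. -/
theorem exists_satellites {J K' : Type*} [Fintype J] [DecidableEq J] [Nonempty J] [Fintype K']
    [DecidableEq K'] [Nonempty K'] (c : ℝ) (x : Fin N → 𝒳) {e₂ : ℝ}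
    (h₂ : ∑ w : J → Fin N → 𝒲, iid (prodLaw fun i => D.qW (x i)) w *
      tv (fun u => 1 / (Fintype.card J : ℝ) * ∑ j, D.blockPost x (w j) u) (iid D.pU) ≤ e₂) :
    ∃ w : K' × J → Fin N → 𝒲,
      tv (fun b => 1 / (Fintype.card (K' × J) : ℝ) * ∑ a, D.blockPostUYV x (w a) b)
          (prodLaw fun i => D.outUYV (x i))
        + 1 / (Fintype.card K' : ℝ) * ∑ k',
          tv (fun u => 1 / (Fintype.card J : ℝ) * ∑ j, D.blockPost x (w (k', j)) u) (iid D.pU)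
      ≤ 2 * D.badUYV c x + √(Real.exp (N * c) / Fintype.card (K' × J)) + e₂ := by
  have hp : prodLaw (fun i => D.qW (x i)) ∈ stdSimplex ℝ (Fin N → 𝒲) :=
    prodLaw_mem fun _ => D.qW_kernel _
  have hcpos : (0 : ℝ) < Fintype.card K' := by exact_mod_cast Fintype.card_pos
  refine exists_le_of_sum_le (iid_mem hp) ?_
  simp only [mul_add, Finset.sum_add_distrib]
  refine add_le_add ?_ ?_
  · refine soft_covering hp (T := D.blockPostUYV x)
      (fun a b => Finset.prod_nonneg fun i _ => D.postUYV_nonneg _ _ _)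
      (q := prodLaw fun i => D.outUYV (x i)) (fun b => ?_) ?_ (Real.exp_pos _).le
    · simp only [prodLaw, AuxData.blockPostUYV, ← Finset.prod_mul_distrib]
      rw [sum_prod_pi (fun i a => D.qW (x i) a * D.postUYV (x i) a (b i))]
      simp only [D.sum_qW_mul_postUYV]
    · exact (prodLaw_mem fun _ => D.outUYV_kernel _).2.le
  · have h3 : ∀ k' : K', ∑ w : K' × J → Fin N → 𝒲, iid (prodLaw fun i => D.qW (x i)) w *
        tv (fun u => 1 / (Fintype.card J : ℝ) * ∑ j, D.blockPost x (w (k', j)) u) (iid D.pU)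
        ≤ e₂ := by
      intro k'
      have he : Function.Injective (fun j : J => (k', j)) := fun a b h => (Prod.mk.inj h).2
      have := sum_prodLaw_comp (p := fun _ : K' × J => prodLaw fun i => D.qW (x i)) (fun _ => hp) he
        (fun w => tv (fun u => 1 / (Fintype.card J : ℝ) * ∑ j, D.blockPost x (w j) u) (iid D.pU))
      rw [iid_eq_prodLaw, this]
      exact h₂
    calc _ = 1 / (Fintype.card K' : ℝ) * ∑ k', ∑ w : K' × J → Fin N → 𝒲,
          iid (prodLaw fun i => D.qW (x i)) w *
          tv (fun u => 1 / (Fintype.card J : ℝ) * ∑ j, D.blockPost x (w (k', j)) u) (iid D.pU) := by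
          rw [Finset.sum_comm, Finset.mul_sum]
          refine Finset.sum_congr rfl fun w _ => ?_
          rw [← Finset.mul_sum]
          ring
      _ ≤ 1 / (Fintype.card K' : ℝ) * ∑ _k' : K', e₂ :=
          mul_le_mul_of_nonneg_left (Finset.sum_le_sum fun k' _ => h3 k') (by positivity)
      _ = e₂ := by
          rw [Finset.sum_const, Finset.card_univ, nsmul_eq_mul]
          field_simp

end

/-! ### The output of a block code -/

section

variable {𝒰 𝒳 𝒴 𝒱 𝒲 J L K K' : Type*} [Fintype 𝒰] [Fintype 𝒳] [Fintype 𝒴] [Fintype 𝒱] [Fintype 𝒲]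
  [Fintype J] [Fintype L] [Fintype K] [Fintype K'] [Nonempty J] [Nonempty L] [Nonempty K]
  [Nonempty K']

open Classical in
/-- A block code whose satellite index has the posterior law given the source block produces the
target up to the resolvability errors of its codebooks: the error of covering the source by `j`, that
of covering `(U, Y, V)` by `(k', j)`, and that of the input codewords. -/
theorem BlockCode.tv_out_le (C : BlockCode 𝒰 𝒳 𝒴 𝒲 J L K K') {pU : 𝒰 → ℝ} {pYX : 𝒳 → 𝒴 → ℝ}
    (hYX : IsKernel pYX) {pV : 𝒲 × 𝒴 → 𝒱 → ℝ} (hV : IsKernel pV) (pX : 𝒳 → ℝ)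
    {out : 𝒳 → 𝒰 × 𝒴 × 𝒱 → ℝ} (hout : IsKernel out) (post : 𝒳 → 𝒲 → 𝒰 → ℝ)
    (hκ : ∀ a k' u j, 1 / (Fintype.card J : ℝ) * post (C.x a) (C.w a (k', j)) u
      = (1 / (Fintype.card J : ℝ) * ∑ j', post (C.x a) (C.w a (k', j')) u) * C.κ a k' u j) :
    tv (C.out pU pYX pV) (fun z => pX z.2.1 * out z.2.1 (z.1, z.2.2)) ≤
      1 / (Fintype.card ((J × L) × K) : ℝ) * ∑ a,
        (tv (fun b : 𝒰 × 𝒴 × 𝒱 => 1 / (Fintype.card (K' × J) : ℝ) * ∑ t, post (C.x a) (C.w a t) b.1 *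
            pYX (C.x a) b.2.1 * pV (C.w a t, b.2.1) b.2.2) (out (C.x a))
          + 1 / (Fintype.card K' : ℝ) * ∑ k',
            tv (fun u => 1 / (Fintype.card J : ℝ) * ∑ j, post (C.x a) (C.w a (k', j)) u) pU)
      + tv (fun x => 1 / (Fintype.card ((J × L) × K) : ℝ) * ∑ a, if C.x a = x then 1 else 0) pX := by
  set cA : ℝ := (Fintype.card ((J × L) × K) : ℝ) with hcA
  set cJ : ℝ := (Fintype.card J : ℝ) with hcJ
  set cK : ℝ := (Fintype.card K' : ℝ) with hcK
  have pA : 0 < cA := by rw [hcA]; exact_mod_cast Fintype.card_pos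
  have pJ : 0 < cJ := by rw [hcJ]; exact_mod_cast Fintype.card_pos
  have pK : 0 < cK := by rw [hcK]; exact_mod_cast Fintype.card_pos
  let Q : (((((J × L) × K) × K' × J) × 𝒰) × 𝒴) × 𝒱 → ℝ := fun z =>
    1 / (cA * cK) * (1 / cJ * post (C.x z.1.1.1.1) (C.w z.1.1.1.1 z.1.1.1.2) z.1.1.2) *
      pYX (C.x z.1.1.1.1) z.1.2 * pV (C.w z.1.1.1.1 z.1.1.1.2, z.1.2) z.2
  let F : (((((J × L) × K) × K' × J) × 𝒰) × 𝒴) × 𝒱 → 𝒰 × 𝒳 × 𝒴 × 𝒱 :=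
    fun z => (z.1.1.2, C.x z.1.1.1.1, z.1.2, z.2)
  let S : (J × L) × K → 𝒰 × 𝒴 × 𝒱 → ℝ := fun a b => 1 / (Fintype.card (K' × J) : ℝ) *
    ∑ t, post (C.x a) (C.w a t) b.1 * pYX (C.x a) b.2.1 * pV (C.w a t, b.2.1) b.2.2
  have hKJ : (Fintype.card (K' × J) : ℝ) = cK * cJ := by rw [Fintype.card_prod]; push_cast; rfl
  -- the posterior law of the satellite index turns `P_U` into the average of the posteriors
  have t1 : tv (C.law pU pYX pV) Q = 1 / cA * ∑ a, 1 / cK * ∑ k',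
      tv (fun u => 1 / cJ * ∑ j, post (C.x a) (C.w a (k', j)) u) pU := by
    have hpt : ∀ a k' j u y v, |C.law pU pYX pV (((((a, k', j), u), y), v)) - Q ((((a, k', j), u), y), v)|
        = 1 / (cA * cK) * (|(1 / cJ * ∑ j', post (C.x a) (C.w a (k', j')) u) - pU u| * C.κ a k' u j) *
          pYX (C.x a) y * pV (C.w a (k', j), y) v := by
      intro a k' j u y v
      simp only [BlockCode.law, BlockCode.pre, BlockCode.index, Q, ← hcA, ← hcK, hκ]
      set s := 1 / cJ * ∑ j', post (C.x a) (C.w a (k', j')) u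
      rw [show 1 / (cA * cK) * C.κ a k' u j * pU u * pYX (C.x a) y * pV (C.w a (k', j), y) v
          - 1 / (cA * cK) * (s * C.κ a k' u j) * pYX (C.x a) y * pV (C.w a (k', j), y) v
          = -((1 / (cA * cK)) * (C.κ a k' u j * pYX (C.x a) y * pV (C.w a (k', j), y) v) * (s - pU u))
          by ring, abs_neg, abs_mul, abs_of_nonneg]
      · ring
      · exact mul_nonneg (by positivity) (mul_nonneg (mul_nonneg ((C.κ_kernel _ _ _).1 _)
          ((hYX _).1 _)) ((hV _).1 _))
    simp only [tv, Fintype.sum_prod_type (α₁ := ((((J × L) × K) × K' × J) × 𝒰) × 𝒴),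
      Fintype.sum_prod_type (α₁ := (((J × L) × K) × K' × J) × 𝒰),
      Fintype.sum_prod_type (α₁ := ((J × L) × K) × K' × J),
      Fintype.sum_prod_type (α₁ := ((J × L) × K)), Fintype.sum_prod_type (α₁ := K'), hpt,
      ← Finset.mul_sum, (hV _).2, (hYX _).2, mul_one]
    rw [← mul_assoc, one_div_mul_one_div]
    congr 1
    refine Finset.sum_congr rfl fun a _ => Finset.sum_congr rfl fun k' _ => ?_
    rw [Finset.sum_comm]
    simp only [← Finset.mul_sum, (C.κ_kernel _ _ _).2, mul_one]
  have t2 : ∀ z, marg Q F z = 1 / cA * ∑ a, if C.x a = z.2.1 then S a (z.1, z.2.2) else 0 := by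
    rintro ⟨u, x, y, v⟩
    have : marg Q F (u, x, y, v) = ∑ a, ∑ t : K' × J, if C.x a = x then Q ((((a, t), u), y), v) else 0 := by
      simp only [marg, F, Fintype.sum_prod_type (α₁ := ((((J × L) × K) × K' × J) × 𝒰) × 𝒴),
        Fintype.sum_prod_type (α₁ := (((J × L) × K) × K' × J) × 𝒰),
        Fintype.sum_prod_type (α₁ := ((J × L) × K) × K' × J),
        Fintype.sum_prod_type (α₁ := ((J × L) × K)) (α₂ := K' × J), Prod.mk.injEq]
      refine Finset.sum_congr rfl fun a _ => Finset.sum_congr rfl fun t _ => ?_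
      rw [Finset.sum_eq_single u, Finset.sum_eq_single y, Finset.sum_eq_single v]
      · simp
      all_goals simp +contextual
    rw [this, Finset.mul_sum]
    refine Finset.sum_congr rfl fun a _ => ?_
    by_cases h : C.x a = x
    · simp only [h, if_true, S, Q, hKJ]
      rw [Finset.mul_sum, Finset.mul_sum]
      refine Finset.sum_congr rfl fun t _ => ?_
      field_simp
    · simp [h]
  let M : 𝒳 → ℝ := fun x => 1 / cA * ∑ a, if C.x a = x then 1 else 0
  have t3 : tv (marg Q F) (fun z => M z.2.1 * out z.2.1 (z.1, z.2.2))
      ≤ 1 / cA * ∑ a, tv (S a) (out (C.x a)) := by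
    have hpt : ∀ z : 𝒰 × 𝒳 × 𝒴 × 𝒱, |marg Q F z - M z.2.1 * out z.2.1 (z.1, z.2.2)| ≤
        1 / cA * ∑ a, if C.x a = z.2.1 then |S a (z.1, z.2.2) - out (C.x a) (z.1, z.2.2)| else 0 := by
      intro z
      rw [t2, show (1 / cA * ∑ a, if C.x a = z.2.1 then S a (z.1, z.2.2) else 0)
          - M z.2.1 * out z.2.1 (z.1, z.2.2) = 1 / cA * ∑ a, if C.x a = z.2.1 then
            S a (z.1, z.2.2) - out (C.x a) (z.1, z.2.2) else 0 from ?_, abs_mul,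
        abs_of_pos (by positivity)]
      · refine mul_le_mul_of_nonneg_left ((Finset.abs_sum_le_sum_abs _ _).trans
          (Finset.sum_le_sum fun a _ => ?_)) (by positivity)
        split_ifs <;> simp
      · simp only [M]
        rw [mul_assoc, Finset.sum_mul, ← mul_sub, ← Finset.sum_sub_distrib]
        congr 1
        refine Finset.sum_congr rfl fun a _ => ?_
        split_ifs with h <;> simp [h]
    refine (Finset.sum_le_sum fun z _ => hpt z).trans (le_of_eq ?_)
    rw [← Finset.mul_sum, Finset.sum_comm]
    congr 1
    refine Finset.sum_congr rfl fun a _ => ?_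
    simp only [tv, Fintype.sum_prod_type (α₁ := 𝒰)]
    refine Finset.sum_congr rfl fun u _ => ?_
    rw [Fintype.sum_prod_type (α₁ := 𝒳), Finset.sum_eq_single (C.x a)]
    · simp
    · intro x _ hx
      simp [Ne.symm hx]
    · simp
  have t4 : tv (fun z : 𝒰 × 𝒳 × 𝒴 × 𝒱 => M z.2.1 * out z.2.1 (z.1, z.2.2))
      (fun z => pX z.2.1 * out z.2.1 (z.1, z.2.2)) = tv M pX := by
    have := fun x => (hout x).2
    simp only [Fintype.sum_prod_type (α₁ := 𝒰)] at this
    simp only [tv, ← sub_mul, abs_mul, abs_of_nonneg ((hout _).1 _), Fintype.sum_prod_type (α₁ := 𝒰),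
      Fintype.sum_prod_type (α₁ := 𝒳)]
    rw [Finset.sum_comm]
    simp only [← Finset.mul_sum, this, mul_one]
  have t5 : tv (C.out pU pYX pV) (marg Q F) ≤ tv (C.law pU pYX pV) Q := tv_marg_le _ _ _
  have t6 := tv_triangle (C.out pU pYX pV) (marg Q F) (fun z => pX z.2.1 * out z.2.1 (z.1, z.2.2))
  have t7 := tv_triangle (marg Q F) (fun z => M z.2.1 * out z.2.1 (z.1, z.2.2))
    (fun z => pX z.2.1 * out z.2.1 (z.1, z.2.2))
  rw [Finset.sum_add_distrib, mul_add]
  have e8 : (1 / cA * ∑ a, tv (S a) (out (C.x a))) + 1 / cA * ∑ a, 1 / cK * ∑ k',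
      tv (fun u => 1 / cJ * ∑ j, post (C.x a) (C.w a (k', j)) u) pU + tv M pX ≥
      tv (C.out pU pYX pV) (fun z => pX z.2.1 * out z.2.1 (z.1, z.2.2)) := by linarith
  exact e8

end

/-! ### Existence of a block code by random coding -/

section

variable {𝒰 𝒳 𝒴 𝒱 𝒲 : Type*} [Fintype 𝒰] [Fintype 𝒳] [Fintype 𝒴] [Fintype 𝒱] [Fintype 𝒲]
  (D : AuxData 𝒰 𝒳 𝒴 𝒱 𝒲) {N : ℕ}

theorem AuxData.blockTarget_eq (z : (Fin N → 𝒰) × (Fin N → 𝒳) × (Fin N → 𝒴) × (Fin N → 𝒱)) :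
    D.blockTarget N z = iid D.pX z.2.1 *
      prodLaw (fun i => D.outUYV (z.2.1 i)) (fun i => (z.1 i, z.2.2.1 i, z.2.2.2 i)) := by
  simp only [blockTarget, target, iid, prodLaw, Finset.prod_mul_distrib]

open Classical in
/-- The random codebook of input codewords covers `X^N`. -/
theorem sum_iid_mul_tv_empirical_le {α A : Type*} [Fintype α] [Fintype A] [DecidableEq A] [Nonempty A]
    {p : α → ℝ} (hp : p ∈ stdSimplex ℝ α) {γ : ℝ} (hγ : 0 ≤ γ) :
    ∑ x : A → α, iid p x * tv (fun b => 1 / (Fintype.card A : ℝ) * ∑ a, if x a = b then 1 else 0) p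
      ≤ 2 * prob p (fun b => γ * p b < 1) + √(γ / Fintype.card A) := by
  have h := soft_covering (ι := A) hp (T := fun a b : α => if a = b then 1 else 0)
    (fun a b => by split_ifs <;> norm_num) (q := p) (by simp) hp.2.le hγ
  refine h.trans (add_le_add_left (mul_le_mul_of_nonneg_left (le_of_eq ?_) zero_le_two) _)
  rw [prob, prob, Fintype.sum_prod_type]
  refine Finset.sum_congr rfl fun a _ => ?_
  rw [Finset.sum_eq_single a]
  · simp
  · intro b _ hb
    simp [Ne.symm hb]
  · simp

/-- Existence of a good block code, by averaging over random codebooks. The numbers `c₁`, `c₂`, `c₃`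
are the exponents of the coverings of `(U, Y, V)` and `X` and of the packing; `e₂` bounds the error of
covering `U`. -/
theorem exists_blockCode {J L K K' : Type*} [Fintype J] [Fintype L] [Fintype K] [Fintype K']
    [Nonempty J] [Nonempty L] [Nonempty K] [Nonempty K'] [DecidableEq J] (c₁ c₂ c₃ : ℝ)
    {e₂ : (Fin N → 𝒳) → ℝ}
    (h₂ : ∀ x : Fin N → 𝒳, ∑ w : J → Fin N → 𝒲, iid (prodLaw fun i => D.qW (x i)) w *
      tv (fun u => 1 / (Fintype.card J : ℝ) * ∑ j, D.blockPost x (w j) u) (iid D.pU) ≤ e₂ x) :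
    ∃ C : BlockCode (Fin N → 𝒰) (Fin N → 𝒳) (Fin N → 𝒴) (Fin N → 𝒲) J L K K',
      tv (C.out (iid D.pU) (D.blockYX N) (D.blockV N)) (D.blockTarget N)
        + C.err (iid D.pU) (D.blockYX N) ≤
      ∑ x, iid D.pX x *
          (2 * D.badUYV c₁ x + √(Real.exp (N * c₁) / Fintype.card (K' × J)) + e₂ x)
        + (2 * prob (iid D.pX : (Fin N → 𝒳) → ℝ) (fun x => Real.exp (N * c₂) * iid D.pX x < 1)
          + √(Real.exp (N * c₂) / Fintype.card ((J × L) × K)))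
        + (prob (fun z : (Fin N → 𝒳) × (Fin N → 𝒴) => iid D.pX z.1 * D.blockYX N z.1 z.2)
            (fun z => D.blockYX N z.1 z.2 ≤ Real.exp (N * c₃) * iid D.qY z.2)
          + (Fintype.card (J × L) - 1) / Real.exp (N * c₃)) := by
  classical
  have hpX : (iid D.pX : (Fin N → 𝒳) → ℝ) ∈ stdSimplex ℝ (Fin N → 𝒳) := iid_mem D.hX
  choose sat hsat using fun x => exists_satellites D (K' := K') c₁ x (h₂ x)
  let g : (Fin N → 𝒳) → ℝ := fun x =>
    tv (fun b => 1 / (Fintype.card (K' × J) : ℝ) * ∑ a, D.blockPostUYV x (sat x a) b)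
          (prodLaw fun i => D.outUYV (x i))
        + 1 / (Fintype.card K' : ℝ) * ∑ k',
          tv (fun u => 1 / (Fintype.card J : ℝ) * ∑ j, D.blockPost x (sat x (k', j)) u) (iid D.pU)
  let dec : ((J × L) × K → Fin N → 𝒳) → (Fin N → 𝒴) × K → J × L := fun x =>
    thresholdDecoder (D.blockYX N) (iid D.qY) (Real.exp (N * c₃)) x
  have hqY : ∀ y : Fin N → 𝒴, ∑ x : Fin N → 𝒳, iid D.pX x * D.blockYX N x y = iid D.qY y := by
    intro y
    simp only [iid, AuxData.blockYX, prodLaw, ← Finset.prod_mul_distrib]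
    exact sum_prod_pi (fun i a => D.pX a * D.pYX a (y i))
  obtain ⟨x, hx⟩ : ∃ x : (J × L) × K → Fin N → 𝒳,
      1 / (Fintype.card ((J × L) × K) : ℝ) * ∑ a, g (x a)
        + tv (fun b => 1 / (Fintype.card ((J × L) × K) : ℝ) * ∑ a, if x a = b then 1 else 0) (iid D.pX)
        + 1 / (Fintype.card ((J × L) × K) : ℝ) * (∑ a, ∑ b,
            if dec x (b, a.2) ≠ a.1 then D.blockYX N (x a) b else 0) ≤
      ∑ x, iid D.pX x *
          (2 * D.badUYV c₁ x + √(Real.exp (N * c₁) / Fintype.card (K' × J)) + e₂ x)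
        + (2 * prob (iid D.pX : (Fin N → 𝒳) → ℝ) (fun x => Real.exp (N * c₂) * iid D.pX x < 1)
          + √(Real.exp (N * c₂) / Fintype.card ((J × L) × K)))
        + (prob (fun z : (Fin N → 𝒳) × (Fin N → 𝒴) => iid D.pX z.1 * D.blockYX N z.1 z.2)
            (fun z => D.blockYX N z.1 z.2 ≤ Real.exp (N * c₃) * iid D.qY z.2)
          + (Fintype.card (J × L) - 1) / Real.exp (N * c₃)) := by
    refine exists_le_of_sum_le (iid_mem hpX) ?_
    have hA : ∑ x : (J × L) × K → Fin N → 𝒳, iid (iid D.pX) x *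
          (1 / (Fintype.card ((J × L) × K) : ℝ) * ∑ a, g (x a)) ≤ ∑ x, iid D.pX x *
          (2 * D.badUYV c₁ x + √(Real.exp (N * c₁) / Fintype.card (K' × J)) + e₂ x) := by
      have h3 : ∀ a : (J × L) × K, ∑ x : (J × L) × K → Fin N → 𝒳, iid (iid D.pX) x * g (x a)
          = ∑ x, iid D.pX x * g x := fun a =>
        sum_prodLaw_apply (p := fun _ => iid D.pX) (fun _ => hpX) a g
      calc _ = 1 / (Fintype.card ((J × L) × K) : ℝ) * ∑ a : (J × L) × K,
            ∑ x : (J × L) × K → Fin N → 𝒳, iid (iid D.pX) x * g (x a) := by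
            rw [Finset.sum_comm, Finset.mul_sum]
            refine Finset.sum_congr rfl fun w _ => ?_
            rw [← Finset.mul_sum]
            ring
        _ = ∑ x, iid D.pX x * g x := by
            simp only [h3]
            rw [Finset.sum_const, Finset.card_univ, nsmul_eq_mul]
            have : (Fintype.card ((J × L) × K) : ℝ) ≠ 0 := by exact_mod_cast Fintype.card_ne_zero
            field_simp
        _ ≤ _ := Finset.sum_le_sum fun x _ => mul_le_mul_of_nonneg_left (hsat x) (hpX.1 x)
    refine le_trans (le_of_eq ?_) (add_le_add (add_le_add hA
      (sum_iid_mul_tv_empirical_le (A := (J × L) × K) hpX (Real.exp_pos (N * c₂)).le))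
      (threshold_decoding (μ := J × L) (κ := K) hpX (D.blockYX_kernel N) hqY (Real.exp_pos (N * c₃))))
    rw [← Finset.sum_add_distrib, ← Finset.sum_add_distrib]
    refine Finset.sum_congr rfl fun x _ => ?_
    rw [mul_add, mul_add]
    congr!
  -- the satellite index is drawn from its posterior law given the source block
  obtain ⟨κ, hκ, hκ'⟩ := exists_kernel_of_sum_eq
    (s := fun b : ((J × L) × K) × K' × (Fin N → 𝒰) => 1 / (Fintype.card J : ℝ) *
      ∑ j', D.blockPost (x b.1) (sat (x b.1) (b.2.1, j')) b.2.2)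
    (f := fun b j => 1 / (Fintype.card J : ℝ) * D.blockPost (x b.1) (sat (x b.1) (b.2.1, j)) b.2.2)
    (fun b j => mul_nonneg (by positivity) (Finset.prod_nonneg fun i _ => D.post_nonneg _ _ _))
    (fun b => (Finset.mul_sum _ _ _).symm)
    (k₀ := fun _ j => if j = Classical.arbitrary J then 1 else 0)
    (fun _ => ⟨fun j => by positivity, by simp⟩)
  let C : BlockCode (Fin N → 𝒰) (Fin N → 𝒳) (Fin N → 𝒴) (Fin N → 𝒲) J L K K' :=
    { x := x
      w := fun a => sat (x a)
      κ := fun a k' u => κ (a, k', u)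
      κ_kernel := fun a k' u => hκ _
      dec := dec x }
  have hout : IsKernel fun (x : Fin N → 𝒳) (b : (Fin N → 𝒰) × (Fin N → 𝒴) × (Fin N → 𝒱)) =>
      prodLaw (fun i => D.outUYV (x i)) (fun i => (b.1 i, b.2.1 i, b.2.2 i)) := by
    intro x
    have h := prodLaw_mem (p := fun i => D.outUYV (x i)) fun i => D.outUYV_kernel _
    refine ⟨fun b => h.1 _, ?_⟩
    rw [← h.2]
    let e : (Fin N → 𝒰) × (Fin N → 𝒴) × (Fin N → 𝒱) ≃ (Fin N → 𝒰 × 𝒴 × 𝒱) :=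
      ((unzip _ _ _).trans ((Equiv.refl _).prodCongr (unzip _ _ _))).symm
    exact e.sum_comp (prodLaw fun i => D.outUYV (x i))
  have key := C.tv_out_le (pU := iid D.pU) (D.blockYX_kernel N) (D.blockV_kernel N) (iid D.pX) hout
    D.blockPost (fun a k' u j => hκ' (a, k', u) j)
  have herr := C.err_eq (iid_mem D.hU) (D.blockYX N)
  have hT : D.blockTarget N = fun z => iid D.pX z.2.1 *
      prodLaw (fun i => D.outUYV (z.2.1 i)) (fun i => (z.1 i, z.2.2.1 i, z.2.2.2 i)) :=
    funext D.blockTarget_eq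
  refine ⟨C, ?_⟩
  rw [hT, herr]
  refine le_trans ?_ hx
  refine add_le_add (key.trans (le_of_eq ?_)) (le_of_eq ?_)
  · congr 1
    · congr 1
      refine Finset.sum_congr rfl fun a _ => ?_
      congr 1
      let e : (Fin N → 𝒰) × (Fin N → 𝒴) × (Fin N → 𝒱) ≃ (Fin N → 𝒰 × 𝒴 × 𝒱) :=
        ((unzip _ _ _).trans ((Equiv.refl _).prodCongr (unzip _ _ _))).symm
      rw [tv, tv, ← e.sum_comp]
      refine Finset.sum_congr rfl fun b _ => ?_
      congr 2
      congr 1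
      refine Finset.sum_congr rfl fun t _ => ?_
      simp only [AuxData.blockPostUYV, AuxData.postUYV, Finset.prod_mul_distrib]
      rfl
    · congr!
  · congr!

end

/-! ### The single-letter rates as entropies -/

/-- A mass of a marginal is a sum over any parametrization `g` of the fibre. -/
theorem marg_eq_sum {Ω α β : Type*} [Fintype Ω] [Fintype β] {p : Ω → ℝ} {f : Ω → α} {a : α}
    {g : β → Ω} {r : Ω → β} (h₁ : ∀ b, f (g b) = a) (h₂ : ∀ b, r (g b) = b)
    (h₃ : ∀ ω, f ω = a → g (r ω) = ω) : marg p f a = ∑ b, p (g b) := by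
  classical
  rw [marg, ← Finset.sum_filter]
  exact Finset.sum_nbij' r g (by simp) (by simp [h₁]) (by simpa using h₃) (by simp [h₂])
    (fun ω hω => by rw [h₃ ω (by simpa using hω)])

namespace AuxData

variable {𝒰 𝒳 𝒴 𝒱 𝒲 : Type*} [Fintype 𝒰] [Fintype 𝒳] [Fintype 𝒴] [Fintype 𝒱] [Fintype 𝒲]
  (D : AuxData 𝒰 𝒳 𝒴 𝒱 𝒲)

/-- The law of `(U, X, W, Y, V)`. -/
def law : 𝒰 × 𝒳 × 𝒲 × 𝒴 × 𝒱 → ℝ := joint D.pU D.pX D.pW D.pYX D.pV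

theorem law_apply (u : 𝒰) (x : 𝒳) (w : 𝒲) (y : 𝒴) (v : 𝒱) :
    D.law (u, x, w, y, v) = D.pU u * D.pX x * D.pW (u, x) w * D.pYX x y * D.pV (w, y) v := rfl

theorem law_nonneg (z : 𝒰 × 𝒳 × 𝒲 × 𝒴 × 𝒱) : 0 ≤ D.law z := by
  obtain ⟨u, x, w, y, v⟩ := z
  have := D.hU.1 u
  have := D.hX.1 x
  have := (D.hW (u, x)).1 w
  have := (D.hYX x).1 y
  have := (D.hV (w, y)).1 v
  rw [law_apply]
  positivity

theorem law_mem : D.law ∈ stdSimplex ℝ (𝒰 × 𝒳 × 𝒲 × 𝒴 × 𝒱) := by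
  refine ⟨D.law_nonneg, ?_⟩
  simp only [Fintype.sum_prod_type, law_apply, ← Finset.mul_sum, (D.hV _).2, (D.hYX _).2, (D.hW _).2,
    mul_one, D.hX.2, D.hU.2]

theorem marg_law_WX (w : 𝒲) (x : 𝒳) :
    marg D.law (fun z => (rvW z, rvX z)) (w, x) = D.pX x * D.qW x w := by
  rw [marg_eq_sum (β := 𝒰 × 𝒴 × 𝒱) (g := fun b => (b.1, x, w, b.2.1, b.2.2))
    (r := fun z => (rvU z, rvY z, rvV z)) (fun _ => rfl) (fun _ => rfl)
    (by rintro ⟨u, x, w, y, v⟩ h; cases h; rfl)]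
  simp only [Fintype.sum_prod_type, law_apply, ← Finset.mul_sum,
    (D.hV _).2, (D.hYX _).2, mul_one, qW]
  rw [Finset.mul_sum]
  exact Finset.sum_congr rfl fun u _ => by ring

theorem marg_law_U (u : 𝒰) : marg D.law rvU u = D.pU u := by
  rw [marg_eq_sum (β := 𝒳 × 𝒲 × 𝒴 × 𝒱) (g := fun b => (u, b.1, b.2.1, b.2.2.1, b.2.2.2))
    (r := fun z => (rvX z, rvW z, rvY z, rvV z)) (fun _ => rfl) (fun _ => rfl)
    (by rintro ⟨u, x, w, y, v⟩ h; cases h; rfl)]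
  simp only [Fintype.sum_prod_type, law_apply, ← Finset.mul_sum,
    (D.hV _).2, (D.hYX _).2, (D.hW _).2, mul_one, D.hX.2]

theorem marg_law_X (x : 𝒳) : marg D.law rvX x = D.pX x := by
  rw [marg_eq_sum (β := 𝒰 × 𝒲 × 𝒴 × 𝒱) (g := fun b => (b.1, x, b.2.1, b.2.2.1, b.2.2.2))
    (r := fun z => (rvU z, rvW z, rvY z, rvV z)) (fun _ => rfl) (fun _ => rfl)
    (by rintro ⟨u, x, w, y, v⟩ h; cases h; rfl)]
  simp only [Fintype.sum_prod_type, law_apply, ← Finset.mul_sum,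
    (D.hV _).2, (D.hYX _).2, (D.hW _).2, mul_one, ← Finset.sum_mul, D.hU.2, one_mul]

theorem marg_law_UX (u : 𝒰) (x : 𝒳) :
    marg D.law (fun z => (rvU z, rvX z)) (u, x) = D.pU u * D.pX x := by
  rw [marg_eq_sum (β := 𝒲 × 𝒴 × 𝒱) (g := fun b => (u, x, b.1, b.2.1, b.2.2))
    (r := fun z => (rvW z, rvY z, rvV z)) (fun _ => rfl) (fun _ => rfl)
    (by rintro ⟨u, x, w, y, v⟩ h; cases h; rfl)]
  simp only [Fintype.sum_prod_type, law_apply, ← Finset.mul_sum,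
    (D.hV _).2, (D.hYX _).2, (D.hW _).2, mul_one]

theorem marg_law_WXU (w : 𝒲) (x : 𝒳) (u : 𝒰) :
    marg D.law (fun z => ((rvW z, rvX z), rvU z)) ((w, x), u) = D.pU u * D.pX x * D.pW (u, x) w := by
  rw [marg_eq_sum (β := 𝒴 × 𝒱) (g := fun b => (u, x, w, b.1, b.2))
    (r := fun z => (rvY z, rvV z)) (fun _ => rfl) (fun _ => rfl)
    (by rintro ⟨u, x, w, y, v⟩ h; cases h; rfl)]
  simp only [Fintype.sum_prod_type, law_apply, ← Finset.mul_sum,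
    (D.hV _).2, (D.hYX _).2, mul_one]

theorem marg_law_Y (y : 𝒴) : marg D.law rvY y = D.qY y := by
  rw [marg_eq_sum (β := 𝒰 × 𝒳 × 𝒲 × 𝒱) (g := fun b => (b.1, b.2.1, b.2.2.1, y, b.2.2.2))
    (r := fun z => (rvU z, rvX z, rvW z, rvV z)) (fun _ => rfl) (fun _ => rfl)
    (by rintro ⟨u, x, w, y, v⟩ h; cases h; rfl)]
  simp only [Fintype.sum_prod_type, law_apply, ← Finset.mul_sum, ← Finset.sum_mul,
    (D.hV _).2, (D.hW _).2, mul_one]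
  rw [Finset.sum_comm]
  simp only [← Finset.sum_mul, D.hU.2, one_mul, qY]

theorem marg_law_WXY (w : 𝒲) (x : 𝒳) (y : 𝒴) :
    marg D.law (fun z => ((rvW z, rvX z), rvY z)) ((w, x), y)
      = D.pX x * D.qW x w * D.pYX x y := by
  rw [marg_eq_sum (β := 𝒰 × 𝒱) (g := fun b => (b.1, x, w, y, b.2))
    (r := fun z => (rvU z, rvV z)) (fun _ => rfl) (fun _ => rfl)
    (by rintro ⟨u, x, w, y, v⟩ h; cases h; rfl)]
  simp only [Fintype.sum_prod_type, law_apply, ← Finset.mul_sum,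
    (D.hV _).2, mul_one, qW]
  rw [Finset.mul_sum, Finset.sum_mul]
  exact Finset.sum_congr rfl fun u _ => by ring

theorem marg_law_UXYV (z : 𝒰 × 𝒳 × 𝒴 × 𝒱) :
    marg D.law (fun z => (rvU z, rvX z, rvY z, rvV z)) z = D.target z := by
  obtain ⟨u, x, y, v⟩ := z
  rw [marg_eq_sum (β := 𝒲) (g := fun w => (u, x, w, y, v)) (r := rvW) (fun _ => rfl) (fun _ => rfl)
    (by rintro ⟨u, x, w, y, v⟩ h; cases h; rfl)]
  simp only [law_apply, target, outUYV, condV, Finset.mul_sum]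
  exact Finset.sum_congr rfl fun w _ => by ring

/-- The factors are positive where the law is. -/
theorem pos_of_law_pos {u : 𝒰} {x : 𝒳} {w : 𝒲} {y : 𝒴} {v : 𝒱} (h : 0 < D.law (u, x, w, y, v)) :
    0 < D.pU u ∧ 0 < D.pX x ∧ 0 < D.pW (u, x) w ∧ 0 < D.pYX x y ∧ 0 < D.pV (w, y) v ∧
      0 < D.qW x w ∧ 0 < D.qY y ∧ 0 < D.outUYV x (u, y, v) := by
  have h1 := h
  rw [law_apply] at h1
  have nU := D.hU.1 u
  have nX := D.hX.1 x
  have nW := (D.hW (u, x)).1 w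
  have nYX := (D.hYX x).1 y
  have nV := (D.hV (w, y)).1 v
  have pV := pos_of_mul_pos_right h1 (by positivity)
  have h2 := pos_of_mul_pos_left h1 nV
  have pYX := pos_of_mul_pos_right h2 (by positivity)
  have h3 := pos_of_mul_pos_left h2 nYX
  have pW := pos_of_mul_pos_right h3 (by positivity)
  have h4 := pos_of_mul_pos_left h3 nW
  have pX := pos_of_mul_pos_right h4 nU
  have pU := pos_of_mul_pos_left h4 nX
  refine ⟨pU, pX, pW, pYX, pV, ?_, ?_, ?_⟩
  · have := marg_pos D.law_nonneg (fun z => (rvW z, rvX z)) h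
    rw [marg_law_WX] at this
    exact pos_of_mul_pos_right this nX
  · have := marg_pos D.law_nonneg rvY h
    rwa [marg_law_Y] at this
  · have := marg_pos D.law_nonneg (fun z => (rvU z, rvX z, rvY z, rvV z)) h
    rw [marg_law_UXYV] at this
    exact pos_of_mul_pos_right this nX

theorem rateU_eq_sum : D.rateU = ∑ z : 𝒰 × 𝒳 × 𝒲 × 𝒴 × 𝒱,
    D.law z * Real.log (D.post z.2.1 z.2.2.1 z.1 / D.pU z.1) := by
  simp only [rateU, Fintype.sum_prod_type, law_apply, ← Finset.sum_mul, ← Finset.mul_sum, (D.hV _).2,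
    (D.hYX _).2, mul_one]
  rw [Finset.sum_comm (γ := 𝒰)]
  refine Finset.sum_congr rfl fun x _ => ?_
  rw [Finset.sum_comm (γ := 𝒰)]
  refine Finset.sum_congr rfl fun w _ => Finset.sum_congr rfl fun u _ => ?_
  rw [mul_assoc (D.pX x), qW_mul_post]
  ring

theorem rateUYV_eq_sum : D.rateUYV = ∑ z : 𝒰 × 𝒳 × 𝒲 × 𝒴 × 𝒱, D.law z *
    Real.log (D.postUYV z.2.1 z.2.2.1 (z.1, z.2.2.2) / D.outUYV z.2.1 (z.1, z.2.2.2)) := by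
  simp only [rateUYV, Fintype.sum_prod_type, law_apply]
  rw [Finset.sum_comm (γ := 𝒰)]
  refine Finset.sum_congr rfl fun x _ => ?_
  rw [Finset.sum_comm (γ := 𝒰)]
  refine Finset.sum_congr rfl fun w _ => Finset.sum_congr rfl fun u _ => Finset.sum_congr rfl
    fun y _ => Finset.sum_congr rfl fun v _ => ?_
  congr 1
  have := D.qW_mul_post x w u
  calc _ = D.pX x * (D.qW x w * D.post x w u) * D.pYX x y * D.pV (w, y) v := by
        simp only [postUYV]; ring
    _ = _ := by rw [this]; ring

theorem rateY_eq_sum : D.rateY = ∑ z : 𝒰 × 𝒳 × 𝒲 × 𝒴 × 𝒱,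
    D.law z * Real.log (D.pYX z.2.1 z.2.2.2.1 / D.qY z.2.2.2.1) := by
  simp only [rateY, Fintype.sum_prod_type, law_apply, ← Finset.sum_mul, ← Finset.mul_sum, (D.hV _).2,
    mul_one]
  rw [Finset.sum_comm (γ := 𝒰)]
  refine Finset.sum_congr rfl fun x _ => ?_
  simp only [Finset.sum_comm (γ := 𝒲) (α := 𝒴), ← Finset.sum_mul, ← Finset.mul_sum, (D.hW _).2,
    mul_one]
  rw [Finset.sum_comm]
  simp only [← Finset.sum_mul, D.hU.2, one_mul]

theorem shannon_pX : shannon D.pX = ent D.law rvX := by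
  rw [ent, funext D.marg_law_X]

theorem rateU_eq : D.rateU = ent D.law (fun z => (rvW z, rvX z)) + ent D.law rvU
    - ent D.law (fun z => ((rvW z, rvX z), rvU z)) := by
  rw [rateU_eq_sum, ent_eq, ent_eq, ent_eq, ← Finset.sum_neg_distrib, ← Finset.sum_neg_distrib,
    ← Finset.sum_neg_distrib, ← Finset.sum_add_distrib, ← Finset.sum_sub_distrib]
  refine Finset.sum_congr rfl fun z _ => ?_
  rcases (D.law_nonneg z).eq_or_lt with h | h
  · simp [← h]
  obtain ⟨u, x, w, y, v⟩ := z
  obtain ⟨pU, pX, pW, pYX, pV, pqW, pqY, pout⟩ := D.pos_of_law_pos h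
  simp only [marg_law_WX, marg_law_U, marg_law_WXU, post]
  simp only [rvW, rvX, rvU]
  rw [Real.log_div (by positivity) (by positivity), Real.log_mul, Real.log_mul, Real.log_mul,
    Real.log_mul, Real.log_div]
  · ring
  all_goals positivity

theorem rateY_eq : D.rateY = ent D.law (fun z => (rvW z, rvX z)) + ent D.law rvY
    - ent D.law (fun z => ((rvW z, rvX z), rvY z)) := by
  rw [rateY_eq_sum, ent_eq, ent_eq, ent_eq, ← Finset.sum_neg_distrib, ← Finset.sum_neg_distrib,
    ← Finset.sum_neg_distrib, ← Finset.sum_add_distrib, ← Finset.sum_sub_distrib]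
  refine Finset.sum_congr rfl fun z _ => ?_
  rcases (D.law_nonneg z).eq_or_lt with h | h
  · simp [← h]
  obtain ⟨u, x, w, y, v⟩ := z
  obtain ⟨pU, pX, pW, pYX, pV, pqW, pqY, pout⟩ := D.pos_of_law_pos h
  simp only [marg_law_WX, marg_law_Y, marg_law_WXY]
  simp only [rvW, rvX, rvY]
  rw [Real.log_div (by positivity) (by positivity), Real.log_mul, Real.log_mul, Real.log_mul]
  · ring
  all_goals positivity

theorem rateUYV_eq : D.rateUYV = ent D.law (fun z => (rvU z, rvX z, rvY z, rvV z))
    + ent D.law (fun z => (rvW z, rvX z)) - ent D.law id - ent D.law rvX := by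
  rw [rateUYV_eq_sum, ent_eq, ent_eq, ent_eq, ent_eq, ← Finset.sum_neg_distrib,
    ← Finset.sum_neg_distrib, ← Finset.sum_neg_distrib, ← Finset.sum_neg_distrib,
    ← Finset.sum_add_distrib, ← Finset.sum_sub_distrib, ← Finset.sum_sub_distrib]
  refine Finset.sum_congr rfl fun z _ => ?_
  rcases (D.law_nonneg z).eq_or_lt with h | h
  · simp [← h]
  obtain ⟨u, x, w, y, v⟩ := z
  obtain ⟨pU, pX, pW, pYX, pV, pqW, pqY, pout⟩ := D.pos_of_law_pos h
  have hid : marg D.law id = D.law := marg_id D.law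
  rw [hid, marg_law_UXYV]
  simp only [marg_law_WX, marg_law_X, postUYV, post, target, id]
  simp only [rvW, rvX, rvU, rvY, rvV, law_apply]
  rw [Real.log_div (by positivity) (by positivity), Real.log_mul, Real.log_mul, Real.log_mul,
    Real.log_div, Real.log_mul, Real.log_mul, Real.log_mul, Real.log_mul, Real.log_mul, Real.log_mul]
  · ring
  all_goals positivity

theorem rateU_nonneg : 0 ≤ D.rateU := by
  rw [rateU_eq, sub_nonneg]
  exact ent_pair_le D.law_mem _ _

theorem rateY_nonneg : 0 ≤ D.rateY := by
  rw [rateY_eq, sub_nonneg]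
  exact ent_pair_le D.law_mem _ _

theorem rateY_le : D.rateY ≤ shannon D.pX := by
  rw [shannon_pX, rateY_eq_sum, ent_eq, ← Finset.sum_neg_distrib]
  refine Finset.sum_le_sum fun z _ => ?_
  rcases (D.law_nonneg z).eq_or_lt with h | h
  · simp [← h]
  obtain ⟨u, x, w, y, v⟩ := z
  obtain ⟨pU, pX, pW, pYX, pV, pqW, pqY, pout⟩ := D.pos_of_law_pos h
  rw [← mul_neg, marg_law_X]
  refine mul_le_mul_of_nonneg_left ?_ h.le
  rw [← Real.log_inv]
  refine Real.log_le_log (by positivity) ?_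
  simp only [rvX]
  rw [div_le_iff₀ pqY, ← div_le_iff₀' (by positivity), div_inv_eq_mul, mul_comm]
  exact Finset.single_le_sum (f := fun x => D.pX x * D.pYX x y)
    (fun x _ => mul_nonneg (D.hX.1 _) ((D.hYX _).1 _)) (Finset.mem_univ x)

theorem ent_law_UX : ent D.law (fun z => (rvU z, rvX z)) = ent D.law rvU + ent D.law rvX := by
  rw [ent_eq, ent_eq, ent_eq, ← Finset.sum_neg_distrib, ← Finset.sum_neg_distrib,
    ← Finset.sum_neg_distrib, ← Finset.sum_add_distrib]
  refine Finset.sum_congr rfl fun z _ => ?_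
  rcases (D.law_nonneg z).eq_or_lt with h | h
  · simp [← h]
  obtain ⟨u, x, w, y, v⟩ := z
  obtain ⟨pU, pX, pW, pYX, pV, pqW, pqY, pout⟩ := D.pos_of_law_pos h
  simp only [marg_law_UX, marg_law_U, marg_law_X]
  simp only [rvU, rvX]
  rw [Real.log_mul pU.ne' pX.ne']
  ring

theorem rateU_le_rateUYV : D.rateU ≤ D.rateUYV := by
  have h := ent_submod D.law_nonneg (fun z => (rvY z, rvV z)) rvW (fun z => (rvU z, rvX z))
  rw [ent_law_UX,
    ent_congr D.law_nonneg (B := id) (fun ω ω' => by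
      simp only [rvU, rvX, rvY, rvV, rvW, Prod.ext_iff, id]; tauto),
    ent_congr D.law_nonneg (A := fun z => ((rvY z, rvV z), rvU z, rvX z))
      (B := fun z => (rvU z, rvX z, rvY z, rvV z)) (fun ω ω' => by
      simp only [Prod.ext_iff]; tauto),
    ent_congr D.law_nonneg (A := fun z => (rvW z, rvU z, rvX z))
      (B := fun z => ((rvW z, rvX z), rvU z)) (fun ω ω' => by
      simp only [Prod.ext_iff]; tauto)] at h
  rw [rateU_eq, rateUYV_eq]
  linarith

/-- `I(W;UXV|Y) + H(X|WY) = H(X) - I(X;Y) + I(W;UYV|X)`. -/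
theorem condMutualInfo_add_condEntropy :
    condMutualInfo D.law rvW (fun z => (rvU z, rvX z, rvV z)) rvY
      + condEntropy D.law rvX (fun z => (rvW z, rvY z))
      = (shannon D.pX - D.rateY + D.rateUYV) / Real.log 2 := by
  rw [condMutualInfo_eq D.law_nonneg, condEntropy_eq D.law_nonneg, shannon_pX, rateY_eq, rateUYV_eq,
    ent_congr D.law_nonneg (A := fun z => (rvW z, (rvU z, rvX z, rvV z), rvY z)) (B := id)
      (fun ω ω' => by simp only [rvU, rvX, rvY, rvV, rvW, Prod.ext_iff, id]; tauto),
    ent_congr D.law_nonneg (A := fun z => ((rvU z, rvX z, rvV z), rvY z))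
      (B := fun z => (rvU z, rvX z, rvY z, rvV z)) (fun ω ω' => by simp only [Prod.ext_iff]; tauto),
    ent_congr D.law_nonneg (A := fun z => (rvX z, rvW z, rvY z))
      (B := fun z => ((rvW z, rvX z), rvY z)) (fun ω ω' => by simp only [Prod.ext_iff]; tauto)]
  ring

theorem mutualInfo_law_U : mutualInfo D.law (fun z => (rvW z, rvX z)) rvU = D.rateU / Real.log 2 := by
  rw [mutualInfo_eq D.law_nonneg, rateU_eq]

theorem mutualInfo_law_Y : mutualInfo D.law (fun z => (rvW z, rvX z)) rvY = D.rateY / Real.log 2 := by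
  rw [mutualInfo_eq D.law_nonneg, rateY_eq]

end AuxData

/-! ### Block codes with vanishing errors -/

namespace AuxData

variable {𝒰 𝒳 𝒴 𝒱 𝒲 : Type*} [Fintype 𝒰] [Fintype 𝒳] [Fintype 𝒴] [Fintype 𝒱] [Fintype 𝒲]
  (D : AuxData 𝒰 𝒳 𝒴 𝒱 𝒲)

/-- The mean error of covering the source block by a random satellite codebook indexed by `J`, for the
input sequence `x`. -/
def errU (J : Type*) [Fintype J] [DecidableEq J] {N : ℕ} (x : Fin N → 𝒳) : ℝ :=
  ∑ w : J → Fin N → 𝒲, iid (prodLaw fun i => D.qW (x i)) w *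
    tv (fun u => 1 / (Fintype.card J : ℝ) * ∑ j, D.blockPost x (w j) u) (iid D.pU)

theorem sum_iid_mul_errU_nonneg (J : Type*) [Fintype J] [DecidableEq J] (N : ℕ) :
    0 ≤ ∑ x : Fin N → 𝒳, iid D.pX x * D.errU J x := by
  refine Finset.sum_nonneg fun x _ => mul_nonneg ((iid_mem D.hX).1 _) ?_
  refine Finset.sum_nonneg fun w _ => mul_nonneg ((iid_mem (prodLaw_mem ?_)).1 _) (tv_nonneg _ _)
  exact fun i => D.qW_kernel _

/-- Soft covering of the source block, averaged over the input sequence. -/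
theorem sum_iid_mul_errU_le (J : Type*) [Fintype J] [DecidableEq J] [Nonempty J] (N : ℕ) (c : ℝ) :
    ∑ x : Fin N → 𝒳, iid D.pX x * D.errU J x ≤
      2 * ∑ x : Fin N → 𝒳, iid D.pX x * D.badU c x + √(Real.exp (N * c) / Fintype.card J) := by
  have h : ∀ x : Fin N → 𝒳, D.errU J x
      ≤ 2 * D.badU c x + √(Real.exp (N * c) / Fintype.card J) := by
    intro x
    refine soft_covering (prodLaw_mem fun _ => D.qW_kernel _) (T := D.blockPost x)
      (fun a b => Finset.prod_nonneg fun i _ => D.post_nonneg _ _ _) (fun b => ?_)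
      (iid_mem D.hU).2.le (Real.exp_pos _).le
    simp only [prodLaw, blockPost, ← Finset.prod_mul_distrib, iid]
    rw [sum_prod_pi (fun i a => D.qW (x i) a * D.post (x i) a (b i))]
    simp only [D.sum_qW_mul_post]
  refine (Finset.sum_le_sum fun x _ => mul_le_mul_of_nonneg_left (h x)
    ((iid_mem D.hX).1 x)).trans (le_of_eq ?_)
  simp only [mul_add, Finset.sum_add_distrib, ← Finset.sum_mul, (iid_mem D.hX).2, one_mul,
    Finset.mul_sum]
  congr 1
  exact Finset.sum_congr rfl fun x _ => by ring

/-- If `I(W;U|X) = 0`, then `U` is independent of `(X, W)`. -/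
theorem post_eq_of_rateU_eq_zero (h : D.rateU = 0) {x : 𝒳} {w : 𝒲} (hx : 0 < D.pX x)
    (hw : 0 < D.qW x w) (u : 𝒰) : D.post x w u = D.pU u := by
  have key : ∀ x w u, D.pX x * D.qW x w * (D.pU u * InformationTheory.klFun (D.pW (u, x) w / D.qW x w))
      = D.pX x * D.qW x w * D.post x w u * Real.log (D.post x w u / D.pU u)
        + (D.pX x * D.qW x w * D.pU u - D.pX x * (D.qW x w * D.post x w u)) := by
    intro x w u
    rcases (D.hU.1 u).eq_or_lt with h0 | h0
    · simp [post, ← h0]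
    · rw [InformationTheory.klFun, post, mul_div_cancel_left₀ _ h0.ne']
      ring
  have hsum : ∑ x, ∑ w, ∑ u, D.pX x * D.qW x w *
      (D.pU u * InformationTheory.klFun (D.pW (u, x) w / D.qW x w)) = 0 := by
    have h1 : ∀ x, ∑ w, ∑ u, D.pX x * (D.qW x w * D.post x w u) = D.pX x := by
      intro x
      rw [Finset.sum_comm]
      simp only [← Finset.mul_sum, sum_qW_mul_post, D.hU.2, mul_one]
    simp only [key, Finset.sum_add_distrib, Finset.sum_sub_distrib, h1]
    simp only [← Finset.mul_sum, D.hU.2, mul_one, (D.qW_kernel _).2, sub_self, add_zero]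
    exact h
  have hn : ∀ x w u, 0 ≤ D.pX x * D.qW x w *
      (D.pU u * InformationTheory.klFun (D.pW (u, x) w / D.qW x w)) := fun x w u =>
    mul_nonneg (mul_nonneg (D.hX.1 _) ((D.qW_kernel _).1 _)) (mul_nonneg (D.hU.1 _)
      (InformationTheory.klFun_nonneg (div_nonneg ((D.hW _).1 _) ((D.qW_kernel _).1 _))))
  have h2 := (Finset.sum_eq_zero_iff_of_nonneg fun x _ => Finset.sum_nonneg fun w _ =>
    Finset.sum_nonneg fun u _ => hn x w u).1 hsum x (Finset.mem_univ x)
  have h3 := (Finset.sum_eq_zero_iff_of_nonneg fun w _ =>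
    Finset.sum_nonneg fun u _ => hn x w u).1 h2 w (Finset.mem_univ w)
  have h4 := (Finset.sum_eq_zero_iff_of_nonneg fun u _ => hn x w u).1 h3 u (Finset.mem_univ u)
  rcases (D.hU.1 u).eq_or_lt with h0 | h0
  · simp [post, ← h0]
  · have h5 := (mul_eq_zero.1 ((mul_eq_zero.1 h4).resolve_left (mul_pos hx hw).ne')).resolve_left h0.ne'
    rw [InformationTheory.klFun_eq_zero_iff (div_nonneg ((D.hW _).1 _) ((D.qW_kernel _).1 _))] at h5
    rw [post, h5, mul_one]

/-- If `I(W;U|X) = 0`, then a single satellite covers the source. -/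
theorem sum_iid_mul_errU_eq_zero (h : D.rateU = 0) (J : Type*) [Fintype J] [DecidableEq J] [Nonempty J]
    (N : ℕ) : ∑ x : Fin N → 𝒳, iid D.pX x * D.errU J x = 0 := by
  have hc : (Fintype.card J : ℝ) ≠ 0 := by exact_mod_cast Fintype.card_ne_zero
  refine Finset.sum_eq_zero fun x _ => ?_
  by_cases hx : iid D.pX x = 0
  · rw [hx, zero_mul]
  rw [errU, mul_eq_zero_of_right]
  refine Finset.sum_eq_zero fun w _ => ?_
  by_cases hw : iid (prodLaw fun i => D.qW (x i)) w = 0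
  · rw [hw, zero_mul]
  have hp : ∀ j u, D.blockPost x (w j) u = iid D.pU u := by
    intro j u
    refine Finset.prod_congr rfl fun i _ => D.post_eq_of_rateU_eq_zero h ?_ ?_ _
    · exact (D.hX.1 _).lt_of_ne' (Finset.prod_ne_zero_iff.1 hx i (Finset.mem_univ i))
    · exact ((D.qW_kernel _).1 _).lt_of_ne' (Finset.prod_ne_zero_iff.1
        (Finset.prod_ne_zero_iff.1 hw j (Finset.mem_univ j)) i (Finset.mem_univ i))
  have : (fun u => 1 / (Fintype.card J : ℝ) * ∑ j, D.blockPost x (w j) u) = iid D.pU := by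
    funext u
    simp only [hp, Finset.sum_const, Finset.card_univ, nsmul_eq_mul]
    field_simp
  rw [this, tv_self, mul_zero]

/-- The size of a codebook of rate `a`, minus one. -/
def size (a : ℝ) (N : ℕ) : ℕ := ⌊Real.exp (N * a)⌋₊

theorem exp_le_size (a : ℝ) (N : ℕ) : Real.exp (N * a) ≤ size a N + 1 := (Nat.lt_floor_add_one _).le

theorem size_le {a : ℝ} (ha : 0 ≤ a) (N : ℕ) : (size a N + 1 : ℝ) ≤ 2 * Real.exp (N * a) := by
  have h1 : (size a N : ℝ) ≤ Real.exp (N * a) := Nat.floor_le (Real.exp_pos _).le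
  have h2 : 1 ≤ Real.exp (N * a) := Real.one_le_exp (by positivity)
  linarith

theorem tendsto_exp_neg {δ : ℝ} (hδ : 0 < δ) :
    Tendsto (fun N : ℕ => Real.exp (-(N * δ))) atTop (𝓝 0) :=
  Real.tendsto_exp_neg_atTop_nhds_zero.comp
    (tendsto_natCast_atTop_atTop.atTop_mul_const hδ)

/-- Block codes exist as soon as their sizes leave a gap `δ` to the covering and packing rates. -/
theorem eventually_exists_blockCode_of_size {j l k k' : ℕ → ℕ} {c₁ c₂ c₃ δ η : ℝ} (hη : 0 < η)
    (hδ : 0 < δ) (h₁ : D.rateUYV < c₁) (h₂ : shannon D.pX < c₂) (h₃ : c₃ < D.rateY)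
    (s₁ : ∀ N : ℕ, Real.exp (N * (c₁ + δ)) ≤ (k' N + 1) * (j N + 1))
    (s₂ : ∀ N : ℕ, Real.exp (N * (c₂ + δ)) ≤ (j N + 1) * (l N + 1) * (k N + 1))
    (s₃ : ∀ N : ℕ, ((j N + 1) * (l N + 1) - 1 : ℝ) ≤ 4 * Real.exp (N * (c₃ - δ)))
    (hU : Tendsto (fun N => ∑ x : Fin N → 𝒳, iid D.pX x * D.errU (Fin (j N + 1)) x) atTop (𝓝 0)) :
    ∀ᶠ N : ℕ in atTop, ∃ C : BlockCode (Fin N → 𝒰) (Fin N → 𝒳) (Fin N → 𝒴) (Fin N → 𝒲)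
        (Fin (j N + 1)) (Fin (l N + 1)) (Fin (k N + 1)) (Fin (k' N + 1)),
      tv (C.out (iid D.pU) (D.blockYX N) (D.blockV N)) (D.blockTarget N) ≤ η ∧
        C.err (iid D.pU) (D.blockYX N) ≤ η := by
  have t₁ := tendsto_covering D.hX D.qW_kernel D.postUYV_nonneg D.sum_qW_mul_postUYV
    (fun x => (D.outUYV_kernel x).2) h₁
  have t₂ := tendsto_source D.hX h₂
  have t₃ := tendsto_packing D.hX D.hYX (fun _ => rfl) h₃
  have te := tendsto_exp_neg hδ
  have ts : Tendsto (fun N : ℕ => √(Real.exp (-(N * δ)))) atTop (𝓝 0) := by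
    simpa using te.sqrt
  have lim := (((((t₁.const_mul 2).add ts).add hU).add ((t₂.const_mul 2).add ts))).add
    (t₃.add (te.const_mul 4))
  simp only [mul_zero, add_zero] at lim
  filter_upwards [lim.eventually_le_const hη] with N hN
  obtain ⟨C, hC⟩ := exists_blockCode D (N := N) (J := Fin (j N + 1)) (L := Fin (l N + 1))
    (K := Fin (k N + 1)) (K' := Fin (k' N + 1)) c₁ c₂ c₃ (e₂ := D.errU (Fin (j N + 1)))
    (fun x => le_rfl)
  have hsqrt : ∀ {c S : ℝ}, Real.exp (N * (c + δ)) ≤ S →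
      √(Real.exp (N * c) / S) ≤ √(Real.exp (-(N * δ))) := by
    intro c S hS
    refine Real.sqrt_le_sqrt ?_
    rw [div_le_iff₀ ((Real.exp_pos _).trans_le hS)]
    calc Real.exp (N * c) = Real.exp (-(N * δ)) * Real.exp (N * (c + δ)) := by
          rw [← Real.exp_add]; ring_nf
      _ ≤ _ := mul_le_mul_of_nonneg_left hS (Real.exp_pos _).le
  have b₁ := hsqrt (c := c₁) (S := (Fintype.card (Fin (k' N + 1) × Fin (j N + 1)) : ℝ))
    (by simpa using s₁ N)
  have b₂ := hsqrt (c := c₂)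
    (S := (Fintype.card ((Fin (j N + 1) × Fin (l N + 1)) × Fin (k N + 1)) : ℝ))
    (by simpa using s₂ N)
  have b₃ : ((Fintype.card (Fin (j N + 1) × Fin (l N + 1)) : ℝ) - 1) / Real.exp (N * c₃)
      ≤ 4 * Real.exp (-(N * δ)) := by
    rw [div_le_iff₀ (Real.exp_pos _), mul_assoc, ← Real.exp_add,
      show -(N * δ) + N * c₃ = N * (c₃ - δ) by ring]
    simpa using s₃ N
  have hsum : ∑ x : Fin N → 𝒳, iid D.pX x * (2 * D.badUYV c₁ x
        + √(Real.exp (N * c₁) / Fintype.card (Fin (k' N + 1) × Fin (j N + 1)))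
        + D.errU (Fin (j N + 1)) x)
      = 2 * ∑ x : Fin N → 𝒳, iid D.pX x * D.badUYV c₁ x
        + √(Real.exp (N * c₁) / Fintype.card (Fin (k' N + 1) × Fin (j N + 1)))
        + ∑ x : Fin N → 𝒳, iid D.pX x * D.errU (Fin (j N + 1)) x := by
    simp only [mul_add, Finset.sum_add_distrib, ← Finset.sum_mul, (iid_mem D.hX).2, one_mul]
    congr 2
    rw [Finset.mul_sum]
    exact Finset.sum_congr rfl fun x _ => by ring
  rw [hsum] at hC
  have hle := hC.trans ((add_le_add (add_le_add (add_le_add_left (add_le_add_right b₁ _) _)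
    (add_le_add_right b₂ _)) (add_le_add_right b₃ _)).trans hN)
  have n₁ := tv_nonneg (C.out (iid D.pU) (D.blockYX N) (D.blockV N)) (D.blockTarget N)
  have n₂ := BlockCode.err_nonneg C (iid_mem D.hU) (D.blockYX_kernel N)
  exact ⟨C, by linarith, by linarith⟩

/-- If `I(WX;U) < I(WX;Y)`, or both vanish, then there are block codes with small errors whose rate of
common randomness is close to `H(X) - I(X;Y) + I(W;UYV|X)`. -/
theorem eventually_exists_blockCode (hI : D.rateU < D.rateY ∨ D.rateU = 0 ∧ D.rateY = 0) {r η : ℝ}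
    (hr : shannon D.pX - D.rateY + D.rateUYV < r) (hη : 0 < η) :
    ∀ᶠ N : ℕ in atTop, ∃ j l k k' : ℕ,
      ((j + 1) * (k + 1) * (k' + 1) : ℝ) ≤ Real.exp (N * r) ∧
      ∃ C : BlockCode (Fin N → 𝒰) (Fin N → 𝒳) (Fin N → 𝒴) (Fin N → 𝒲)
        (Fin (j + 1)) (Fin (l + 1)) (Fin (k + 1)) (Fin (k' + 1)),
      tv (C.out (iid D.pU) (D.blockYX N) (D.blockV N)) (D.blockTarget N) ≤ η ∧
        C.err (iid D.pU) (D.blockYX N) ≤ η := by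
  have hXY := D.rateY_le
  have hU0 := D.rateU_nonneg
  have hUV := D.rateU_le_rateUYV
  set g := r - (shannon D.pX - D.rateY + D.rateUYV) with hg
  have hg0 : 0 < g := sub_pos.2 hr
  have hlarge : ∀ ε : ℝ, 0 < ε → ∀ᶠ N : ℕ in atTop, (8 : ℝ) ≤ Real.exp (N * ε) := fun ε hε =>
    (Real.tendsto_exp_atTop.comp
      (tendsto_natCast_atTop_atTop.atTop_mul_const hε)).eventually_ge_atTop 8
  have hsize : ∀ {a b c : ℝ} (N : ℕ), 0 ≤ a → 0 ≤ b → 0 ≤ c → ∀ s : ℝ, a + b + c + s ≤ r →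
      (8 : ℝ) ≤ Real.exp (N * s) →
      ((size a N + 1) * (size b N + 1) * (size c N + 1) : ℝ) ≤ Real.exp (N * r) := by
    intro a b c N ha hb hc s hs h8
    have h1 := size_le ha N
    have h2 := size_le hb N
    have h3 := size_le hc N
    calc ((size a N + 1) * (size b N + 1) * (size c N + 1) : ℝ)
        ≤ (2 * Real.exp (N * a)) * (2 * Real.exp (N * b)) * (2 * Real.exp (N * c)) := by gcongr
      _ = 8 * Real.exp (N * (a + b + c)) := by
          rw [mul_add, mul_add, Real.exp_add, Real.exp_add]; ring
      _ ≤ Real.exp (N * s) * Real.exp (N * (a + b + c)) := by gcongr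
      _ = Real.exp (N * (a + b + c + s)) := by rw [← Real.exp_add]; ring_nf
      _ ≤ _ := Real.exp_le_exp.2 (by gcongr)
  rcases hI with hI | ⟨hU, hY⟩
  -- The satellite index has rate `I(W;U|X) + 2δ`, enough to cover `U`; local randomness fills up the
  -- message to the rate `I(X;Y) - 3δ`, which the channel supports; the rest of the input index, of
  -- rate `H(X) - I(X;Y) + 5δ`, and of the satellite index, of rate `I(W;YV|UX)`, are common.
  · obtain ⟨δ, hδ, hδ1, hδ2⟩ : ∃ δ : ℝ, 0 < δ ∧ 5 * δ ≤ D.rateY - D.rateU ∧ 8 * δ ≤ g := by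
      refine ⟨min ((D.rateY - D.rateU) / 5) (g / 8), lt_min (by linarith) (by linarith), ?_, ?_⟩
      · linarith [min_le_left ((D.rateY - D.rateU) / 5) (g / 8)]
      · linarith [min_le_right ((D.rateY - D.rateU) / 5) (g / 8)]
    have hlim : Tendsto (fun N => ∑ x : Fin N → 𝒳, iid D.pX x *
        D.errU (Fin (size (D.rateU + 2 * δ) N + 1)) x) atTop (𝓝 0) := by
      have t := tendsto_covering D.hX D.qW_kernel D.post_nonneg D.sum_qW_mul_post
        (fun _ => D.hU.2) (c := D.rateU + δ) (lt_add_of_pos_right _ hδ)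
      have ts : Tendsto (fun N : ℕ => √(Real.exp (-(N * δ)))) atTop (𝓝 0) := by
        simpa using (tendsto_exp_neg hδ).sqrt
      have lim := (t.const_mul 2).add ts
      simp only [mul_zero, add_zero] at lim
      refine squeeze_zero (fun N => D.sum_iid_mul_errU_nonneg _ N) (fun N => ?_) lim
      refine (D.sum_iid_mul_errU_le _ N (D.rateU + δ)).trans
        (add_le_add_right (Real.sqrt_le_sqrt ?_) _)
      have hs := exp_le_size (D.rateU + 2 * δ) N
      rw [Fintype.card_fin, Nat.cast_add_one, div_le_iff₀ ((Real.exp_pos _).trans_le hs)]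
      calc Real.exp (N * (D.rateU + δ)) = Real.exp (-(N * δ)) * Real.exp (N * (D.rateU + 2 * δ)) := by
            rw [← Real.exp_add]; ring_nf
        _ ≤ _ := mul_le_mul_of_nonneg_left hs (Real.exp_pos _).le
    have s₁ : ∀ N : ℕ, Real.exp (N * (D.rateUYV + δ + δ)) ≤
        (size (D.rateUYV - D.rateU) N + 1) * (size (D.rateU + 2 * δ) N + 1) := by
      intro N
      refine le_trans (le_of_eq ?_) (mul_le_mul (exp_le_size _ N) (exp_le_size _ N)
        (Real.exp_pos _).le (by positivity))
      rw [← Real.exp_add]; ring_nf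
    have s₂ : ∀ N : ℕ, Real.exp (N * (shannon D.pX + δ + δ)) ≤ (size (D.rateU + 2 * δ) N + 1) *
        (size (D.rateY - D.rateU - 5 * δ) N + 1) * (size (shannon D.pX - D.rateY + 5 * δ) N + 1) := by
      intro N
      refine le_trans (le_of_eq ?_) (mul_le_mul (mul_le_mul (exp_le_size _ N) (exp_le_size _ N)
        (Real.exp_pos _).le (by positivity)) (exp_le_size _ N) (Real.exp_pos _).le (by positivity))
      rw [← Real.exp_add, ← Real.exp_add]; ring_nf
    have s₃ : ∀ N : ℕ, ((size (D.rateU + 2 * δ) N + 1) * (size (D.rateY - D.rateU - 5 * δ) N + 1) - 1 : ℝ)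
        ≤ 4 * Real.exp (N * (D.rateY - 2 * δ - δ)) := by
      intro N
      have h1 := size_le (show 0 ≤ D.rateU + 2 * δ by linarith) N
      have h2 := size_le (show 0 ≤ D.rateY - D.rateU - 5 * δ by linarith) N
      have h3 := mul_le_mul h1 h2 (by positivity) (by positivity)
      have h4 : 2 * Real.exp (N * (D.rateU + 2 * δ)) * (2 * Real.exp (N * (D.rateY - D.rateU - 5 * δ)))
          = 4 * Real.exp (N * (D.rateY - 2 * δ - δ)) := by
        rw [show (N : ℝ) * (D.rateY - 2 * δ - δ)
          = N * (D.rateU + 2 * δ) + N * (D.rateY - D.rateU - 5 * δ) by ring, Real.exp_add]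
        ring
      linarith
    have hev := D.eventually_exists_blockCode_of_size
      (j := size (D.rateU + 2 * δ)) (l := size (D.rateY - D.rateU - 5 * δ))
      (k := size (shannon D.pX - D.rateY + 5 * δ)) (k' := size (D.rateUYV - D.rateU))
      (c₁ := D.rateUYV + δ) (c₂ := shannon D.pX + δ) (c₃ := D.rateY - 2 * δ) hη hδ (by linarith)
      (by linarith) (by linarith) s₁ s₂ s₃ hlim
    filter_upwards [hlarge δ hδ, hev] with N h8 ⟨C, hC⟩
    exact ⟨_, _, _, _, hsize N (by linarith) (by linarith) (by linarith) δ (by linarith) h8, C, hC⟩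
  -- Without a message there is nothing to decode: `J` and `L` are trivial, the packing error is zero
  -- for every threshold, and `c₃ = -1` is an arbitrary choice below `I(X;Y) = 0`.
  · set δ := g / 5 with hδ'
    have hδ : 0 < δ := by positivity
    have hlim : Tendsto (fun N => ∑ x : Fin N → 𝒳, iid D.pX x * D.errU (Fin (0 + 1)) x)
        atTop (𝓝 0) := by
      simp only [D.sum_iid_mul_errU_eq_zero hU]
      exact tendsto_const_nhds
    have s₁ : ∀ N : ℕ, Real.exp (N * (D.rateUYV + δ + δ)) ≤
        (size (D.rateUYV + 2 * δ) N + 1) * (((0 : ℕ) : ℝ) + 1) := by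
      intro N
      have := exp_le_size (D.rateUYV + 2 * δ) N
      rw [show D.rateUYV + 2 * δ = D.rateUYV + δ + δ by ring] at this ⊢
      simpa using this
    have s₂ : ∀ N : ℕ, Real.exp (N * (shannon D.pX + δ + δ)) ≤ (((0 : ℕ) : ℝ) + 1) *
        (((0 : ℕ) : ℝ) + 1) * (size (shannon D.pX + 2 * δ) N + 1) := by
      intro N
      have := exp_le_size (shannon D.pX + 2 * δ) N
      rw [show shannon D.pX + 2 * δ = shannon D.pX + δ + δ by ring] at this ⊢
      simpa using this
    have s₃ : ∀ N : ℕ, ((((0 : ℕ) : ℝ) + 1) * (((0 : ℕ) : ℝ) + 1) - 1 : ℝ)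
        ≤ 4 * Real.exp (N * (-1 - δ)) := by
      intro N
      have := Real.exp_pos (N * (-1 - δ))
      push_cast
      linarith
    have hev := D.eventually_exists_blockCode_of_size
      (j := fun _ => 0) (l := fun _ => 0)
      (k := size (shannon D.pX + 2 * δ)) (k' := size (D.rateUYV + 2 * δ))
      (c₁ := D.rateUYV + δ) (c₂ := shannon D.pX + δ) (c₃ := -1) hη hδ (by linarith)
      (by linarith) (by linarith) s₁ s₂ s₃ hlim
    filter_upwards [hlarge δ hδ, hev] with N h8 ⟨C, hC⟩
    refine ⟨0, _, _, _, ?_, C, hC⟩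
    have := hsize (a := 0) N le_rfl (b := shannon D.pX + 2 * δ) (c := D.rateUYV + 2 * δ)
      (by linarith) (by linarith) δ (by linarith) h8
    refine le_trans ?_ this
    have h0 : (0 : ℝ) ≤ size 0 N := Nat.cast_nonneg _
    have hc : (((0 : ℕ) : ℝ) + 1) ≤ size 0 N + 1 := by simp
    gcongr

end AuxData

/-! ### Marginals of laws given by stochastic maps -/

/-- If a stochastic map depends on its input `a` only through `f a`, then the law of `f a` and of the
output is obtained by applying the map to the law of `f a`. -/
theorem marg_mul_comp {α α' β γ : Type*} [Fintype α] [Fintype α'] [Fintype β] (p : α → ℝ) (f : α → α')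
    (k : α' → β → ℝ) (h : α' × β → γ) :
    marg (fun z : α × β => p z.1 * k (f z.1) z.2) (fun z => h (f z.1, z.2))
      = marg (fun z : α' × β => marg p f z.1 * k z.1 z.2) h := by
  classical
  funext c
  have e : ∀ b, ∑ a, (if h (f a, b) = c then p a * k (f a) b else 0)
      = ∑ a', if h (a', b) = c then marg p f a' * k a' b else 0 := by
    intro b
    have := sum_marg_mul p f (fun a' => if h (a', b) = c then k a' b else 0)
    simpa only [mul_ite, mul_zero] using this.symm
  simp only [marg, Fintype.sum_prod_type_right] at e ⊢
  exact Finset.sum_congr rfl fun b _ => e b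

/-- Functions of independent random variables are independent. -/
theorem marg_prodLaw_map {ι α β : Type*} [Fintype ι] [DecidableEq ι] [Fintype α] (p : ι → α → ℝ)
    (f : ι → α → β) (b : ι → β) :
    marg (prodLaw p) (fun w i => f i (w i)) b = prodLaw (fun i => marg (p i) (f i)) b := by
  classical
  simp only [prodLaw, marg]
  rw [← sum_prod_pi (fun i a => if f i a = b i then p i a else 0)]
  refine Finset.sum_congr rfl fun w _ => ?_
  by_cases h : ∀ i, f i (w i) = b i
  · rw [if_pos (funext h)]
    exact Finset.prod_congr rfl fun i _ => by rw [if_pos (h i)]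
  · rw [if_neg (fun h' => h fun i => congrFun h' i)]
    push Not at h
    obtain ⟨i, hi⟩ := h
    exact (Finset.prod_eq_zero (Finset.mem_univ i) (by rw [if_neg hi])).symm

/-- Stochastic maps that agree off an event give laws at distance at most twice its probability. -/
theorem tv_mul_kernel_le {α β : Type*} [Fintype α] [Fintype β] {p : α → ℝ} (hp : ∀ a, 0 ≤ p a)
    {k k' : α → β → ℝ} (hk : IsKernel k) (hk' : IsKernel k') {E : α → Prop}
    (h : ∀ a, ¬ E a → k a = k' a) :
    tv (fun z : α × β => p z.1 * k z.1 z.2) (fun z => p z.1 * k' z.1 z.2) ≤ 2 * prob p E := by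
  classical
  have e : ∀ a, ∑ b, |p a * k a b - p a * k' a b| ≤ 2 * if E a then p a else 0 := by
    intro a
    by_cases ha : E a
    · simp only [← mul_sub, abs_mul, abs_of_nonneg (hp a), ← Finset.mul_sum, if_pos ha]
      rw [mul_comm 2]
      exact mul_le_mul_of_nonneg_left (tv_le_two (hk a) (hk' a)) (hp a)
    · simp [h a ha, ha]
  rw [tv, Fintype.sum_prod_type, prob, Finset.mul_sum]
  exact Finset.sum_le_sum fun a _ => e a

/-- The union bound. -/
theorem prob_iid_exists_le {ι α : Type*} [Fintype ι] [DecidableEq ι] [Fintype α] {p : α → ℝ}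
    (hp : p ∈ stdSimplex ℝ α) (E : α → Prop) :
    prob (iid p : (ι → α) → ℝ) (fun w => ∃ i, E (w i)) ≤ Fintype.card ι * prob p E := by
  classical
  have h1 : ∀ i : ι, ∑ w : ι → α, (if E (w i) then iid p w else 0) = prob p E := by
    intro i
    have := sum_prodLaw_apply (p := fun _ : ι => p) (fun _ => hp) i (fun a => if E a then 1 else 0)
    simpa [prob, iid_eq_prodLaw] using this
  calc prob (iid p : (ι → α) → ℝ) (fun w => ∃ i, E (w i))
      ≤ ∑ w : ι → α, ∑ i, if E (w i) then iid p w else 0 := by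
        refine Finset.sum_le_sum fun w _ => ?_
        have hn : ∀ i, 0 ≤ if E (w i) then iid p w else 0 := fun i => by
          split_ifs <;> simp [(iid_mem hp).1 w]
        split_ifs with h
        · obtain ⟨i, hi⟩ := h
          exact le_trans (by rw [if_pos hi]) (Finset.single_le_sum (fun i _ => hn i) (Finset.mem_univ i))
        · exact Finset.sum_nonneg fun i _ => hn i
    _ = _ := by
        rw [Finset.sum_comm]
        simp [h1]

/-! ### Sequential systems -/

section Scan

variable {S A R T : Type*}

/-- The state before time `b` of the system that maps the state, the input and the randomness to a
record, and the record to the next state. -/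
def scanState (step : S → A → R → T) (next : T → S) (s₀ : S) (u : ℕ → A) (r : ℕ → R) : ℕ → S
  | 0 => s₀
  | b + 1 => next (step (scanState step next s₀ u r b) (u b) (r b))

theorem scanState_congr (step : S → A → R → T) (next : T → S) (s₀ : S) {u u' : ℕ → A} {r r' : ℕ → R}
    {b : ℕ} (hu : ∀ i < b, u i = u' i) (hr : ∀ i < b, r i = r' i) :
    scanState step next s₀ u r b = scanState step next s₀ u' r' b := by
  induction b with
  | zero => rfl
  | succ b ih =>
    rw [scanState, scanState, ih (fun i hi => hu i (by omega)) (fun i hi => hr i (by omega)),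
      hu b (by omega), hr b (by omega)]

/-- A finite sequence, continued by an arbitrary value. -/
def extendFin [Nonempty A] {B : ℕ} (u : Fin B → A) (b : ℕ) : A :=
  if h : b < B then u ⟨b, h⟩ else Classical.arbitrary A

theorem extendFin_apply [Nonempty A] {B : ℕ} (u : Fin B → A) (b : Fin B) : extendFin u b = u b := by
  simp [extendFin]

variable [Nonempty A] [Nonempty R] {B : ℕ}

/-- The records of the system. -/
def scan (step : S → A → R → T) (next : T → S) (s₀ : S) (u : Fin B → A) (r : Fin B → R)
    (b : Fin B) : T :=
  step (scanState step next s₀ (extendFin u) (extendFin r) b) (u b) (r b)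

/-- The state before time `b`, from the records. -/
def stateOf (next : T → S) (s₀ : S) (τ : Fin B → T) (b : Fin B) : S :=
  if h : b.val = 0 then s₀ else next (τ ⟨b.val - 1, by omega⟩)

theorem stateOf_scan (step : S → A → R → T) (next : T → S) (s₀ : S) (u : Fin B → A) (r : Fin B → R)
    (b : Fin B) : stateOf next s₀ (scan step next s₀ u r) b
      = scanState step next s₀ (extendFin u) (extendFin r) b := by
  obtain ⟨b, hb⟩ := b
  cases b with
  | zero => rfl
  | succ b =>
    rw [stateOf, dif_neg (Nat.succ_ne_zero _), scanState, scan]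
    simp only [Nat.add_sub_cancel]
    rw [← extendFin_apply u, ← extendFin_apply r]

/-- A sequence of records is the one produced by the system if and only if it satisfies the recursion
with the states read off from the records themselves. -/
theorem scan_eq_iff (step : S → A → R → T) (next : T → S) (s₀ : S) (u : Fin B → A) (r : Fin B → R)
    (τ : Fin B → T) : scan step next s₀ u r = τ ↔
      ∀ b, step (stateOf next s₀ τ b) (u b) (r b) = τ b := by
  constructor
  · rintro rfl b
    rw [stateOf_scan, scan]
  · intro h
    have key : ∀ b (hb : b < B), scan step next s₀ u r ⟨b, hb⟩ = τ ⟨b, hb⟩ := by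
      intro b
      induction b with
      | zero =>
        intro hb
        rw [← h ⟨0, hb⟩]
        rfl
      | succ b ih =>
        intro hb
        rw [← h ⟨b + 1, hb⟩, scan, ← stateOf_scan step next s₀ u r ⟨b + 1, hb⟩]
        simp only [stateOf, Nat.add_sub_cancel, ih (by omega)]
    exact funext fun b => key b b.2

/-- If the law of the record does not depend on the state, then the records are independent given the
inputs. -/
theorem marg_scan [Fintype R] {w : R → ℝ} {step : S → A → R → T} {idx : A → T → ℝ}
    (h : ∀ s a, marg w (step s a) = idx a) (next : T → S) (s₀ : S) (u : Fin B → A) (τ : Fin B → T) :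
    marg (iid w) (fun r => scan step next s₀ u r) τ = ∏ b, idx (u b) (τ b) := by
  have h1 := marg_prodLaw_map (fun _ : Fin B => w)
    (fun b => step (stateOf next s₀ τ b) (u b)) τ
  simp only [h] at h1
  refine Eq.trans ?_ h1
  refine Finset.sum_congr rfl fun r _ => ?_
  have hiff := (scan_eq_iff step next s₀ u r τ).trans funext_iff.symm
  by_cases hr : scan step next s₀ u r = τ
  · rw [if_pos hr, if_pos (hiff.1 hr)]
    rfl
  · rw [if_neg hr, if_neg fun h => hr (hiff.2 h)]

end Scan

/-! ### Chaining block codes -/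

namespace BlockCode

section

variable {𝒰 𝒳 𝒴 𝒱 𝒲 J L K K' : Type*} [Fintype 𝒰] [Fintype 𝒳] [Fintype 𝒴] [Fintype 𝒱] [Fintype 𝒲]
  [AddCommGroup J] [Fintype J] [Fintype L] [Fintype K] [Fintype K'] [Nonempty L] [Nonempty K]
  [Nonempty K'] [DecidableEq J] [DecidableEq L] [DecidableEq K] [DecidableEq K'] [DecidableEq 𝒰]

/-- The common randomness `(pad, k, k')` of a block; the pad masks the satellite index of the previous
block. -/
abbrev Common (J K K' : Type*) := J × K × K'

/-- The local randomness `(ℓ, σ)` of a block; `σ` gives the satellite index in every situation. -/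
abbrev Local (𝒰 J L K K' : Type*) := L × (((J × L) × K) × K' × 𝒰 → J)

/-- The indices `(a, k', j)` used in a block. -/
abbrev Record (J L K K' : Type*) := ((J × L) × K) × K' × J

variable (C : BlockCode 𝒰 𝒳 𝒴 𝒲 J L K K')

/-- The law of the local randomness. -/
def localLaw (t : Local 𝒰 J L K K') : ℝ :=
  1 / (Fintype.card L : ℝ) * prodLaw (fun c : ((J × L) × K) × K' × 𝒰 => C.κ c.1 c.2.1 c.2.2) t.2

/-- The law of the randomness of a block. -/
def randLaw (r : Common J K K' × Local 𝒰 J L K K') : ℝ :=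
  1 / (Fintype.card (Common J K K') : ℝ) * C.localLaw r.2

/-- The index of the input codeword, for the satellite index `s` of the previous block. -/
def inputIndex (s : J) (r : Common J K K' × Local 𝒰 J L K K') : (J × L) × K :=
  ((s + r.1.1, r.2.1), r.1.2.1)

/-- The indices of a block, for the satellite index `s` of the previous block. -/
def step (s : J) (u : 𝒰) (r : Common J K K' × Local 𝒰 J L K K') : Record J L K K' :=
  (inputIndex s r, r.1.2.2, r.2.2 (inputIndex s r, r.1.2.2, u))

theorem localLaw_mem : C.localLaw ∈ stdSimplex ℝ (Local 𝒰 J L K K') := by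
  have h := prodLaw_mem (p := fun c : ((J × L) × K) × K' × 𝒰 => C.κ c.1 c.2.1 c.2.2)
    fun c => C.κ_kernel _ _ _
  refine ⟨fun t => mul_nonneg (by positivity) (h.1 _), ?_⟩
  simp only [localLaw, Fintype.sum_prod_type, ← Finset.mul_sum, h.2]
  simp

theorem randLaw_mem : C.randLaw ∈ stdSimplex ℝ (Common J K K' × Local 𝒰 J L K K') := by
  have : Nonempty J := ⟨0⟩
  refine ⟨fun t => mul_nonneg (by positivity) (C.localLaw_mem.1 _), ?_⟩
  rw [Fintype.sum_prod_type]
  simp only [randLaw, ← Finset.mul_sum, C.localLaw_mem.2]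
  rw [Finset.sum_const, Finset.card_univ, nsmul_eq_mul, mul_one, one_div_mul_cancel]
  exact_mod_cast Fintype.card_ne_zero

/-- The pad makes the indices of a block independent of the previous block. -/
theorem marg_step (s : J) (u : 𝒰) : marg C.randLaw (step s u) = C.index u := by
  classical
  funext ⟨⟨⟨m, ℓ⟩, k⟩, k', j⟩
  have hσ := sum_prodLaw_apply (p := fun c : ((J × L) × K) × K' × 𝒰 => C.κ c.1 c.2.1 c.2.2)
    (fun c => C.κ_kernel _ _ _) (((m, ℓ), k), k', u) (fun j' => if j' = j then 1 else 0)
  simp only [mul_ite, mul_one, mul_zero, Finset.sum_ite_eq', Finset.mem_univ, if_true] at hσ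
  rw [marg, Fintype.sum_prod_type, Finset.sum_eq_single ((m - s, k, k') : Common J K K'),
    Fintype.sum_prod_type, Finset.sum_eq_single ℓ]
  · trans ∑ σ : ((J × L) × K) × K' × 𝒰 → J,
        1 / (Fintype.card (Common J K K') : ℝ) * (1 / (Fintype.card L : ℝ)) *
          if σ (((m, ℓ), k), k', u) = j then
            prodLaw (fun c : ((J × L) × K) × K' × 𝒰 => C.κ c.1 c.2.1 c.2.2) σ else 0
    · refine Finset.sum_congr rfl fun σ _ => ?_
      simp only [step, inputIndex, add_sub_cancel, Prod.mk.injEq, true_and, randLaw, localLaw]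
      split_ifs <;> simp [mul_assoc]
    rw [← Finset.mul_sum, hσ]
    simp only [index, Common, Fintype.card_prod]
    push_cast
    field_simp
  · intro ℓ' _ hℓ
    refine Finset.sum_eq_zero fun σ _ => if_neg fun h => hℓ ?_
    simp only [step, inputIndex, Prod.mk.injEq] at h
    exact h.1.1.2
  · simp
  · rintro ⟨p, k₁, k₂⟩ _ hne
    refine Finset.sum_eq_zero fun t _ => if_neg fun h => hne ?_
    simp only [step, inputIndex, Prod.mk.injEq] at h
    obtain ⟨⟨⟨h1, -⟩, h2⟩, h3, -⟩ := h
    rw [← h1, h2, h3, add_sub_cancel_left]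
  · simp

variable [Nonempty 𝒰] {B : ℕ}

instance : Nonempty (Common J K K' × Local 𝒰 J L K K') :=
  ⟨((0, Classical.arbitrary K, Classical.arbitrary K'), Classical.arbitrary L, fun _ => 0)⟩

/-- The indices of all blocks. -/
def records (u : Fin B → 𝒰) (r : Fin B → Common J K K' × Local 𝒰 J L K K') :
    Fin B → Record J L K K' :=
  scan step (fun τ : Record J L K K' => τ.2.2) 0 u r

/-- The common randomness can be read off from the indices. -/
def commonOf (τ : Fin B → Record J L K K') (b : Fin B) : Common J K K' :=
  ((τ b).1.1.1 - stateOf (fun τ : Record J L K K' => τ.2.2) 0 τ b, (τ b).1.2, (τ b).2.1)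

theorem commonOf_records (u : Fin B → 𝒰) (r : Fin B → Common J K K' × Local 𝒰 J L K K') (b : Fin B) :
    commonOf (records u r) b = (r b).1 := by
  rw [commonOf, records, stateOf_scan]
  simp only [scan, step, inputIndex, add_sub_cancel_left]

/-- The satellite codeword of block `b` chosen by the decoder: the message of the block is decoded from
its own output, and its satellite index from the output of the next block. -/
def decW (y : Fin (B + 1) → 𝒴) (ρ : Fin (B + 1) → Common J K K') (b : Fin B) : 𝒲 :=
  C.w (C.dec (y b.castSucc, (ρ b.castSucc).2.1), (ρ b.castSucc).2.1)
    ((ρ b.castSucc).2.2, (C.dec (y b.succ, (ρ b.succ).2.1)).1 - (ρ b.succ).1)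

/-- The decoder finds the satellite codewords if it decodes all messages: the message of the next block,
unmasked by its pad, is the satellite index of the block. -/
theorem decW_eq {y : Fin (B + 1) → 𝒴} {τ : Fin (B + 1) → Record J L K K'}
    (h : ∀ b, C.dec (y b, (τ b).1.2) = (τ b).1.1) (b : Fin B) :
    C.decW y (commonOf τ) b = C.w (τ b.castSucc).1 (τ b.castSucc).2 := by
  have h1 : stateOf (fun τ : Record J L K K' => τ.2.2) 0 τ b.succ = (τ b.castSucc).2.2 := by
    rw [stateOf, dif_neg (by simp)]
    rfl
  simp only [decW, commonOf, h, h1, sub_sub_cancel]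

/-- The law of the randomness, the source blocks, the output blocks and the blocks of `V` of a chain of
`B + 1` block codes; `V` is only generated for the first `B` blocks. -/
def chainLaw (pU : 𝒰 → ℝ) (pYX : 𝒳 → 𝒴 → ℝ) (pV : 𝒲 × 𝒴 → 𝒱 → ℝ)
    (z : ((Fin (B + 1) → Common J K K' × Local 𝒰 J L K K') × (Fin (B + 1) → 𝒰)) ×
      ((Fin (B + 1) → 𝒴) × (Fin B → 𝒱))) : ℝ :=
  (iid C.randLaw z.1.1 * iid pU z.1.2) *
    (prodLaw (fun b => pYX (C.x (records z.1.2 z.1.1 b).1)) z.2.1 *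
      prodLaw (fun b => pV (C.decW z.2.1 (fun b => (z.1.1 b).1) b, z.2.1 b.castSucc)) z.2.2)

/-- The blocks of `(U, X, Y, V)`. -/
def chainOut (z : ((Fin (B + 1) → Common J K K' × Local 𝒰 J L K K') × (Fin (B + 1) → 𝒰)) ×
      ((Fin (B + 1) → 𝒴) × (Fin B → 𝒱))) (b : Fin B) : 𝒰 × 𝒳 × 𝒴 × 𝒱 :=
  (z.1.2 b.castSucc, C.x (records z.1.2 z.1.1 b.castSucc).1, z.2.1 b.castSucc, z.2.2 b)

theorem pre_mem {pU : 𝒰 → ℝ} (hU : pU ∈ stdSimplex ℝ 𝒰) {pYX : 𝒳 → 𝒴 → ℝ} (hYX : IsKernel pYX) :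
    C.pre pU pYX ∈ stdSimplex ℝ ((Record J L K K' × 𝒰) × 𝒴) := by
  have : Nonempty J := ⟨0⟩
  refine ⟨fun z => ?_, ?_⟩
  · have := (C.κ_kernel z.1.1.1 z.1.1.2.1 z.1.2).1 z.1.1.2.2
    have := hU.1 z.1.2
    have := (hYX (C.x z.1.1.1)).1 z.2
    simp only [pre, index]
    positivity
  · have h1 : ∀ u, ∑ τ, C.index u τ = 1 := by
      intro u
      rw [← C.marg_step 0 u, sum_marg, C.randLaw_mem.2]
    rw [Fintype.sum_prod_type]
    simp only [pre, ← Finset.mul_sum, (hYX _).2, mul_one]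
    rw [Fintype.sum_prod_type_right]
    simp only [← Finset.sum_mul, h1, one_mul, hU.2]

set_option synthInstance.maxSize 1000 in
/-- The chain produces an i.i.d. sequence of blocks up to the decoding errors. -/
theorem tv_chain_le {pU : 𝒰 → ℝ} (hU : pU ∈ stdSimplex ℝ 𝒰) {pYX : 𝒳 → 𝒴 → ℝ} (hYX : IsKernel pYX)
    {pV : 𝒲 × 𝒴 → 𝒱 → ℝ} (hV : IsKernel pV) :
    tv (marg (C.chainLaw pU pYX pV) C.chainOut : (Fin B → 𝒰 × 𝒳 × 𝒴 × 𝒱) → ℝ)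
      (iid (C.out pU pYX pV)) ≤ 2 * ((B + 1) * C.err pU pYX) := by
  have hpre := C.pre_mem hU hYX
  -- the law of the blocks of `(records, source, output)`
  let Z := (Record J L K K' × 𝒰) × 𝒴
  let kreal : (Fin (B + 1) → Z) → (Fin B → 𝒱) → ℝ := fun z => prodLaw fun b =>
    pV (C.decW (fun b => (z b).2) (commonOf fun b => (z b).1.1) b, (z b.castSucc).2)
  let kideal : (Fin (B + 1) → Z) → (Fin B → 𝒱) → ℝ := fun z => prodLaw fun b =>
    pV (C.w (z b.castSucc).1.1.1 (z b.castSucc).1.1.2, (z b.castSucc).2)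
  let real : (Fin (B + 1) → Z) × (Fin B → 𝒱) → ℝ := fun z => iid (C.pre pU pYX) z.1 * kreal z.1 z.2
  let ideal : (Fin (B + 1) → Z) × (Fin B → 𝒱) → ℝ := fun z => iid (C.pre pU pYX) z.1 * kideal z.1 z.2
  let out : (Fin (B + 1) → Z) × (Fin B → 𝒱) → Fin B → 𝒰 × 𝒳 × 𝒴 × 𝒱 := fun z b =>
    ((z.1 b.castSucc).1.2, C.x (z.1 b.castSucc).1.1.1, (z.1 b.castSucc).2, z.2 b)
  have e1 : marg (C.chainLaw pU pYX pV) C.chainOut = marg real out := by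
    have hf : ∀ τ u, marg (fun z : (Fin (B + 1) → Common J K K' × Local 𝒰 J L K K') ×
          (Fin (B + 1) → 𝒰) => iid C.randLaw z.1 * iid pU z.2)
        (fun z => (records z.2 z.1, z.2)) (τ, u) = (∏ b, C.index (u b) (τ b)) * iid pU u := by
      intro τ u
      have h := marg_scan C.marg_step (fun τ : Record J L K K' => τ.2.2) 0 u τ
      rw [← h, marg, Fintype.sum_prod_type_right, Finset.sum_eq_single u]
      · rw [marg, Finset.sum_mul]
        refine Finset.sum_congr rfl fun r _ => ?_
        simp only [records, Prod.mk.injEq, and_true]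
        split_ifs <;> simp
      · intro u' _ hu
        refine Finset.sum_eq_zero fun r _ => if_neg fun h => hu (Prod.mk.inj h).2
      · simp
    let k : (Fin (B + 1) → Record J L K K') × (Fin (B + 1) → 𝒰) →
        (Fin (B + 1) → 𝒴) × (Fin B → 𝒱) → ℝ := fun a c =>
      prodLaw (fun b => pYX (C.x (a.1 b).1)) c.1 *
        prodLaw (fun b => pV (C.decW c.1 (commonOf a.1) b, c.1 b.castSucc)) c.2
    have h2 := marg_mul_comp (fun z : (Fin (B + 1) → Common J K K' × Local 𝒰 J L K K') ×
          (Fin (B + 1) → 𝒰) => iid C.randLaw z.1 * iid pU z.2) (fun z => (records z.2 z.1, z.2)) k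
      (fun z => (fun b : Fin B => (z.1.2 b.castSucc, C.x (z.1.1 b.castSucc).1, z.2.1 b.castSucc,
        z.2.2 b) : Fin B → 𝒰 × 𝒳 × 𝒴 × 𝒱))
    have h3 : C.chainLaw pU pYX pV = fun z => (iid C.randLaw z.1.1 * iid pU z.1.2) *
        k (records z.1.2 z.1.1, z.1.2) z.2 := by
      funext z
      simp only [chainLaw, k, funext (commonOf_records z.1.2 z.1.1)]
    let e : (Fin (B + 1) → Z) × (Fin B → 𝒱) ≃
        ((Fin (B + 1) → Record J L K K') × (Fin (B + 1) → 𝒰)) × ((Fin (B + 1) → 𝒴) × (Fin B → 𝒱)) :=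
      { toFun := fun z => ((fun b => (z.1 b).1.1, fun b => (z.1 b).1.2), (fun b => (z.1 b).2, z.2))
        invFun := fun z => (fun b => ((z.1.1 b, z.1.2 b), z.2.1 b), z.2.2)
        left_inv := fun _ => rfl
        right_inv := fun _ => rfl }
    rw [h3]
    refine h2.trans ?_
    rw [← marg_equiv_comp _ e]
    congr 1
    funext z
    simp only [e, Equiv.coe_fn_mk]
    rw [hf]
    simp only [real, kreal, k, iid, pre, prodLaw, Finset.prod_mul_distrib]
    ring
  have e2 : marg ideal out = iid (C.out pU pYX pV) := by
    have h1 : marg (iid (C.pre pU pYX) : (Fin (B + 1) → Z) → ℝ) (fun z b => z (Fin.castSucc b))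
        = (iid (C.pre pU pYX) : (Fin B → Z) → ℝ) := funext fun z =>
      marg_prodLaw_comp (p := fun _ : Fin (B + 1) => C.pre pU pYX) (fun _ => hpre)
        (Fin.castSucc_injective B) z
    have h2 := marg_mul_comp (iid (C.pre pU pYX) : (Fin (B + 1) → Z) → ℝ)
      (fun z b => z (Fin.castSucc b))
      (fun z : Fin B → Z => prodLaw fun b => pV (C.w (z b).1.1.1 (z b).1.1.2, (z b).2))
      (fun z => (fun b : Fin B => ((z.1 b).1.2, C.x (z.1 b).1.1.1, (z.1 b).2, z.2 b) :
        Fin B → 𝒰 × 𝒳 × 𝒴 × 𝒱))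
    refine h2.trans ?_
    rw [h1, ← marg_equiv_comp _ (unzip (Fin B) Z 𝒱)]
    have h3 := funext fun z => marg_prodLaw_map (fun _ : Fin B => C.law pU pYX pV)
      (fun _ z => (z.1.1.2, C.x z.1.1.1.1, z.1.2, z.2)) z
    refine Eq.trans ?_ h3
    congr 1
    funext z
    simp only [unzip, Equiv.coe_fn_mk, iid, prodLaw, law, Finset.prod_mul_distrib]
  have e3 : tv real ideal ≤ 2 * ((B + 1) * C.err pU pYX) := by
    refine (tv_mul_kernel_le (iid_mem hpre).1 (k := kreal) (k' := kideal)
      (fun z => prodLaw_mem fun _ => hV _) (fun z => prodLaw_mem fun _ => hV _)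
      (E := fun z => ∃ b, C.dec ((z b).2, (z b).1.1.1.2) ≠ (z b).1.1.1.1) fun z hz => ?_).trans
      (mul_le_mul_of_nonneg_left ((prob_iid_exists_le hpre fun a =>
        C.dec (a.2, a.1.1.1.2) ≠ a.1.1.1.1).trans (le_of_eq ?_)) zero_le_two)
    · push Not at hz
      simp only [kreal, kideal]
      congr 1
      funext b
      rw [C.decW_eq (τ := fun b => (z b).1.1) hz]
    · simp [err]
  rw [e1, ← e2]
  exact (tv_marg_le _ _ _).trans e3

end

end BlockCode

/-! ### From chains of block codes to codes -/

/-- If the stochastic map `k` turns into `k'` after relabelling its output by `g`, then relabelling input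
and output turns the law `p` followed by `k` into the law of `f` followed by `k'`. -/
theorem marg_prod_kernel {α α' β β' : Type*} [Fintype α] [Fintype β] (p : α → ℝ) (k : α → β → ℝ)
    (f : α → α') (g : β → β') (k' : α' → β' → ℝ) (h : ∀ a, marg (k a) g = k' (f a)) :
    marg (fun z : α × β => p z.1 * k z.1 z.2) (fun z => (f z.1, g z.2))
      = fun z => marg p f z.1 * k' z.1 z.2 := by
  classical
  funext ⟨a', b'⟩
  have e : ∀ a, ∑ b, (if (f a, g b) = (a', b') then p a * k a b else 0)
      = (if f a = a' then p a else 0) * k' a' b' := by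
    intro a
    by_cases ha : f a = a'
    · rw [if_pos ha, ← ha, ← h a, marg, Finset.mul_sum]
      refine Finset.sum_congr rfl fun b _ => ?_
      simp only [ha, Prod.mk.injEq, true_and]
      split_ifs <;> simp
    · rw [if_neg ha, zero_mul]
      exact Finset.sum_eq_zero fun b _ => if_neg fun h => ha (Prod.mk.inj h).1
  rw [marg, Fintype.sum_prod_type, marg, Finset.sum_mul]
  refine Finset.sum_congr rfl fun a _ => Eq.trans ?_ (e a)
  congr!

/-- Disjoint blocks of independent random variables are independent. -/
theorem marg_prodLaw_blocks {ι α : Type*} [Fintype ι] [DecidableEq ι] [Fintype α] {p : ι → α → ℝ}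
    (hp : ∀ i, p i ∈ stdSimplex ℝ α) {B N : ℕ} {e : Fin B × Fin N → ι} (he : Function.Injective e) :
    marg (prodLaw p) (fun w (b : Fin B) (i : Fin N) => w (e (b, i)))
      = prodLaw (fun b => prodLaw fun i => p (e (b, i))) := by
  have h := marg_marg (prodLaw p) (fun w z => w (e z)) (Equiv.curry (Fin B) (Fin N) α)
  refine Eq.trans h.symm ?_
  funext a
  rw [funext fun a => marg_prodLaw_comp hp he a, marg_equiv]
  simp only [prodLaw, Fintype.prod_prod_type]
  rfl

/-- The number `c` of common randomness, reduced to the set `α`. -/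
def reduceTo (α : Type*) [Fintype α] [Nonempty α] {M : ℕ} (c : Fin M) : α :=
  (Fintype.equivFin α).symm ⟨c.val % Fintype.card α, Nat.mod_lt _ Fintype.card_pos⟩

/-- The reduction of a uniform number below `M` is nearly uniform: each residue class has `M / |α|`
elements up to an error of one. -/
theorem tv_marg_reduceTo_le (α : Type*) [Fintype α] [Nonempty α] {M : ℕ} (hM : 0 < M) :
    tv (marg (fun _ : Fin M => 1 / (M : ℝ)) (reduceTo α)) (fun _ => 1 / (Fintype.card α : ℝ))
      ≤ Fintype.card α / M := by
  classical
  set d := Fintype.card α with hd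
  have hd0 : 0 < d := Fintype.card_pos
  have hM' : (0 : ℝ) < M := by exact_mod_cast hM
  have hd' : (0 : ℝ) < d := by exact_mod_cast hd0
  have key : ∀ a : α, |marg (fun _ : Fin M => 1 / (M : ℝ)) (reduceTo α) a - 1 / (d : ℝ)| ≤ 1 / M := by
    intro a
    set v := (Fintype.equivFin α a).val with hv
    have hvd : v < d := (Fintype.equivFin α a).2
    have h1 : marg (fun _ : Fin M => 1 / (M : ℝ)) (reduceTo α) a
        = (Nat.count (fun x => x ≡ v [MOD d]) M : ℝ) * (1 / M) := by
      have h2 : ∀ c : Fin M, reduceTo α c = a ↔ c.val ≡ v [MOD d] := by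
        intro c
        rw [reduceTo, Equiv.symm_apply_eq, Fin.ext_iff, Nat.ModEq, Nat.mod_eq_of_lt hvd]
      simp only [marg, h2]
      rw [Fin.sum_univ_eq_sum_range (fun c => if c ≡ v [MOD d] then 1 / (M : ℝ) else 0),
        Nat.count_eq_card_filter_range, ← Finset.sum_filter, Finset.sum_const, nsmul_eq_mul]
    rw [h1, Nat.count_modEq_card M hd0 v]
    have hdm : (M : ℝ) = d * (M / d : ℕ) + (M % d : ℕ) := by exact_mod_cast (Nat.div_add_mod M d).symm
    have hr : ((M % d : ℕ) : ℝ) < d := by exact_mod_cast Nat.mod_lt M hd0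
    have hr0 : (0 : ℝ) ≤ (M % d : ℕ) := Nat.cast_nonneg _
    have hdiv : ((M / d : ℕ) : ℝ) = (M - (M % d : ℕ)) / d := by
      rw [eq_div_iff hd'.ne', eq_sub_iff_add_eq, mul_comm]; exact hdm.symm
    have hq : ((M % d : ℕ) : ℝ) / d ≤ 1 := (div_le_one hd').2 hr.le
    have hq0 : 0 ≤ ((M % d : ℕ) : ℝ) / d := by positivity
    have e : ∀ b : ℝ, ((M / d : ℕ) + b) * (1 / M) - 1 / d = (b - ((M % d : ℕ) : ℝ) / d) * (1 / M) := by
      intro b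
      rw [hdiv]
      field_simp
      ring
    push_cast
    rw [e, abs_mul, abs_of_pos (by positivity : (0 : ℝ) < 1 / M)]
    refine mul_le_of_le_one_left (by positivity) ?_
    rw [abs_le]
    split_ifs <;> constructor <;> linarith
  calc _ ≤ ∑ _a : α, 1 / (M : ℝ) := Finset.sum_le_sum fun a _ => key a
    _ = _ := by
      rw [Finset.sum_const, Finset.card_univ, nsmul_eq_mul, mul_one_div]

/-- The time index of letter `i` of block `b`. -/
def slot {B N n : ℕ} (h : B * N ≤ n) (z : Fin B × Fin N) : Fin n := Fin.castLE h (finProdFinEquiv z)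

theorem slot_injective {B N n : ℕ} (h : B * N ≤ n) : Function.Injective (slot h) :=
  (Fin.castLE_injective h).comp finProdFinEquiv.injective

theorem slot_val {B N n : ℕ} (h : B * N ≤ n) (z : Fin B × Fin N) :
    (slot h z).val = z.2 + N * z.1 := by
  simp [slot]

namespace BlockCode

set_option synthInstance.maxSize 1000

section

variable {𝒰 𝒳 𝒴 𝒱 𝒲 J L K K' : Type*} [Fintype 𝒰] [Fintype 𝒳] [Fintype 𝒴] [Fintype 𝒱] [Fintype 𝒲]
  [AddCommGroup J] [Fintype J] [Fintype L] [Fintype K] [Fintype K'] [Nonempty L] [Nonempty K]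
  [Nonempty K'] [DecidableEq J] [DecidableEq L] [DecidableEq K] [DecidableEq K'] [DecidableEq 𝒰]
  [Nonempty 𝒰] {B N n M : ℕ}
  (C : BlockCode (Fin N → 𝒰) (Fin N → 𝒳) (Fin N → 𝒴) 𝒲 J L K K')

/-- The local randomness of block `b` of a code, for the value `s` of its local randomness. -/
def localOf (𝒰 J L K K' : Type*) [Fintype 𝒰] [Fintype J] [Fintype L] [Fintype K] [Fintype K']
    [DecidableEq J] [DecidableEq L] [DecidableEq K] [DecidableEq K'] [DecidableEq 𝒰] (B N : ℕ) :
    Fin (Fintype.card (Fin (B + 1) → Local (Fin N → 𝒰) J L K K')) ≃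
      (Fin (B + 1) → Local (Fin N → 𝒰) J L K K') := (Fintype.equivFin _).symm

/-- The randomness of the blocks. -/
def randOf (ρ : Fin (B + 1) → Common J K K') (t : Fin (B + 1) → Local (Fin N → 𝒰) J L K K')
    (b : Fin (B + 1)) : Common J K K' × Local (Fin N → 𝒰) J L K K' := (ρ b, t b)

/-- Places the blocks of `V` at the first times, and an arbitrary symbol at the later times. -/
def placeV (v₀ : 𝒱) (v : Fin B → Fin N → 𝒱) (t : Fin n) : 𝒱 :=
  if h : t.val < B * N then
    v (finProdFinEquiv.symm ⟨t.val, h⟩).1 (finProdFinEquiv.symm ⟨t.val, h⟩).2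
  else v₀

theorem placeV_slot (v₀ : 𝒱) (v : Fin B → Fin N → 𝒱) (h : (B + 1) * N ≤ n) (b : Fin B) (i : Fin N) :
    placeV v₀ v (slot h (b.castSucc, i)) = v b i := by
  have hlt : (slot h (b.castSucc, i)).val < B * N := by
    rw [slot_val]
    exact (finProdFinEquiv (b, i)).2.trans_eq' (by simp)
  have e : (⟨(slot h (b.castSucc, i)).val, hlt⟩ : Fin (B * N)) = finProdFinEquiv (b, i) := by
    ext
    simp [slot_val]
  rw [placeV, dif_pos hlt, e, Equiv.symm_apply_apply]

/-- The code of length `n` that chains `B + 1` block codes of length `N`. Its local randomness numbers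
the local randomness of all blocks, its common randomness is reduced to the common randomness of all
blocks; the unused times at the end are filled with `x₀` and `v₀`. The encoder extends the source
symbols observed so far arbitrarily, since the input of a block uses only the previous blocks. -/
def chainCode {pV : 𝒲 × (Fin N → 𝒴) → (Fin N → 𝒱) → ℝ} (hV : IsKernel pV) (x₀ : 𝒳) (v₀ : 𝒱)
    (h : (B + 1) * N ≤ n) : Code 𝒰 𝒳 𝒴 𝒱 n M where
  numS := Fintype.card (Fin (B + 1) → Local (Fin N → 𝒰) J L K K')
  pS s := iid C.localLaw (localOf 𝒰 J L K K' B N s)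
  pS_mem := by
    have := iid_mem (ι := Fin (B + 1)) C.localLaw_mem
    exact ⟨fun s => this.1 _, ((localOf 𝒰 J L K K' B N).sum_comp _).trans this.2⟩
  f i p c s := if ht : i.val < (B + 1) * N then
      C.x (inputIndex (scanState step (fun τ : Record J L K K' => τ.2.2) 0
        (fun b' i' => extendFin p (i'.val + N * b'))
        (extendFin (randOf (reduceTo (Fin (B + 1) → Common J K K') c) (localOf 𝒰 J L K K' B N s)))
        (finProdFinEquiv.symm (⟨i.val, ht⟩ : Fin ((B + 1) * N))).1)
        (randOf (reduceTo (Fin (B + 1) → Common J K K') c) (localOf 𝒰 J L K K' B N s)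
          (finProdFinEquiv.symm (⟨i.val, ht⟩ : Fin ((B + 1) * N))).1))
        (finProdFinEquiv.symm (⟨i.val, ht⟩ : Fin ((B + 1) * N))).2
    else x₀
  g z := marg (prodLaw fun b : Fin B => pV (C.decW (fun b i => z.1 (slot h (b, i)))
    (reduceTo (Fin (B + 1) → Common J K K') z.2) b, fun i => z.1 (slot h (b.castSucc, i))))
    (placeV v₀)
  g_kernel z := marg_mem (prodLaw_mem fun _ => hV _) _

/-- Since the index of the input codeword of block `b` depends only on the source blocks before `b`, the
strictly causal encoder produces the input of the chain. -/
theorem chainCode_input {pV : 𝒲 × (Fin N → 𝒴) → (Fin N → 𝒱) → ℝ} (hV : IsKernel pV) (x₀ : 𝒳)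
    (v₀ : 𝒱) (h : (B + 1) * N ≤ n) (c : Fin M)
    (s : Fin (Fintype.card (Fin (B + 1) → Local (Fin N → 𝒰) J L K K'))) (u : Fin n → 𝒰)
    (b : Fin (B + 1)) (i : Fin N) :
    (C.chainCode hV x₀ v₀ h).input c s u (slot h (b, i))
      = C.x (records (fun b i => u (slot h (b, i)))
          (randOf (reduceTo (Fin (B + 1) → Common J K K') c) (localOf 𝒰 J L K K' B N s)) b).1 i := by
  have hlt : (slot h (b, i)).val < (B + 1) * N := (finProdFinEquiv (b, i)).2
  have e : (⟨(slot h (b, i)).val, hlt⟩ : Fin ((B + 1) * N)) = finProdFinEquiv (b, i) := rfl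
  simp only [Code.input, chainCode, dif_pos hlt, e, Equiv.symm_apply_apply, records, scan, step]
  refine congrArg (fun σ => C.x (inputIndex σ _) i)
    (scanState_congr step (fun τ : Record J L K K' => τ.2.2) 0 (fun b' hb' => ?_) fun _ _ => rfl)
  have hb : b' < B + 1 := hb'.trans b.2
  funext i'
  have hle : i'.val + N * b' < (slot h (b, i)).val := by
    rw [slot_val]
    calc i'.val + N * b' < N * (b' + 1) := by rw [mul_add]; have := i'.2; omega
      _ ≤ N * b := Nat.mul_le_mul_left _ hb'
      _ ≤ _ := Nat.le_add_left _ _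
  rw [extendFin, dif_pos hle, extendFin, dif_pos hb, past]
  congr 1

end

end BlockCode

/-! ### The law of the chained code -/

namespace BlockCode

set_option synthInstance.maxSize 1000

section

variable {𝒰 𝒳 𝒴 𝒱 𝒲 J L K K' : Type*} [Fintype 𝒰] [Fintype 𝒳] [Fintype 𝒴] [Fintype 𝒱] [Fintype 𝒲]
  [AddCommGroup J] [Fintype J] [Fintype L] [Fintype K] [Fintype K'] [Nonempty L] [Nonempty K]
  [Nonempty K'] [DecidableEq J] [DecidableEq L] [DecidableEq K] [DecidableEq K'] [DecidableEq 𝒰]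
  [Nonempty 𝒰] {B N n M : ℕ}
  (C : BlockCode (Fin N → 𝒰) (Fin N → 𝒳) (Fin N → 𝒴) 𝒲 J L K K')

/-- The randomness and the blocks of a sample point of the code that chains block codes. -/
def chainSample (h : (B + 1) * N ≤ n)
    (ω : Fin M × Fin (Fintype.card (Fin (B + 1) → Local (Fin N → 𝒰) J L K K')) × (Fin n → 𝒰) ×
      (Fin n → 𝒴) × (Fin n → 𝒱)) :
    ((Fin (B + 1) → Common J K K' × Local (Fin N → 𝒰) J L K K') × (Fin (B + 1) → Fin N → 𝒰)) ×
      ((Fin (B + 1) → Fin N → 𝒴) × (Fin B → Fin N → 𝒱)) :=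
  ((randOf (reduceTo (Fin (B + 1) → Common J K K') ω.1) (localOf 𝒰 J L K K' B N ω.2.1),
      fun b i => ω.2.2.1 (slot h (b, i))),
    (fun b i => ω.2.2.2.1 (slot h (b, i)), fun b i => ω.2.2.2.2 (slot h (b.castSucc, i))))

/-- The law of the randomness and of the blocks of the code that chains block codes. -/
theorem marg_chainSample {pU : 𝒰 → ℝ} (hU : pU ∈ stdSimplex ℝ 𝒰) {pYX : 𝒳 → 𝒴 → ℝ}
    (hYX : IsKernel pYX) {pV : 𝒲 × (Fin N → 𝒴) → (Fin N → 𝒱) → ℝ} (hV : IsKernel pV) (x₀ : 𝒳)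
    (v₀ : 𝒱) (h : (B + 1) * N ≤ n) :
    marg ((C.chainCode (M := M) hV x₀ v₀ h).full pU pYX) (chainSample h) = fun z =>
      (marg (fun _ : Fin M => 1 / (M : ℝ)) (reduceTo (Fin (B + 1) → Common J K K'))
          (fun b => (z.1.1 b).1) * iid C.localLaw (fun b => (z.1.1 b).2) * iid (iid pU) z.1.2) *
        (prodLaw (fun b => prodLaw fun i => pYX (C.x (records z.1.2 z.1.1 b).1 i)) z.2.1 *
          prodLaw (fun b => pV (C.decW z.2.1 (fun b => (z.1.1 b).1) b, z.2.1 b.castSucc)) z.2.2) := by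
  set KC := C.chainCode (M := M) hV x₀ v₀ h with hKC
  have hinj := slot_injective h
  let red : Fin M → Fin (B + 1) → Common J K K' := reduceTo (Fin (B + 1) → Common J K K')
  let loc : Fin KC.numS ≃ (Fin (B + 1) → Local (Fin N → 𝒰) J L K K') := localOf 𝒰 J L K K' B N
  -- the law of the randomness and of the source
  let p : Fin M × (Fin KC.numS × (Fin n → 𝒰)) → ℝ := fun a => 1 / (M : ℝ) * (KC.pS a.2.1 * iid pU a.2.2)
  let f : Fin M × (Fin KC.numS × (Fin n → 𝒰)) →
      (Fin (B + 1) → Common J K K' × Local (Fin N → 𝒰) J L K K') × (Fin (B + 1) → Fin N → 𝒰) :=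
    fun a => (randOf (red a.1) (loc a.2.1), fun b i => a.2.2 (slot h (b, i)))
  have hf : ∀ z, marg p f z = marg (fun _ : Fin M => 1 / (M : ℝ)) red (fun b => (z.1 b).1) *
      iid C.localLaw (fun b => (z.1 b).2) * iid (iid pU) z.2 := by
    have h1 : marg (fun a : Fin KC.numS × (Fin n → 𝒰) => KC.pS a.1 * iid pU a.2)
        (fun a => (loc a.1, fun (b : Fin (B + 1)) (i : Fin N) => a.2 (slot h (b, i))))
        = fun z => iid C.localLaw z.1 * iid (iid pU) z.2 := by
      have h2 := marg_prod_kernel KC.pS (fun _ : Fin KC.numS => (iid pU : (Fin n → 𝒰) → ℝ)) loc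
        (fun u (b : Fin (B + 1)) (i : Fin N) => u (slot h (b, i))) (fun _ => iid (iid pU))
        (fun _ => marg_prodLaw_blocks (p := fun _ => pU) (fun _ => hU) hinj)
      rw [h2]
      funext z
      rw [marg_equiv]
      congr 1
      exact congrArg (iid C.localLaw) (loc.apply_symm_apply z.1)
    have h3 := marg_prod_kernel (fun _ : Fin M => 1 / (M : ℝ))
      (fun _ (a : Fin KC.numS × (Fin n → 𝒰)) => KC.pS a.1 * iid pU a.2) red
      (fun a => (loc a.1, fun (b : Fin (B + 1)) (i : Fin N) => a.2 (slot h (b, i))))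
      (fun _ z => iid C.localLaw z.1 * iid (iid pU) z.2) (fun _ => h1)
    let e : (Fin (B + 1) → Common J K K') ×
        ((Fin (B + 1) → Local (Fin N → 𝒰) J L K K') × (Fin (B + 1) → Fin N → 𝒰)) ≃
        (Fin (B + 1) → Common J K K' × Local (Fin N → 𝒰) J L K K') × (Fin (B + 1) → Fin N → 𝒰) :=
      { toFun := fun z => (randOf z.1 z.2.1, z.2.2)
        invFun := fun z => (fun b => (z.1 b).1, (fun b => (z.1 b).2, z.2))
        left_inv := fun _ => rfl
        right_inv := fun _ => rfl }
    intro z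
    have h4 := marg_marg p (fun a => (red a.1, (loc a.2.1,
      fun (b : Fin (B + 1)) (i : Fin N) => a.2.2 (slot h (b, i))))) e
    have h5 : marg p f z = marg p (fun a => e (red a.1, (loc a.2.1,
      fun (b : Fin (B + 1)) (i : Fin N) => a.2.2 (slot h (b, i))))) z := rfl
    rw [h5, ← h4, marg_equiv, h3, mul_assoc]
    rfl
  -- the law of the outputs
  let k : Fin M × (Fin KC.numS × (Fin n → 𝒰)) → (Fin n → 𝒴) × (Fin n → 𝒱) → ℝ := fun a c =>
    prodLaw (fun i => pYX (KC.input a.1 a.2.1 a.2.2 i)) c.1 * KC.g (c.1, a.1) c.2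
  let k' : (Fin (B + 1) → Common J K K' × Local (Fin N → 𝒰) J L K K') × (Fin (B + 1) → Fin N → 𝒰) →
      (Fin (B + 1) → Fin N → 𝒴) × (Fin B → Fin N → 𝒱) → ℝ := fun a c =>
    prodLaw (fun b => prodLaw fun i => pYX (C.x (records a.2 a.1 b).1 i)) c.1 *
      prodLaw (fun b => pV (C.decW c.1 (fun b => (a.1 b).1) b, c.1 b.castSucc)) c.2
  have hk : ∀ a, marg (k a) (fun c => (fun b i => c.1 (slot h (b, i)),
      fun (b : Fin B) (i : Fin N) => c.2 (slot h (b.castSucc, i)))) = k' (f a) := by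
    intro a
    have h1 := marg_prod_kernel (prodLaw (fun i => pYX (KC.input a.1 a.2.1 a.2.2 i)))
      (fun y v => KC.g (y, a.1) v) (fun y (b : Fin (B + 1)) (i : Fin N) => y (slot h (b, i)))
      (fun v (b : Fin B) (i : Fin N) => v (slot h (b.castSucc, i)))
      (fun y => prodLaw fun b => pV (C.decW y (red a.1) b, y b.castSucc)) (fun y => by
        simp only [hKC, chainCode]
        rw [marg_marg]
        simp only [placeV_slot]
        exact marg_id _)
    refine h1.trans ?_
    rw [marg_prodLaw_blocks (fun i => hYX _) hinj]
    have hin : ∀ b i, KC.input a.1 a.2.1 a.2.2 (slot h (b, i)) = C.x (records (f a).2 (f a).1 b).1 i :=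
      fun b i => C.chainCode_input hV x₀ v₀ h a.1 a.2.1 a.2.2 b i
    simp only [hin]
    rfl
  have hmain := marg_prod_kernel p k f _ k' hk
  let e : (Fin M × (Fin KC.numS × (Fin n → 𝒰) × (Fin n → 𝒴) × (Fin n → 𝒱))) ≃
      (Fin M × (Fin KC.numS × (Fin n → 𝒰))) × ((Fin n → 𝒴) × (Fin n → 𝒱)) :=
    { toFun := fun ω => ((ω.1, (ω.2.1, ω.2.2.1)), ω.2.2.2)
      invFun := fun z => (z.1.1, z.1.2.1, z.1.2.2, z.2)
      left_inv := fun _ => rfl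
      right_inv := fun _ => rfl }
  rw [← marg_equiv_comp _ e] at hmain
  refine Eq.trans ?_ (hmain.trans ?_)
  · congr 1
    funext ω
    simp only [Code.full, Code.base, e, Equiv.coe_fn_mk, p, k]
    ring
  · funext z
    rw [hf]

end

end BlockCode

/-! ### Coordination by chained codes -/

theorem tv_comp_equiv {α β : Type*} [Fintype α] [Fintype β] (e : α ≃ β) (p q : β → ℝ) :
    tv (fun a => p (e a)) (fun a => q (e a)) = tv p q :=
  e.sum_comp fun b => |p b - q b|

/-- The time indices of the first `B` blocks of length `N`. -/
def slots (B N n : ℕ) : Finset (Fin n) := Finset.univ.filter fun t => t.val < B * N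

/-- The block and the position in the block of a time index. -/
def slotsEquiv {B N n : ℕ} (h : B * N ≤ n) : slots B N n ≃ Fin B × Fin N where
  toFun t := finProdFinEquiv.symm ⟨t.1.val, (Finset.mem_filter.1 t.2).2⟩
  invFun z := ⟨slot h z, Finset.mem_filter.2 ⟨Finset.mem_univ _, (finProdFinEquiv z).2⟩⟩
  left_inv t := by
    apply Subtype.ext
    apply Fin.ext
    simp [slot, Nat.mod_add_div]
  right_inv z := by
    have : (⟨(slot h z).val, (finProdFinEquiv z).2⟩ : Fin (B * N)) = finProdFinEquiv z := rfl
    simp only [this, Equiv.symm_apply_apply]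

theorem card_slots {B N n : ℕ} (h : B * N ≤ n) : (slots B N n).card = B * N := by
  rw [← Fintype.card_coe, Fintype.card_congr (slotsEquiv h)]
  simp

/-- Blocks of four sequences, as a family indexed by the times of the blocks. -/
def unblock {B N n : ℕ} (h : B * N ≤ n) (𝒰 𝒳 𝒴 𝒱 : Type*) :
    (Fin B → (Fin N → 𝒰) × (Fin N → 𝒳) × (Fin N → 𝒴) × (Fin N → 𝒱)) ≃
      (slots B N n → 𝒰 × 𝒳 × 𝒴 × 𝒱) where
  toFun a t := ((a (slotsEquiv h t).1).1 (slotsEquiv h t).2,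
    (a (slotsEquiv h t).1).2.1 (slotsEquiv h t).2, (a (slotsEquiv h t).1).2.2.1 (slotsEquiv h t).2,
    (a (slotsEquiv h t).1).2.2.2 (slotsEquiv h t).2)
  invFun w b := (fun i => (w ((slotsEquiv h).symm (b, i))).1,
    fun i => (w ((slotsEquiv h).symm (b, i))).2.1, fun i => (w ((slotsEquiv h).symm (b, i))).2.2.1,
    fun i => (w ((slotsEquiv h).symm (b, i))).2.2.2)
  left_inv a := by simp
  right_inv w := by simp

/-- Independent blocks of independent letters are independent letters. -/
theorem marg_unblock_iid {𝒰 𝒳 𝒴 𝒱 : Type*} [Fintype 𝒰] [Fintype 𝒳] [Fintype 𝒴] [Fintype 𝒱]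
    {B N n : ℕ} (h : B * N ≤ n) (P : 𝒰 × 𝒳 × 𝒴 × 𝒱 → ℝ) :
    marg (iid fun z : (Fin N → 𝒰) × (Fin N → 𝒳) × (Fin N → 𝒴) × (Fin N → 𝒱) =>
        ∏ i, P (z.1 i, z.2.1 i, z.2.2.1 i, z.2.2.2 i)) (unblock (B := B) h 𝒰 𝒳 𝒴 𝒱) = iid P := by
  funext w
  rw [marg_equiv, iid, iid, ← (slotsEquiv h).symm.prod_comp, Fintype.prod_prod_type]
  rfl

namespace BlockCode

set_option synthInstance.maxSize 1000

section

variable {𝒰 𝒳 𝒴 𝒱 𝒲 J L K K' : Type*} [Fintype 𝒰] [Fintype 𝒳] [Fintype 𝒴] [Fintype 𝒱] [Fintype 𝒲]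
  [AddCommGroup J] [Fintype J] [Fintype L] [Fintype K] [Fintype K'] [Nonempty L] [Nonempty K]
  [Nonempty K'] [DecidableEq J] [DecidableEq L] [DecidableEq K] [DecidableEq K'] [DecidableEq 𝒰]
  [Nonempty 𝒰] {B N n M : ℕ}
  (C : BlockCode (Fin N → 𝒰) (Fin N → 𝒳) (Fin N → 𝒴) 𝒲 J L K K')

/-- The common randomness of the blocks is uniform and independent of the local randomness. -/
theorem iid_randLaw (r : Fin (B + 1) → Common J K K' × Local (Fin N → 𝒰) J L K K') :
    iid C.randLaw r = 1 / (Fintype.card (Fin (B + 1) → Common J K K') : ℝ)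
      * iid C.localLaw (fun b => (r b).2) := by
  simp only [iid, randLaw, Finset.prod_mul_distrib, Finset.prod_const, Finset.card_univ,
    Fintype.card_fin, Fintype.card_pi]
  push_cast
  rw [one_div_pow]

/-- The chain of block codes coordinates the blocks up to the errors of its block codes and to the
error of reducing the common randomness. -/
theorem tv_chainCode_lawOn_le {pU : 𝒰 → ℝ} (hU : pU ∈ stdSimplex ℝ 𝒰) {pYX : 𝒳 → 𝒴 → ℝ}
    (hYX : IsKernel pYX) {pV : 𝒲 × (Fin N → 𝒴) → (Fin N → 𝒱) → ℝ} (hV : IsKernel pV) (x₀ : 𝒳)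
    (v₀ : 𝒱) (h : (B + 1) * N ≤ n) (hM : 0 < M) {P : 𝒰 × 𝒳 × 𝒴 × 𝒱 → ℝ}
    (hP : (fun z : (Fin N → 𝒰) × (Fin N → 𝒳) × (Fin N → 𝒴) × (Fin N → 𝒱) =>
        ∏ i, P (z.1 i, z.2.1 i, z.2.2.1 i, z.2.2.2 i)) ∈ stdSimplex ℝ _) :
    tv ((C.chainCode (M := M) hV x₀ v₀ h).lawOn pU pYX (slots B N n)) (iid P) ≤
      (Fintype.card (Common J K K') : ℝ) ^ (B + 1) / M
        + 2 * ((B + 1) * C.err (iid pU) (fun x => prodLaw fun i => pYX (x i)))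
        + B * tv (C.out (iid pU) (fun x => prodLaw fun i => pYX (x i)) pV)
          (fun z => ∏ i, P (z.1 i, z.2.1 i, z.2.2.1 i, z.2.2.2 i)) := by
  have hBn : B * N ≤ n := le_trans (Nat.mul_le_mul_right N (Nat.le_succ B)) h
  have hYX' : IsKernel fun x : Fin N → 𝒳 => prodLaw fun i => pYX (x i) :=
    fun x => prodLaw_mem fun _ => hYX _
  have hU' : (iid pU : (Fin N → 𝒰) → ℝ) ∈ stdSimplex ℝ (Fin N → 𝒰) := iid_mem hU
  set q : (Fin (B + 1) → Common J K K') → ℝ :=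
    marg (fun _ : Fin M => 1 / (M : ℝ)) (reduceTo (Fin (B + 1) → Common J K K')) with hq
  let kern : (Fin (B + 1) → Common J K K' × Local (Fin N → 𝒰) J L K K') × (Fin (B + 1) → Fin N → 𝒰) →
      (Fin (B + 1) → Fin N → 𝒴) × (Fin B → Fin N → 𝒱) → ℝ := fun a c =>
    prodLaw (fun b => prodLaw fun i => pYX (C.x (records a.2 a.1 b).1 i)) c.1 *
      prodLaw (fun b => pV (C.decW c.1 (fun b => (a.1 b).1) b, c.1 b.castSucc)) c.2
  have hkern : IsKernel kern := by
    intro a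
    have h1 := fun y : Fin (B + 1) → Fin N → 𝒴 => prodLaw_mem (p := fun b : Fin B =>
      pV (C.decW y (fun b => (a.1 b).1) b, y b.castSucc)) fun _ => hV _
    have h2 := prodLaw_mem (p := fun b : Fin (B + 1) => prodLaw fun i =>
      pYX (C.x (records a.2 a.1 b).1 i)) fun _ => hYX' _
    refine ⟨fun c => mul_nonneg (h2.1 _) ((h1 _).1 _), ?_⟩
    simp only [Fintype.sum_prod_type, kern, ← Finset.mul_sum, (h1 _).2, mul_one, h2.2]
  let real : (((Fin (B + 1) → Common J K K' × Local (Fin N → 𝒰) J L K K') × (Fin (B + 1) → Fin N → 𝒰)) ×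
      ((Fin (B + 1) → Fin N → 𝒴) × (Fin B → Fin N → 𝒱))) → ℝ := fun z =>
    (q (fun b => (z.1.1 b).1) * iid C.localLaw (fun b => (z.1.1 b).2) * iid (iid pU) z.1.2) *
      kern z.1 z.2
  -- the coordinated letters are a function of the blocks
  have e1 : (C.chainCode (M := M) hV x₀ v₀ h).lawOn pU pYX (slots B N n)
      = marg (marg real C.chainOut) (unblock hBn 𝒰 𝒳 𝒴 𝒱) := by
    have hs : ∀ t : slots B N n, slot h ((slotsEquiv hBn t).1.castSucc, (slotsEquiv hBn t).2) = t := by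
      intro t
      have h1 := congrArg Subtype.val ((slotsEquiv hBn).symm_apply_apply t)
      rw [← h1]
      apply Fin.ext
      rw [slot_val]
      exact (slot_val hBn _).symm
    have h1 : marg ((C.chainCode (M := M) hV x₀ v₀ h).full pU pYX) (chainSample h) = real :=
      C.marg_chainSample (M := M) hU hYX hV x₀ v₀ h
    rw [Code.lawOn_eq, marg_marg]
    rw [← h1]
    refine Eq.trans ?_ (marg_marg ((C.chainCode (M := M) hV x₀ v₀ h).full pU pYX) (chainSample h) _).symm
    congr 1
    funext ω t
    have h2 := C.chainCode_input hV x₀ v₀ h ω.1 ω.2.1 ω.2.2.1 (slotsEquiv hBn t).1.castSucc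
      (slotsEquiv hBn t).2
    rw [hs] at h2
    simp only [unblock, Equiv.coe_fn_mk, chainOut, chainSample, h2, hs]
  have e2 : tv real (C.chainLaw (iid pU) (fun x => prodLaw fun i => pYX (x i)) pV)
      ≤ (Fintype.card (Common J K K') : ℝ) ^ (B + 1) / M := by
    have : Nonempty J := ⟨0⟩
    have h1 := tv_marg_reduceTo_le (Fin (B + 1) → Common J K K') hM
    have h2 := tv_mul_kernel
      (fun a : (Fin (B + 1) → Common J K K' × Local (Fin N → 𝒰) J L K K') × (Fin (B + 1) → Fin N → 𝒰) =>
        q (fun b => (a.1 b).1) * iid C.localLaw (fun b => (a.1 b).2) * iid (iid pU) a.2)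
      (fun a => iid C.randLaw a.1 * iid (iid pU) a.2) kern hkern
    let e : (Fin (B + 1) → Common J K K' × Local (Fin N → 𝒰) J L K K') × (Fin (B + 1) → Fin N → 𝒰) ≃
        (Fin (B + 1) → Common J K K') ×
          ((Fin (B + 1) → Local (Fin N → 𝒰) J L K K') × (Fin (B + 1) → Fin N → 𝒰)) :=
      { toFun := fun z => (fun b => (z.1 b).1, (fun b => (z.1 b).2, z.2))
        invFun := fun z => (randOf z.1 z.2.1, z.2.2)
        left_inv := fun _ => rfl
        right_inv := fun _ => rfl }
    have hk2 : IsKernel fun (_ : Fin (B + 1) → Common J K K')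
        (z : (Fin (B + 1) → Local (Fin N → 𝒰) J L K K') × (Fin (B + 1) → Fin N → 𝒰)) =>
        iid C.localLaw z.1 * iid (iid pU) z.2 := by
      intro _
      have m1 := iid_mem (ι := Fin (B + 1)) C.localLaw_mem
      have m2 := iid_mem (ι := Fin (B + 1)) hU'
      refine ⟨fun z => mul_nonneg (m1.1 _) (m2.1 _), ?_⟩
      simp only [Fintype.sum_prod_type, ← Finset.mul_sum, m2.2, mul_one, m1.2]
    have h3 := tv_mul_kernel q (fun _ => 1 / (Fintype.card (Fin (B + 1) → Common J K K') : ℝ)) _ hk2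
    rw [← tv_comp_equiv e] at h3
    refine le_trans (le_of_eq ?_) (h1.trans (le_of_eq ?_))
    · refine h2.trans (Eq.trans ?_ h3)
      congr 1
      · funext a
        exact mul_assoc _ _ _
      · funext a
        rw [iid_randLaw]
        exact mul_assoc _ _ _
    · rw [Fintype.card_pi]
      simp
  have e3 := C.tv_chain_le (B := B) hU' hYX' hV
  have hout : C.out (iid pU) (fun x => prodLaw fun i => pYX (x i)) pV ∈ stdSimplex ℝ
      ((Fin N → 𝒰) × (Fin N → 𝒳) × (Fin N → 𝒴) × (Fin N → 𝒱)) := by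
    refine marg_mem ⟨fun z => mul_nonneg ((C.pre_mem hU' hYX').1 _) ((hV _).1 _), ?_⟩ _
    rw [Fintype.sum_prod_type]
    simp only [← Finset.mul_sum, (hV _).2, mul_one, (C.pre_mem hU' hYX').2]
  have e4 := tv_iid_fin_le hout hP B
  rw [e1, ← marg_unblock_iid hBn P]
  refine (tv_marg_le _ _ _).trans ?_
  have t1 := tv_triangle (marg real C.chainOut)
    (marg (C.chainLaw (B := B) (iid pU) (fun x => prodLaw fun i => pYX (x i)) pV) (C.chainOut (B := B)))
    (iid (ι := Fin B) fun z : (Fin N → 𝒰) × (Fin N → 𝒳) × (Fin N → 𝒴) × (Fin N → 𝒱) =>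
        ∏ i, P (z.1 i, z.2.1 i, z.2.2.1 i, z.2.2.2 i))
  have t2 := tv_triangle
    (marg (C.chainLaw (B := B) (iid pU) (fun x => prodLaw fun i => pYX (x i)) pV) (C.chainOut (B := B)))
    (iid (ι := Fin B) (C.out (iid pU) (fun x => prodLaw fun i => pYX (x i)) pV))
    (iid (ι := Fin B) fun z : (Fin N → 𝒰) × (Fin N → 𝒳) × (Fin N → 𝒴) × (Fin N → 𝒱) =>
        ∏ i, P (z.1 i, z.2.1 i, z.2.2.1 i, z.2.2.2 i))
  have t3 := tv_marg_le real (C.chainLaw (iid pU) (fun x => prodLaw fun i => pYX (x i)) pV) C.chainOut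
  linarith

end

end BlockCode

/-! ### Achievability -/

/-- A choice of near-minimizers realizes a vanishing infimum. -/
theorem exists_tendsto_zero {ι : ℕ → Type*} [∀ n, Nonempty (ι n)] {F : ∀ n, ι n → ℝ}
    (h0 : ∀ n i, 0 ≤ F n i) (h : ∀ δ : ℝ, 0 < δ → ∀ᶠ n in atTop, ∃ i, F n i < δ) :
    ∃ s : ∀ n, ι n, Tendsto (fun n => F n (s n)) atTop (𝓝 0) := by
  have hbdd : ∀ n, BddBelow (Set.range (F n)) := fun n => ⟨0, by rintro _ ⟨i, rfl⟩; exact h0 n i⟩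
  choose s hs using fun n => exists_lt_of_ciInf_lt
    (lt_add_of_pos_right (⨅ i, F n i) (Nat.one_div_pos_of_nat (α := ℝ) (n := n)))
  have hinf : Tendsto (fun n => ⨅ i, F n i) atTop (𝓝 0) := by
    refine tendsto_order.2 ⟨fun a ha => .of_forall fun n => ha.trans_le (le_ciInf (h0 n)), fun a ha => ?_⟩
    filter_upwards [h a ha] with n hn
    obtain ⟨i, hi⟩ := hn
    exact (ciInf_le (hbdd n) i).trans_lt hi
  refine ⟨s, squeeze_zero (fun n => h0 n _) (fun n => (hs n).le) ?_⟩
  simpa using hinf.add (tendsto_one_div_add_atTop_nhds_zero_nat (𝕜 := ℝ))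

section

variable {𝒰 𝒳 𝒴 𝒱 : Type*} [Fintype 𝒰] [Fintype 𝒳] [Fintype 𝒴] [Fintype 𝒱]

theorem nonempty_code [Nonempty 𝒳] [Nonempty 𝒱] (n M : ℕ) : Nonempty (Code 𝒰 𝒳 𝒴 𝒱 n M) := by
  classical
  exact ⟨{ numS := 1, pS := Pi.single 0 1, pS_mem := single_mem_stdSimplex ℝ _
           f := fun _ _ _ _ => Classical.arbitrary 𝒳
           g := fun _ => Pi.single (fun _ => Classical.arbitrary 𝒱) 1
           g_kernel := fun _ => single_mem_stdSimplex ℝ _ }⟩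

/-- Achievability from codes that leave out a fraction `δ` of the slots and are `δ`-close to the
target on the other slots. -/
theorem achievable_of_eventually {pU : 𝒰 → ℝ} {pYX : 𝒳 → 𝒴 → ℝ} {P : 𝒰 × 𝒳 × 𝒴 × 𝒱 → ℝ} {R : ℝ}
    (hP : P ∈ stdSimplex ℝ (𝒰 × 𝒳 × 𝒴 × 𝒱)) (hR : 0 ≤ R)
    (h : ∀ δ : ℝ, 0 < δ → ∀ᶠ n : ℕ in atTop, ∃ (K : Code 𝒰 𝒳 𝒴 𝒱 n ⌊(2 : ℝ) ^ ((n : ℝ) * R)⌋₊)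
      (A : Finset (Fin n)), (1 - (A.card : ℝ) / n) + tv (K.lawOn pU pYX A) (iid P) < δ) :
    Achievable pU pYX P R := by
  obtain ⟨_, x, _, v⟩ := (nonempty_of_mem_stdSimplex hP).some
  have : Nonempty 𝒳 := ⟨x⟩
  have : Nonempty 𝒱 := ⟨v⟩
  have hne : ∀ n : ℕ, Nonempty (Code 𝒰 𝒳 𝒴 𝒱 n ⌊(2 : ℝ) ^ ((n : ℝ) * R)⌋₊) :=
    fun n => nonempty_code n _
  have h1 : ∀ (n : ℕ) (A : Finset (Fin n)), 0 ≤ 1 - (A.card : ℝ) / n := by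
    intro n A
    have : A.card ≤ n := by simpa using A.card_le_univ
    exact sub_nonneg.2 (div_le_one_of_le₀ (by exact_mod_cast this) (Nat.cast_nonneg n))
  obtain ⟨s, hs⟩ := exists_tendsto_zero
    (ι := fun n => Code 𝒰 𝒳 𝒴 𝒱 n ⌊(2 : ℝ) ^ ((n : ℝ) * R)⌋₊ × Finset (Fin n))
    (F := fun n s => (1 - (s.2.card : ℝ) / n) + tv (s.1.lawOn pU pYX s.2) (iid P))
    (fun n s => add_nonneg (h1 n _) (tv_nonneg _ _)) fun δ hδ => (h δ hδ).mono
      fun n ⟨K, A, hKA⟩ => ⟨(K, A), hKA⟩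
  refine ⟨hP, hR, fun n => (s n).1, fun ε hε => ⟨fun n => (s n).2, ?_, ?_⟩⟩
  · filter_upwards [hs.eventually_lt_const hε, eventually_gt_atTop 0] with n hn hn0
    have hn0' : (0 : ℝ) < n := by exact_mod_cast hn0
    have h2 := tv_nonneg ((s n).1.lawOn pU pYX (s n).2) (iid P)
    rw [← lt_div_iff₀ hn0']
    linarith
  · exact squeeze_zero (fun n => tv_nonneg _ _) (fun n => le_add_of_nonneg_left (h1 n _)) hs

end

namespace AuxData

variable {𝒰 𝒳 𝒴 𝒱 𝒲 : Type*} [Fintype 𝒰] [Fintype 𝒳] [Fintype 𝒴] [Fintype 𝒱] [Fintype 𝒲]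
  (D : AuxData 𝒰 𝒳 𝒴 𝒱 𝒲)

theorem blockTarget_mem (N : ℕ) : D.blockTarget N ∈
    stdSimplex ℝ ((Fin N → 𝒰) × (Fin N → 𝒳) × (Fin N → 𝒴) × (Fin N → 𝒱)) := by
  let e : ((Fin N → 𝒰) × (Fin N → 𝒳) × (Fin N → 𝒴) × (Fin N → 𝒱)) ≃ (Fin N → 𝒰 × 𝒳 × 𝒴 × 𝒱) :=
    { toFun := fun z i => (z.1 i, z.2.1 i, z.2.2.1 i, z.2.2.2 i)
      invFun := fun w => (fun i => (w i).1, fun i => (w i).2.1, fun i => (w i).2.2.1,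
        fun i => (w i).2.2.2)
      left_inv := fun _ => rfl
      right_inv := fun _ => rfl }
  have h := iid_mem (ι := Fin N) D.target_mem
  exact ⟨fun z => h.1 (e z), (e.sum_comp (iid D.target)).trans h.2⟩

/-- Above the rate of the inner region, and if `I(WX;U) < I(WX;Y)` or both vanish, the target is
achievable: chain `B + 1` block codes, with `B` large. -/
theorem achievable (hI : D.rateU < D.rateY ∨ D.rateU = 0 ∧ D.rateY = 0) {R : ℝ}
    (hR : shannon D.pX - D.rateY + D.rateUYV < R * Real.log 2) :
    Achievable D.pU D.pYX D.target R := by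
  classical
  obtain ⟨u, x₀, _, v₀⟩ := (nonempty_of_mem_stdSimplex D.target_mem).some
  have : Nonempty 𝒰 := ⟨u⟩
  have hrate : 0 ≤ shannon D.pX - D.rateY + D.rateUYV := by
    have h1 := D.rateY_le
    have h2 := D.rateU_nonneg
    have h3 := D.rateU_le_rateUYV
    linarith
  have hR0 : 0 ≤ R := by
    by_contra h
    have := mul_neg_of_neg_of_pos (not_le.1 h) (Real.log_pos one_lt_two)
    linarith
  obtain ⟨r, hr, hrR⟩ := exists_between hR
  refine achievable_of_eventually D.target_mem hR0 fun δ hδ => ?_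
  -- The total error is at most the sum of four terms below `δ / 4`: the fraction of the last block, that
  -- of the times left over, the reduction of the common randomness, and the errors of `B + 1` blocks.
  obtain ⟨B, hB⟩ := exists_nat_one_div_lt (show 0 < δ / 4 by linarith)
  set η : ℝ := δ / (12 * (B + 1)) with hη
  have hη0 : 0 < η := by positivity
  have hN : Tendsto (fun n : ℕ => n / (B + 1)) atTop atTop := Nat.tendsto_div_const_atTop (by omega)
  have hexp : ∀ᶠ n : ℕ in atTop, 2 * Real.exp (-(n * (R * Real.log 2 - r))) < δ / 4 := by
    have := (tendsto_exp_neg (sub_pos.2 hrR)).const_mul 2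
    rw [mul_zero] at this
    exact this.eventually_lt_const (by linarith)
  have hlin : ∀ᶠ n : ℕ in atTop, (B : ℝ) / n < δ / 4 :=
    (tendsto_const_div_atTop_nhds_zero_nat (B : ℝ)).eventually_lt_const (by linarith)
  filter_upwards [hN.eventually (D.eventually_exists_blockCode hI hr hη0), hexp, hlin,
    eventually_gt_atTop 0] with n hcode hexp hlin hn
  obtain ⟨N, hNdef⟩ : ∃ N, N = n / (B + 1) := ⟨_, rfl⟩
  rw [← hNdef] at hcode
  obtain ⟨j, l, k, k', hsize, C, hC, hCe⟩ := hcode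
  have hmul : (B + 1) * N ≤ n := hNdef ▸ Nat.mul_div_le n (B + 1)
  have hM := floor_two_rpow_pos (n := n) hR0
  have hn' : (0 : ℝ) < n := by exact_mod_cast hn
  have hbd := C.tv_chainCode_lawOn_le (M := ⌊(2 : ℝ) ^ ((n : ℝ) * R)⌋₊) D.hU D.hYX (D.blockV_kernel N)
    x₀ v₀ hmul hM (P := D.target) (D.blockTarget_mem N)
  refine ⟨_, slots B N n, lt_of_le_of_lt (add_le_add_right hbd _) ?_⟩
  have hcard : 1 - ((slots B N n).card : ℝ) / n ≤ 1 / (B + 1) + B / n := by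
    rw [card_slots (le_trans (Nat.mul_le_mul_right N (Nat.le_succ B)) hmul)]
    have h1 : (n : ℝ) ≤ (B + 1) * N + B := by
      have h3 : n ≤ (B + 1) * N + B := by
        conv_lhs => rw [← Nat.div_add_mod n (B + 1), ← hNdef]
        exact Nat.add_le_add_left (Nat.lt_succ_iff.1 (Nat.mod_lt n (Nat.succ_pos B))) _
      exact_mod_cast h3
    have h2 : (1 : ℝ) - 1 / (B + 1) = B / (B + 1) := by field_simp; ring
    have h3 : (B : ℝ) / (B + 1) ≤ (B * N : ℕ) / n + B / n := by
      rw [← add_div, div_le_div_iff₀ (by positivity) hn']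
      push_cast
      nlinarith [Nat.cast_nonneg (α := ℝ) B]
    linarith
  have hratio : (Fintype.card (BlockCode.Common (Fin (j + 1)) (Fin (k + 1)) (Fin (k' + 1))) : ℝ) ^ (B + 1)
      / ⌊(2 : ℝ) ^ ((n : ℝ) * R)⌋₊ < δ / 4 := by
    refine lt_of_le_of_lt ?_ hexp
    have h1 : (Fintype.card (BlockCode.Common (Fin (j + 1)) (Fin (k + 1)) (Fin (k' + 1))) : ℝ) ^ (B + 1)
        ≤ Real.exp (n * r) := by
      have h1 : (Fintype.card (BlockCode.Common (Fin (j + 1)) (Fin (k + 1)) (Fin (k' + 1))) : ℝ)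
          ≤ Real.exp (N * r) := by
        refine le_trans (le_of_eq ?_) hsize
        simp [BlockCode.Common, mul_assoc]
      refine (pow_le_pow_left₀ (Nat.cast_nonneg _) h1 _).trans ?_
      rw [← Real.exp_nat_mul, Real.exp_le_exp, ← mul_assoc]
      exact mul_le_mul_of_nonneg_right (by exact_mod_cast hmul) (hrate.trans hr.le)
    have h2 : Real.exp (n * (R * Real.log 2)) ≤ 2 * (⌊(2 : ℝ) ^ ((n : ℝ) * R)⌋₊ : ℝ) := by
      have h3 : (1 : ℝ) ≤ (⌊(2 : ℝ) ^ ((n : ℝ) * R)⌋₊ : ℝ) := by exact_mod_cast hM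
      have h4 := Nat.lt_floor_add_one ((2 : ℝ) ^ ((n : ℝ) * R))
      have h5 : (2 : ℝ) ^ ((n : ℝ) * R) = Real.exp (n * (R * Real.log 2)) := by
        rw [Real.rpow_def_of_pos two_pos]
        ring_nf
      linarith
    rw [div_le_iff₀ (by exact_mod_cast hM)]
    calc _ ≤ Real.exp (n * r) := h1
      _ = Real.exp (-(n * (R * Real.log 2 - r))) * Real.exp (n * (R * Real.log 2)) := by
        rw [← Real.exp_add]; ring_nf
      _ ≤ Real.exp (-(n * (R * Real.log 2 - r))) * (2 * (⌊(2 : ℝ) ^ ((n : ℝ) * R)⌋₊ : ℝ)) :=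
        mul_le_mul_of_nonneg_left h2 (Real.exp_nonneg _)
      _ = _ := by ring
  have herr : 2 * (((B : ℝ) + 1) * C.err (iid D.pU) (D.blockYX N))
      + B * tv (C.out (iid D.pU) (D.blockYX N) (D.blockV N)) (D.blockTarget N) ≤ δ / 4 := by
    calc _ ≤ 2 * (((B : ℝ) + 1) * η) + B * η := by gcongr
      _ ≤ 3 * ((B + 1) * η) := by linarith
      _ = δ / 4 := by rw [hη]; field_simp; norm_num
  have herr' : 2 * (((B : ℝ) + 1) * C.err (iid D.pU) (fun x => prodLaw fun i => D.pYX (x i)))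
      + B * tv (C.out (iid D.pU) (fun x => prodLaw fun i => D.pYX (x i)) (D.blockV N))
        (fun z => ∏ i, D.target (z.1 i, z.2.1 i, z.2.2.1 i, z.2.2.2 i)) ≤ δ / 4 := herr
  linarith

end AuxData

/-! ### The inner bound: erasures of the auxiliary variable -/

section

namespace AuxData

variable {𝒰 𝒳 𝒴 𝒱 𝒲 : Type*} [Fintype 𝒰] [Fintype 𝒳] [Fintype 𝒴] [Fintype 𝒱] [Fintype 𝒲]
  (D : AuxData 𝒰 𝒳 𝒴 𝒱 𝒲)

/-- The auxiliary variable is erased with probability `t`; the decoder replaces an erased symbol by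
`w₀`. -/
def erase (w₀ : 𝒲) (t : unitInterval) : AuxData 𝒰 𝒳 𝒴 𝒱 (Option 𝒲) where
  pU := D.pU
  hU := D.hU
  pX := D.pX
  hX := D.hX
  pW a w := w.elim (t : ℝ) fun w => (1 - t) * D.pW a w
  hW a := by
    refine ⟨fun w => ?_, ?_⟩
    · cases w with
      | none => exact t.2.1
      | some w => exact mul_nonneg (sub_nonneg.2 t.2.2) ((D.hW a).1 w)
    · rw [Fintype.sum_option]
      simp only [Option.elim, ← Finset.mul_sum, (D.hW a).2]
      ring
  pYX := D.pYX
  hYX := D.hYX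
  pV b := D.pV (b.1.getD w₀, b.2)
  hV _ := D.hV _

variable (w₀ : 𝒲) (t : unitInterval)

theorem erase_qW_none (x : 𝒳) : (D.erase w₀ t).qW x none = t := by
  simp [qW, erase, ← Finset.sum_mul, D.hU.2]

theorem erase_qW_some (x : 𝒳) (w : 𝒲) : (D.erase w₀ t).qW x (some w) = (1 - t) * D.qW x w := by
  simp only [qW, erase, Option.elim, Finset.mul_sum]
  exact Finset.sum_congr rfl fun u _ => by ring

theorem erase_post_some (ht : (t : ℝ) ≠ 1) (x : 𝒳) (w : 𝒲) (u : 𝒰) :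
    (D.erase w₀ t).post x (some w) u = D.post x w u := by
  rw [post, erase_qW_some, post]
  simp only [erase, Option.elim]
  rw [mul_div_mul_left _ _ (sub_ne_zero.2 ht.symm)]

/-- An erased symbol carries no information about `U`. -/
theorem erase_rateU : (D.erase w₀ t).rateU = (1 - t) * D.rateU := by
  have h0 : ∀ u, (D.erase w₀ t).pX = D.pX ∧ (D.erase w₀ t).pU u = D.pU u := fun _ => ⟨rfl, rfl⟩
  simp only [rateU, Fintype.sum_option, Finset.mul_sum]
  refine Finset.sum_congr rfl fun x _ => ?_
  have h1 : ∑ u, (D.erase w₀ t).pX x * (D.erase w₀ t).qW x none * (D.erase w₀ t).post x none u *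
      Real.log ((D.erase w₀ t).post x none u / (D.erase w₀ t).pU u) = 0 := by
    refine Finset.sum_eq_zero fun u _ => ?_
    rcases eq_or_ne (t : ℝ) 0 with ht | ht
    · rw [erase_qW_none, ht]; ring
    · have : (D.erase w₀ t).post x none u = D.pU u := by
        rw [post, erase_qW_none]
        simp only [erase, Option.elim]
        rw [div_self ht, mul_one]
      rw [this, (h0 u).2]
      rcases eq_or_ne (D.pU u) 0 with hu | hu
      · rw [hu]; simp
      · rw [div_self hu, Real.log_one, mul_zero]
  rw [h1, zero_add]
  refine Finset.sum_congr rfl fun w _ => Finset.sum_congr rfl fun u _ => ?_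
  rw [erase_qW_some]
  rcases eq_or_ne (t : ℝ) 1 with ht | ht
  · rw [ht]; ring
  · rw [erase_post_some D w₀ t ht, (h0 u).1, (h0 u).2]
    ring

theorem erase_zero_outUYV (x : 𝒳) (b : 𝒰 × 𝒴 × 𝒱) : (D.erase w₀ 0).outUYV x b = D.outUYV x b := by
  simp [outUYV, condV, erase]

theorem erase_zero_target : (D.erase w₀ 0).target = D.target := by
  funext z
  rw [target, erase_zero_outUYV]
  rfl

theorem erase_zero_rateUYV : (D.erase w₀ 0).rateUYV = D.rateUYV := by
  simp only [rateUYV, Fintype.sum_option, erase_zero_outUYV, erase_qW_none, erase_qW_some, postUYV,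
    erase_post_some D w₀ 0 (by simp)]
  simp [erase]

theorem continuous_erase_law : Continuous fun t => (D.erase w₀ t).law := by
  refine continuous_pi fun ⟨u, x, w, y, v⟩ => ?_
  simp only [law_apply, erase]
  cases w <;> simp only [Option.elim] <;> fun_prop

theorem continuous_erase_target : Continuous fun t => (D.erase w₀ t).target := by
  have : (fun t => (D.erase w₀ t).target)
      = fun t => marg (D.erase w₀ t).law (fun z => (rvU z, rvX z, rvY z, rvV z)) :=
    funext fun t => funext fun z => ((D.erase w₀ t).marg_law_UXYV z).symm
  rw [this]
  exact (continuous_marg _).comp (D.continuous_erase_law w₀)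

theorem continuous_erase_rateUYV : Continuous fun t => (D.erase w₀ t).rateUYV := by
  simp only [rateUYV_eq]
  have h := D.continuous_erase_law w₀
  exact ((((continuous_ent _).comp h).add ((continuous_ent _).comp h)).sub
    ((continuous_ent _).comp h)).sub ((continuous_ent _).comp h)

/-- The erasures turn `I(WX;U) ≤ I(WX;Y)` into a strict inequality (or both sides vanish), and change
the target and the rate continuously. -/
theorem mem_region (hI : D.rateU ≤ D.rateY) {R : ℝ}
    (hR : shannon D.pX - D.rateY + D.rateUYV ≤ R * Real.log 2) :
    (D.target, R) ∈ region D.pU D.pYX := by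
  obtain ⟨u, x, _⟩ := (nonempty_of_mem_stdSimplex D.target_mem).some
  obtain ⟨w₀⟩ := nonempty_of_mem_stdSimplex (D.hW (u, x))
  have hlog : 0 < Real.log 2 := Real.log_pos one_lt_two
  let F : unitInterval → (𝒰 × 𝒳 × 𝒴 × 𝒱 → ℝ) × ℝ := fun t =>
    ((D.erase w₀ t).target, R + ((D.erase w₀ t).rateUYV - D.rateUYV) / Real.log 2 + t)
  have hF : Continuous F := by
    have h1 := D.continuous_erase_target w₀
    have h2 := D.continuous_erase_rateUYV w₀
    exact h1.prodMk ((continuous_const.add ((h2.sub continuous_const).div_const _)).add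
      continuous_subtype_val)
  have hF0 : F 0 = (D.target, R) := by
    simp only [F, erase_zero_target, erase_zero_rateUYV]
    simp
  have hlim : Tendsto F (𝓝[>] 0) (𝓝 (D.target, R)) := hF0 ▸ (hF.tendsto 0).mono_left nhdsWithin_le_nhds
  have : (𝓝[>] (0 : unitInterval)).NeBot := nhdsGT_neBot_of_exists_gt ⟨1, zero_lt_one⟩
  refine mem_closure_of_tendsto hlim (eventually_mem_nhdsWithin.mono fun t ht => ?_)
  have ht0 : 0 < (t : ℝ) := ht
  have hU0 := D.rateU_nonneg
  have hI' : (D.erase w₀ t).rateU < (D.erase w₀ t).rateY ∨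
      (D.erase w₀ t).rateU = 0 ∧ (D.erase w₀ t).rateY = 0 := by
    have hY : (D.erase w₀ t).rateY = D.rateY := rfl
    rw [erase_rateU, hY]
    rcases D.rateY_nonneg.eq_or_lt with h | h
    · refine Or.inr ⟨?_, h.symm⟩
      rw [le_antisymm (h ▸ hI) hU0, mul_zero]
    · refine Or.inl ?_
      rcases hU0.eq_or_lt with h' | h'
      · rwa [← h', mul_zero]
      · nlinarith
  refine (D.erase w₀ t).achievable hI' ?_
  have h1 : (R + ((D.erase w₀ t).rateUYV - D.rateUYV) / Real.log 2 + t) * Real.log 2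
      = R * Real.log 2 + ((D.erase w₀ t).rateUYV - D.rateUYV) + t * Real.log 2 := by field_simp
  change shannon D.pX - D.rateY + (D.erase w₀ t).rateUYV < _
  rw [h1]
  nlinarith

end AuxData

variable {𝒰 𝒳 𝒴 𝒱 : Type*} [Fintype 𝒰] [Fintype 𝒳] [Fintype 𝒴] [Fintype 𝒱]

theorem innerRegion_subset_region {pU : 𝒰 → ℝ} (hU : pU ∈ stdSimplex ℝ 𝒰) {pYX : 𝒳 → 𝒴 → ℝ}
    (hYX : IsKernel pYX) :
    (innerRegion pU pYX : Set ((𝒰 × 𝒳 × 𝒴 × 𝒱 → ℝ) × ℝ)) ⊆ region pU pYX := by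
  rintro ⟨P, R⟩ ⟨m, Q, ⟨⟨pX, hX, -, pW, pV, hW, hV, rfl⟩, hP, hI⟩, hR⟩
  let D : AuxData 𝒰 𝒳 𝒴 𝒱 (Fin m) := ⟨pU, hU, pX, hX, pW, hW, pYX, hYX, pV, hV⟩
  have hlog : 0 < Real.log 2 := Real.log_pos one_lt_two
  have hPD : D.target = P := by
    rw [← show _ = P from hP]
    exact funext fun z => (D.marg_law_UXYV z).symm
  have hI' : D.rateU / Real.log 2 ≤ D.rateY / Real.log 2 := by
    rw [← D.mutualInfo_law_U, ← D.mutualInfo_law_Y]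
    exact hI
  have hR' : (shannon D.pX - D.rateY + D.rateUYV) / Real.log 2 ≤ R :=
    D.condMutualInfo_add_condEntropy ▸ hR
  rw [div_le_div_iff_of_pos_right hlog] at hI'
  rw [div_le_iff₀ hlog] at hR'
  exact hPD ▸ D.mem_region hI' hR'

end

end StrongCoord

end

theorem theorem1 {𝒰 𝒳 𝒴 𝒱 : Type*} [Fintype 𝒰] [Fintype 𝒳] [Fintype 𝒴] [Fintype 𝒱]
    (pU : 𝒰 → ℝ) (hU : pU ∈ stdSimplex ℝ 𝒰)
    (pYX : 𝒳 → 𝒴 → ℝ) (hYX : StrongCoord.IsKernel pYX) :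
    (StrongCoord.innerRegion pU pYX : Set ((𝒰 × 𝒳 × 𝒴 × 𝒱 → ℝ) × ℝ))
        ⊆ StrongCoord.region pU pYX ∧
      (StrongCoord.region pU pYX : Set ((𝒰 × 𝒳 × 𝒴 × 𝒱 → ℝ) × ℝ))
        ⊆ StrongCoord.outerRegion pU pYX := by
  exact ⟨StrongCoord.innerRegion_subset_region hU hYX, StrongCoord.region_subset_outerRegion hU hYX⟩
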